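/- An instance consists of a ground set $U$ of $n$ elements and a family $\mathcal S\subseteq 2^U$ of $m$ subsets of $U$. A sub-cover is a subfamily $\mathcal S'\subseteq\mathcal S$ whose union is $U$. Exact Cover asks to decide whether there is a sub-cover whose members are pairwise disjoint; Set Cover asks to find a sub-cover of minimal size (or to report that there is no sub-cover). A problem can be solved in time $O^*(f(n))$ if there are a program (for a random access machine with logarithmic cost) and constants $C,c$ such that on every instance the program halts within time $C\,(n+m+1)^c f(n)$ and gives a correct answer. The program may be deterministic, with an answer that is always correct, or a Monte Carlo algorithm, for which the time bound holds for all outcomes of its coin flips and the answer is correct with probability at least $2/3$. Let $\gamma>0$. If Exact Cover on $n$ elements can be solved in time $O^*(2^{(1-\gamma)n})$, then there exists a constant $\delta>0$ such that Set Cover on $n$ elements can be solved in time $O^*(2^{(1-\delta)n})$. This holds if "solved" refers to Monte Carlo algorithms both in the hypothesis and in the conclusion, and also if it refers to deterministic algorithms in both. -/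

import Mathlib

namespace RAM

/-! ## Random access machines with logarithmic cost and fair coins -/

/-- The memory of the machine: cell `a` holds the natural number `s a`. -/
abbrev Mem := ℕ → ℕ

/-- The machine's operations on two numbers. -/
inductive BinOp where
  | add | sub | mul | div | mod | land | lor | xor | lt | eq

/-- The value of an operation. Subtraction is truncated, and comparisons return `0` or `1`. -/
def BinOp.eval : BinOp → ℕ → ℕ → ℕ
  | .add, x, y => x + y
  | .sub, x, y => x - y
  | .mul, x, y => x * y
  | .div, x, y => x / y
  | .mod, x, y => x % y
  | .land, x, y => x &&& y
  | .lor, x, y => x ||| y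
  | .xor, x, y => x ^^^ y
  | .lt, x, y => if x < y then 1 else 0
  | .eq, x, y => if x = y then 1 else 0

/-- Expressions: constants, the content of the cell whose address is the value of an expression,
and operations. -/
inductive Expr where
  | const (k : ℕ)
  | load (e : Expr)
  | op (o : BinOp) (e₁ e₂ : Expr)

/-- The value of an expression in memory `s`. -/
def Expr.eval (s : Mem) : Expr → ℕ
  | .const k => k
  | .load e => s (e.eval s)
  | .op o e₁ e₂ => o.eval (e₁.eval s) (e₂.eval s)

/-- The logarithmic cost of evaluating an expression: every number that occurs, as an address, an
operand or a result, is charged its length in binary, and every operation is charged one more. -/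
def Expr.cost (s : Mem) : Expr → ℕ
  | .const k => Nat.size k + 1
  | .load e => e.cost s + Nat.size ((Expr.load e).eval s) + 1
  | .op o e₁ e₂ => e₁.cost s + e₂.cost s + Nat.size ((Expr.op o e₁ e₂).eval s) + 1

/-- Programs. A program is a finite object that does not depend on the input. -/
inductive Prog where
  /-- Do nothing. -/
  | skip
  /-- Write the value of `e` into the cell whose address is the value of `a`. -/
  | store (a e : Expr)
  /-- Write a fair random bit into the cell whose address is the value of `a`. -/
  | flip (a : Expr)
  /-- First `c`, then `d`. -/
  | seq (c d : Prog)
  /-- If the value of `e` is not `0` then `c`, else `d`. -/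
  | cond (e : Expr) (c d : Prog)
  /-- As long as the value of `e` is not `0`, do `c`. -/
  | loop (e : Expr) (c : Prog)

/-- A program is deterministic if it contains no coin flip. -/
def Prog.Deterministic : Prog → Prop
  | .skip => True
  | .store _ _ => True
  | .flip _ => False
  | .seq c d => c.Deterministic ∧ d.Deterministic
  | .cond _ c d => c.Deterministic ∧ d.Deterministic
  | .loop _ c => c.Deterministic

/-- `Exec c s μ`: started in memory `s`, the program `c` halts for all outcomes of its coin flips,
and `μ` is the joint distribution of the final memory and of the running time. The coin flips of
one run are independent. -/
inductive Exec : Prog → Mem → PMF (Mem × ℕ) → Prop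
  | skip (s : Mem) : Exec .skip s (PMF.pure (s, 1))
  | store (a e : Expr) (s : Mem) :
      Exec (.store a e) s
        (PMF.pure (Function.update s (a.eval s) (e.eval s), a.cost s + e.cost s + 1))
  | flip (a : Expr) (s : Mem) :
      Exec (.flip a) s
        ((PMF.uniformOfFintype Bool).map fun b =>
          (Function.update s (a.eval s) b.toNat, a.cost s + 1))
  | seq (c d : Prog) (s : Mem) (μ : PMF (Mem × ℕ)) (ν : Mem → PMF (Mem × ℕ))
      (hc : Exec c s μ) (hd : ∀ p ∈ μ.support, Exec d p.1 (ν p.1)) :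
      Exec (.seq c d) s (μ.bind fun p => (ν p.1).map fun q => (q.1, p.2 + q.2))
  | cond_true (e : Expr) (c d : Prog) (s : Mem) (μ : PMF (Mem × ℕ))
      (he : e.eval s ≠ 0) (hc : Exec c s μ) :
      Exec (.cond e c d) s (μ.map fun p => (p.1, e.cost s + 1 + p.2))
  | cond_false (e : Expr) (c d : Prog) (s : Mem) (μ : PMF (Mem × ℕ))
      (he : e.eval s = 0) (hd : Exec d s μ) :
      Exec (.cond e c d) s (μ.map fun p => (p.1, e.cost s + 1 + p.2))
  | loop_stop (e : Expr) (c : Prog) (s : Mem) (he : e.eval s = 0) :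
      Exec (.loop e c) s (PMF.pure (s, e.cost s + 1))
  | loop_step (e : Expr) (c : Prog) (s : Mem) (μ : PMF (Mem × ℕ)) (ν : Mem → PMF (Mem × ℕ))
      (he : e.eval s ≠ 0) (hc : Exec c s μ)
      (hl : ∀ p ∈ μ.support, Exec (.loop e c) p.1 (ν p.1)) :
      Exec (.loop e c) s
        (μ.bind fun p => (ν p.1).map fun q => (q.1, e.cost s + 1 + p.2 + q.2))

/-! ## Covering problems -/

/-- A ground set of `n` elements and a family of `m` (distinct) subsets of it, which is listed in
some order. -/
structure SetSystem where
  /-- The number of elements. -/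
  n : ℕ
  /-- The number of sets. -/
  m : ℕ
  /-- The sets. -/
  S : Fin m → Finset (Fin n)
  /-- The sets of the family are distinct. -/
  inj : Function.Injective S

/-- The subfamily with index set `A` is a sub-cover: its union is the ground set. -/
def SetSystem.IsSubCover (I : SetSystem) (A : Finset (Fin I.m)) : Prop :=
  A.biUnion I.S = Finset.univ

/-- The sub-covers of minimal size. -/
def SetSystem.IsMinSubCover (I : SetSystem) (A : Finset (Fin I.m)) : Prop :=
  I.IsSubCover A ∧ ∀ B : Finset (Fin I.m), I.IsSubCover B → A.card ≤ B.card

/-- Some sub-cover consists of pairwise disjoint sets. -/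
def SetSystem.HasExactCover (I : SetSystem) : Prop :=
  ∃ A : Finset (Fin I.m), I.IsSubCover A ∧ (A : Set (Fin I.m)).PairwiseDisjoint I.S

/-- The memory that holds the input: `n` in cell `0`, `m` in cell `1`, then the `m × n` incidence
matrix row by row; all other cells are `0`. -/
def SetSystem.input (I : SetSystem) : Mem
  | 0 => I.n
  | 1 => I.m
  | a + 2 => if ∃ (i : Fin I.m) (j : Fin I.n), a = i * I.n + j ∧ j ∈ I.S i then 1 else 0

/-- A computational problem on set systems: which final memories are correct answers. -/
abbrev Problem := SetSystem → Mem → Prop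

/-- Exact Cover, a decision problem: the answer is a bit in cell `0`. -/
def ExactCover : Problem := fun I s =>
  (I.HasExactCover → s 0 = 1) ∧ (¬ I.HasExactCover → s 0 = 0)

/-- Set Cover, an optimization problem: cell `0` tells whether there is a sub-cover, and if there
is one, then cells `1, …, m` hold the characteristic vector of a sub-cover of minimal size. -/
def SetCover : Problem := fun I s =>
  ((∃ A, I.IsSubCover A) →
    s 0 = 1 ∧ ∃ A, I.IsMinSubCover A ∧ ∀ i : Fin I.m, s (1 + i) = if i ∈ A then 1 else 0) ∧
  ((¬ ∃ A, I.IsSubCover A) → s 0 = 0)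

/-! ## Solvability in time `O*(f(n))` -/

/-- The problem `Q` can be solved in time `O*(f(n))` by a Monte Carlo algorithm: on every instance
the program halts within `C · (n + m + 1) ^ c · f(n)` steps for all outcomes of its coin flips, and
its answer is correct with probability at least `2/3`. -/
def MonteCarloSolvable (Q : Problem) (f : ℕ → ℝ) : Prop :=
  ∃ (P : Prog) (C c : ℕ), ∀ I : SetSystem, ∃ μ : PMF (Mem × ℕ),
    Exec P I.input μ ∧
    (∀ p ∈ μ.support, (p.2 : ℝ) ≤ C * ((I.n : ℝ) + I.m + 1) ^ c * f I.n) ∧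
    2 / 3 ≤ μ.toOuterMeasure {p | Q I p.1}

/-- The problem `Q` can be solved in time `O*(f(n))` by a deterministic algorithm. -/
def DetSolvable (Q : Problem) (f : ℕ → ℝ) : Prop :=
  ∃ (P : Prog) (C c : ℕ), P.Deterministic ∧ ∀ I : SetSystem, ∃ μ : PMF (Mem × ℕ),
    Exec P I.input μ ∧
    ∀ p ∈ μ.support, (p.2 : ℝ) ≤ C * ((I.n : ℝ) + I.m + 1) ^ c * f I.n ∧ Q I p.1

end RAM

namespace RAM

open scoped ENNReal

/-! ## Expected values -/

/-! Combinatorial core. Fix a constant `t` and let `A` be a cover. Assign to every element one set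
of `A` that contains it, list the elements so that those with the same assigned set are consecutive,
and cut the list into `t` chunks of at most `n / t + 1` elements. At most `t` sets are in use at the
first position of some chunk; every other set serves the elements of at most one chunk. Guess these
exceptional sets, and for each chunk the number of other sets that serve it: there are only `(m + 1)
^ (2 * t)` guesses. Given a guess, let `V` be the union of the exceptional sets and, for small `X`,
let `F X` be the number of sets needed to cover `X` outside of `V`. A partition of the ground set
into small sets `X j` with `F (X j)` at most the guessed numbers is then an exact cover, once `t`
new elements serve as labels of the chunks. Conversely, each such partition gives a cover that costs
no more than the guess. These directions are `exists_guess_of_cover` and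
`exists_cover_of_hasExactCover`; minimizing over all guesses gives the minimal size of a cover.

Time. For large `t` the number of subsets with at most `n / t + 1` elements is below `2 ^ (ε n)`, up
to a constant factor, for any prescribed `ε` (`exists_length_smallList_le`). Hence the table `F`,
the size of the Exact Cover instance and the polynomial dependence of the solver on that size
together cost only a fraction of the gain `γ`, and about half of the gain is left (`exists_sum_le`).

From size to solution. Delete each set in turn if the minimal size of a cover stays the same.
Afterwards every remaining nonempty set belongs to every minimal cover, so these sets form one
(`SetSystem.isMinSubCover_of_needed`).

Error. Each Exact Cover question is asked repeatedly and decided by majority. A potential in the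
number of wrong answers, whose expectation is followed through the loop, replaces the usual tail
bound (`repProg_spec`, `amplifies_third`); a union bound over all questions finishes. The
deterministic case is the same argument with error `0` (`amplifies_zero`).

Machine. The given solver expects a memory that is blank except for its input, and leaves unknown
contents behind. The memory is therefore interleaved into polynomially many infinite segments, and
each run of the solver gets a fresh one; relocation preserves the distribution of results and costs
a polynomial factor (`reloc_exec`). Programs are verified by triples `HT`, which combine a time
bound, a sure postcondition and a bound on an expected value. -/

/-- The expected value of `f` under `μ`. -/
noncomputable def ev {α : Type*} (μ : PMF α) (f : α → ℝ≥0∞) : ℝ≥0∞ := ∑' a, μ a * f a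

lemma ev_pure {α : Type*} (a : α) (f : α → ℝ≥0∞) : ev (PMF.pure a) f = f a := by
  classical
  unfold ev
  rw [tsum_eq_single a]
  · simp [PMF.pure_apply]
  · intro b hb
    simp [PMF.pure_apply, hb]

lemma ev_bind {α β : Type*} (μ : PMF α) (k : α → PMF β) (f : β → ℝ≥0∞) :
    ev (μ.bind k) f = ev μ fun a => ev (k a) f := by
  unfold ev
  simp_rw [PMF.bind_apply, ← ENNReal.tsum_mul_right, ← ENNReal.tsum_mul_left]
  rw [ENNReal.tsum_comm]
  simp_rw [mul_assoc]

lemma ev_map {α β : Type*} (μ : PMF α) (g : α → β) (f : β → ℝ≥0∞) :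
    ev (μ.map g) f = ev μ fun a => f (g a) := by
  unfold PMF.map
  rw [ev_bind]
  simp [ev_pure]

lemma ev_mono {α : Type*} {μ : PMF α} {f g : α → ℝ≥0∞} (h : ∀ a ∈ μ.support, f a ≤ g a) :
    ev μ f ≤ ev μ g := by
  refine ENNReal.tsum_le_tsum fun a => ?_
  by_cases ha : μ a = 0
  · simp [ha]
  · exact mul_le_mul_right (h a ha) _

lemma ev_const {α : Type*} (μ : PMF α) (c : ℝ≥0∞) : ev μ (fun _ => c) = c := by
  unfold ev
  rw [ENNReal.tsum_mul_right, μ.tsum_coe, one_mul]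

lemma ev_add {α : Type*} (μ : PMF α) (f g : α → ℝ≥0∞) :
    ev μ (fun a => f a + g a) = ev μ f + ev μ g := by
  unfold ev
  simp_rw [mul_add]
  exact ENNReal.tsum_add

lemma ev_mul {α : Type*} (μ : PMF α) (c : ℝ≥0∞) (f : α → ℝ≥0∞) :
    ev μ (fun a => c * f a) = c * ev μ f := by
  unfold ev
  rw [← ENNReal.tsum_mul_left]
  exact tsum_congr fun a => by ring

/-- The indicator of a proposition. -/
noncomputable def ind (p : Prop) : ℝ≥0∞ := by
  classical exact if p then 1 else 0

lemma ind_true {p : Prop} (h : p) : ind p = 1 := if_pos h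

lemma ind_false {p : Prop} (h : ¬ p) : ind p = 0 := if_neg h

lemma ind_le_one (p : Prop) : ind p ≤ 1 := by
  by_cases h : p
  · rw [ind_true h]
  · rw [ind_false h]; exact zero_le_one

lemma ev_ind {α : Type*} (μ : PMF α) (p : α → Prop) :
    ev μ (fun a => ind (p a)) = μ.toOuterMeasure {a | p a} := by
  classical
  rw [PMF.toOuterMeasure_apply]
  unfold ev
  refine tsum_congr fun a => ?_
  by_cases h : p a
  · simp only [ind_true h]; simp [h]
  · simp only [ind_false h]; simp [h]

/-! ## Costs of expressions -/

/-- The number of nodes of an expression, constants counting with their length. -/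
def Expr.wt : Expr → ℕ
  | .const k => Nat.size k + 1
  | .load e => e.wt + 1
  | .op _ a b => a.wt + b.wt + 1

/-- All numbers that are loaded in the evaluation of an expression have length at most `b`. -/
def Expr.LoadsLe (s : Mem) (b : ℕ) : Expr → Prop
  | .const _ => True
  | .load e => e.LoadsLe s b ∧ Nat.size (s (e.eval s)) ≤ b
  | .op _ x y => x.LoadsLe s b ∧ y.LoadsLe s b

lemma size_le_of_le_pow {x k : ℕ} (h : x < 2 ^ k) : Nat.size x ≤ k := Nat.size_le.2 h

lemma lt_pow_size (x : ℕ) : x < 2 ^ Nat.size x := Nat.lt_size_self x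

lemma size_add_le (x y : ℕ) : Nat.size (x + y) ≤ Nat.size x + Nat.size y + 1 := by
  refine size_le_of_le_pow ?_
  have h1 := lt_pow_size x
  have h2 := lt_pow_size y
  have h3 : 2 ^ Nat.size x ≤ 2 ^ (Nat.size x + Nat.size y) :=
    Nat.pow_le_pow_right (by norm_num) (by omega)
  have h4 : 2 ^ Nat.size y ≤ 2 ^ (Nat.size x + Nat.size y) :=
    Nat.pow_le_pow_right (by norm_num) (by omega)
  rw [pow_succ]
  omega

lemma size_mul_le (x y : ℕ) : Nat.size (x * y) ≤ Nat.size x + Nat.size y := by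
  refine size_le_of_le_pow ?_
  rw [pow_add]
  exact Nat.mul_lt_mul'' (lt_pow_size x) (lt_pow_size y)

lemma size_le_self (x : ℕ) : Nat.size x ≤ x := size_le_of_le_pow Nat.lt_two_pow_self

lemma BinOp.size_eval_le (o : BinOp) (x y : ℕ) :
    Nat.size (o.eval x y) ≤ Nat.size x + Nat.size y + 1 := by
  have hm : max (Nat.size x) (Nat.size y) ≤ Nat.size x + Nat.size y := by omega
  have hx : x < 2 ^ max (Nat.size x) (Nat.size y) :=
    (lt_pow_size x).trans_le (Nat.pow_le_pow_right (by norm_num) (le_max_left _ _))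
  have hy : y < 2 ^ max (Nat.size x) (Nat.size y) :=
    (lt_pow_size y).trans_le (Nat.pow_le_pow_right (by norm_num) (le_max_right _ _))
  cases o
  · exact size_add_le x y
  · exact (Nat.size_le_size (Nat.sub_le x y)).trans (by omega)
  · exact (size_mul_le x y).trans (by omega)
  · exact (Nat.size_le_size (Nat.div_le_self x y)).trans (by omega)
  · exact (Nat.size_le_size (Nat.mod_le x y)).trans (by omega)
  · exact (size_le_of_le_pow (Nat.and_lt_two_pow x hy)).trans (by omega)
  · exact (size_le_of_le_pow (Nat.or_lt_two_pow hx hy)).trans (by omega)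
  · exact (size_le_of_le_pow (Nat.xor_lt_two_pow hx hy)).trans (by omega)
  · have : BinOp.lt.eval x y ≤ 1 := by simp only [BinOp.eval]; split_ifs <;> omega
    exact (Nat.size_le_size this).trans (by simp)
  · have : BinOp.eq.eval x y ≤ 1 := by simp only [BinOp.eval]; split_ifs <;> omega
    exact (Nat.size_le_size this).trans (by simp)

/-- An operation produces a number whose length is at most the sum of the lengths of its operands
plus one, so lengths add up along the tree, and a load resets them to at most `b`. -/
lemma Expr.size_eval_lt {s : Mem} {b : ℕ} {e : Expr} (h : e.LoadsLe s b) :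
    Nat.size (e.eval s) + 1 ≤ e.wt * (b + 1) := by
  induction e with
  | const k => simp only [Expr.eval, Expr.wt]; nlinarith
  | load e _ => simp only [Expr.eval, Expr.wt]; have := h.2; nlinarith [Nat.zero_le (e.wt * (b+1))]
  | op o x y ihx ihy =>
    have := o.size_eval_le (x.eval s) (y.eval s)
    have h1 := ihx h.1
    have h2 := ihy h.2
    simp only [Expr.eval, Expr.wt]
    nlinarith

/-- Every node is charged a length that is linear in the weight below it; hence the square. -/
lemma Expr.cost_le {s : Mem} {b : ℕ} {e : Expr} (h : e.LoadsLe s b) :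
    e.cost s ≤ e.wt ^ 2 * (b + 1) := by
  induction e with
  | const k => simp only [Expr.cost, Expr.wt]; nlinarith [Nat.zero_le b, Nat.zero_le (Nat.size k), Nat.zero_le (Nat.size k * b)]
  | load e ih =>
    have h1 := ih h.1
    have h2 := Expr.size_eval_lt h
    simp only [Expr.cost]
    rw [Expr.wt] at h2 ⊢
    nlinarith [Nat.zero_le (e.wt * (b+1))]
  | op o x y ihx ihy =>
    have h1 := ihx h.1
    have h2 := ihy h.2
    have h3 := Expr.size_eval_lt h
    simp only [Expr.cost]
    rw [Expr.wt] at h3 ⊢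
    have e1 : (x.wt + y.wt + 1) ^ 2 * (b + 1) = x.wt ^ 2 * (b+1) + y.wt ^ 2 * (b+1)
      + (x.wt + y.wt + 1) * (b + 1) + (2 * x.wt * y.wt + x.wt + y.wt) * (b+1) := by ring
    rw [e1]
    have := Nat.zero_le ((2 * x.wt * y.wt + x.wt + y.wt) * (b+1))
    omega

/-! ## A segmented memory -/

/-- The expression for the number of cells that hold the input. -/
def inputSizeExpr : Expr :=
  .op .add (.const 2) (.op .mul (.load (.const 0)) (.load (.const 1)))

/-- The address of the cell with a given index in a given segment. -/
def addrExpr (TE seg idx : Expr) : Expr :=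
  .op .add (.op .add inputSizeExpr (.op .mul idx TE)) seg

/-- The parameters of the segmented memory: the numbers of elements and sets, the number of
segments, a bound on the lengths of the numbers in the first eight segments, and the time unit. -/
structure Layout where
  n : ℕ
  m : ℕ
  T : ℕ
  b : ℕ
  w : ℕ
  TE : Expr
  hT : 8 < T
  hn : n < 2 ^ b
  hm : m < 2 ^ b
  eval_TE : ∀ s : Mem, s 0 = n → s 1 = m → TE.eval s = T
  loads_TE : ∀ s : Mem, s 0 = n → s 1 = m → TE.LoadsLe s b
  hw : 2 * (100 * (TE.wt + 20)) ^ 2 * (b + 1) + 1 ≤ w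

/-- The content of the memory by segments. -/
abbrev Segs := ℕ → ℕ → ℕ

/-- Writing into a cell of a segment. -/
def Segs.set (v : Segs) (σ i x : ℕ) : Segs := fun σ' i' => if σ' = σ ∧ i' = i then x else v σ' i'

namespace Layout

variable (Γ : Layout)

/-- The number of cells that hold the input. -/
def R : ℕ := 2 + Γ.n * Γ.m

/-- The address of cell `i` of segment `σ`. -/
def addr (σ i : ℕ) : ℕ := Γ.R + i * Γ.T + σ

/-- The segments of a memory; segment `7` holds the input. -/
def segs (s : Mem) : Segs := fun σ i =>
  if σ = 7 then (if i < Γ.R then s i else 0) else if σ < Γ.T then s (Γ.addr σ i) else 0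

lemma T_pos : 0 < Γ.T := by have := Γ.hT; omega

/-- Behind the input, the segments are the residue classes modulo `T`. Interleaving makes all of
them infinite, which is needed because nothing is known in advance about the addresses that the
solver uses. -/
lemma addr_inj {σ i σ' i' : ℕ} (h : σ < Γ.T) (h' : σ' < Γ.T) :
    Γ.addr σ i = Γ.addr σ' i' ↔ σ = σ' ∧ i = i' := by
  constructor
  · intro e
    unfold addr at e
    have e' : σ + i * Γ.T = σ' + i' * Γ.T := by omega
    have h1 : (σ + i * Γ.T) % Γ.T = (σ' + i' * Γ.T) % Γ.T := by rw [e']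
    rw [Nat.add_mul_mod_self_right, Nat.add_mul_mod_self_right, Nat.mod_eq_of_lt h,
      Nat.mod_eq_of_lt h'] at h1
    subst h1
    exact ⟨rfl, Nat.eq_of_mul_eq_mul_right Γ.T_pos (by omega)⟩
  · rintro ⟨rfl, rfl⟩; rfl

lemma R_le_addr (σ i : ℕ) : Γ.R ≤ Γ.addr σ i := by unfold addr; omega

lemma segs_update {σ : ℕ} (hσ : σ < Γ.T) (h7 : σ ≠ 7) (s : Mem) (i x : ℕ) :
    Γ.segs (Function.update s (Γ.addr σ i) x) = (Γ.segs s).set σ i x := by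
  funext σ' i'
  unfold segs Segs.set
  have hR := Γ.R_le_addr σ i
  by_cases h1 : σ' = 7
  · subst h1
    have : ¬ (7 = σ ∧ i' = i) := fun h => h7 h.1.symm
    simp only [this, if_true, if_false]
    split_ifs with h2
    · rw [Function.update_of_ne (by omega)]
    · rfl
  · by_cases h2 : σ' < Γ.T
    · simp only [h1, h2, if_true, if_false, Function.update_apply, Γ.addr_inj h2 hσ]
    · have : ¬ (σ' = σ ∧ i' = i) := fun h => h2 (h.1 ▸ hσ)
      simp only [h1, h2, this, if_false]

lemma segs_update_input {a : ℕ} (ha : a < Γ.R) (s : Mem) (x : ℕ) :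
    Γ.segs (Function.update s a x) = (Γ.segs s).set 7 a x := by
  funext σ' i'
  unfold segs Segs.set
  by_cases h1 : σ' = 7
  · subst h1
    simp only [if_true, true_and, Function.update_apply]
    split_ifs with h2 h3 h3 <;> first | rfl | omega
  · have := Γ.R_le_addr σ' i'
    simp only [h1, if_false, false_and]
    rw [Function.update_of_ne (by omega)]

/-- The memory holds `n` and `m`, and the numbers in the first eight segments are small. -/
def WF (s : Mem) : Prop :=
  s 0 = Γ.n ∧ s 1 = Γ.m ∧ ∀ σ < 8, ∀ i, Γ.segs s σ i < 2 ^ Γ.b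

lemma segs_input_zero (s : Mem) : Γ.segs s 7 0 = s 0 := by simp [segs, R]

lemma segs_input_one (s : Mem) : Γ.segs s 7 1 = s 1 := by
  have : 1 < Γ.R := by unfold R; omega
  simp [segs, this]

/-- The length bound concerns only the segments below `8`; the segments from `8` on are left to the
solver and may hold numbers of any length. -/
lemma WF.update {Γ : Layout} {s : Mem} (h : Γ.WF s) {σ : ℕ} (hσ : σ < Γ.T) (h7 : σ ≠ 7) (i x : ℕ)
    (hx : σ < 8 → x < 2 ^ Γ.b) : Γ.WF (Function.update s (Γ.addr σ i) x) := by
  have hR := Γ.R_le_addr σ i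
  have h2 : 2 ≤ Γ.R := by unfold R; omega
  refine ⟨?_, ?_, ?_⟩
  · rw [Function.update_of_ne (by omega)]; exact h.1
  · rw [Function.update_of_ne (by omega)]; exact h.2.1
  · intro σ' hσ' i'
    rw [Γ.segs_update hσ h7]
    unfold Segs.set
    split_ifs with hc
    · exact hx (hc.1 ▸ hσ')
    · exact h.2.2 σ' hσ' i'

end Layout

/-- Expressions over the segmented memory. -/
inductive SExpr where
  | k (c : ℕ)
  | n
  | m
  | ld (σ : ℕ) (i : SExpr)
  | op (o : BinOp) (a b : SExpr)

namespace SExpr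

/-- The value of an expression. -/
def eval (v : Segs) : SExpr → ℕ
  | .k c => c
  | .n => v 7 0
  | .m => v 7 1
  | .ld σ i => v σ (i.eval v)
  | .op o a b => o.eval (a.eval v) (b.eval v)

/-- The translation into an expression over the memory of the machine. -/
def comp (TE : Expr) : SExpr → Expr
  | .k c => .const c
  | .n => .load (.const 0)
  | .m => .load (.const 1)
  | .ld σ i => .load (addrExpr TE (.const σ) (i.comp TE))
  | .op o a b => .op o (a.comp TE) (b.comp TE)

/-- The expression reads only from the first seven segments. -/
def ok : SExpr → Bool
  | .k _ => true
  | .n => true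
  | .m => true
  | .ld σ i => σ < 7 && i.ok
  | .op _ a b => a.ok && b.ok

/-- The size of an expression. -/
def wt : SExpr → ℕ
  | .k c => c + 1
  | .n => 1
  | .m => 1
  | .ld σ i => i.wt + σ + 1
  | .op _ a b => a.wt + b.wt + 1

/-- The number of segments depends on the input, so every address computation recomputes it from the
cells `0` and `1`. This is why `Layout.WF` keeps `n` and `m` there during the whole computation. -/
lemma comp_spec {Γ : Layout} {s : Mem} (h : Γ.WF s) (e : SExpr) (he : e.ok) :
    (e.comp Γ.TE).eval s = e.eval (Γ.segs s) ∧ (e.comp Γ.TE).LoadsLe s Γ.b := by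
  induction e with
  | k c => exact ⟨rfl, trivial⟩
  | n =>
    refine ⟨?_, trivial, ?_⟩
    · simp [comp, eval, Expr.eval, Γ.segs_input_zero]
    · simp only [Expr.eval, h.1]; exact size_le_of_le_pow Γ.hn
  | m =>
    refine ⟨?_, trivial, ?_⟩
    · simp [comp, eval, Expr.eval, Γ.segs_input_one]
    · simp only [Expr.eval, h.2.1]; exact size_le_of_le_pow Γ.hm
  | ld σ i ih =>
    simp only [ok, Bool.and_eq_true, decide_eq_true_eq] at he
    obtain ⟨h1, h2⟩ := ih he.2
    have hT := Γ.hT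
    have e1 : (addrExpr Γ.TE (.const σ) (i.comp Γ.TE)).eval s = Γ.addr σ (i.eval (Γ.segs s)) := by
      simp [addrExpr, inputSizeExpr, Expr.eval, BinOp.eval, h.1, h.2.1, h1,
        Γ.eval_TE s h.1 h.2.1, Layout.addr, Layout.R]
    have e2 : s (Γ.addr σ (i.eval (Γ.segs s))) = Γ.segs s σ (i.eval (Γ.segs s)) := by
      have h7 : σ ≠ 7 := by omega
      have : σ < Γ.T := by omega
      simp [Layout.segs, h7, this]
    refine ⟨?_, ⟨?_, ?_⟩⟩
    · simp only [comp, Expr.eval, e1, e2, eval]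
    · refine ⟨⟨⟨trivial, ⟨trivial, ?_⟩, ⟨trivial, ?_⟩⟩, h2, Γ.loads_TE s h.1 h.2.1⟩, trivial⟩
      · simp only [Expr.eval, h.1]; exact size_le_of_le_pow Γ.hn
      · simp only [Expr.eval, h.2.1]; exact size_le_of_le_pow Γ.hm
    · rw [e1, e2]
      exact size_le_of_le_pow (h.2.2 σ (by omega) _)
  | op o a c iha ihc =>
    simp only [ok, Bool.and_eq_true] at he
    obtain ⟨h1, h2⟩ := iha he.1
    obtain ⟨h3, h4⟩ := ihc he.2
    exact ⟨by simp only [comp, Expr.eval, eval, h1, h3], h2, h4⟩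

/-- Each load expands into an address computation that contains one copy of `TE` and a bounded
number of further nodes. -/
lemma wt_comp_le (TE : Expr) (e : SExpr) : (e.comp TE).wt ≤ e.wt * (TE.wt + 20) := by
  induction e with
  | k c =>
    have := size_le_self c
    simp only [comp, wt, Expr.wt]; nlinarith [Nat.zero_le (c * TE.wt), Nat.zero_le TE.wt]
  | n => simp [comp, wt, Expr.wt]
  | m => simp [comp, wt, Expr.wt]
  | ld σ i ih =>
    have := size_le_self σ
    have h1 : Nat.size 1 = 1 := Nat.size_one
    have h2 : Nat.size 2 = 2 := by decide
    simp only [comp, wt, Expr.wt, addrExpr, inputSizeExpr, Nat.size_zero, h1, h2]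
    nlinarith [Nat.zero_le (σ * TE.wt)]
  | op o a b iha ihb =>
    simp only [comp, wt, Expr.wt]
    nlinarith

end SExpr

/-- The factor `2` lets an instruction that evaluates two expressions, an address and a value, fit
into one time unit `w`. -/
lemma Layout.expr_cost_le {Γ : Layout} {s : Mem} {e : Expr} (h : e.LoadsLe s Γ.b)
    (hw : e.wt ≤ 100 * (Γ.TE.wt + 20)) : 2 * e.cost s + 1 ≤ Γ.w := by
  refine le_trans ?_ Γ.hw
  have h1 := (Expr.cost_le h).trans (Nat.mul_le_mul_right (Γ.b + 1) (Nat.pow_le_pow_left hw 2))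
  rw [mul_assoc]
  generalize (100 * (Γ.TE.wt + 20)) ^ 2 * (Γ.b + 1) = X at *
  omega

lemma Layout.cost_le {Γ : Layout} {s : Mem} (h : Γ.WF s) (e : SExpr) (he : e.ok) (hw : e.wt ≤ 100) :
    2 * (e.comp Γ.TE).cost s + 1 ≤ Γ.w :=
  Layout.expr_cost_le (SExpr.comp_spec h e he).2
    ((SExpr.wt_comp_le Γ.TE e).trans (Nat.mul_le_mul_right _ hw))

lemma Layout.inputSizeExpr_spec {Γ : Layout} {s : Mem} (h : Γ.WF s) :
    inputSizeExpr.eval s = Γ.R ∧ inputSizeExpr.LoadsLe s Γ.b := by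
  refine ⟨by simp [inputSizeExpr, Expr.eval, BinOp.eval, h.1, h.2.1, Layout.R], trivial,
    ⟨trivial, ?_⟩, ⟨trivial, ?_⟩⟩
  · simp only [Expr.eval, h.1]; exact size_le_of_le_pow Γ.hn
  · simp only [Expr.eval, h.2.1]; exact size_le_of_le_pow Γ.hm

/-- The address of a cell of the segmented memory, as an expression over the memory of the
machine. -/
def SExpr.addr (TE : Expr) (σ i : SExpr) : Expr := addrExpr TE (σ.comp TE) (i.comp TE)

lemma SExpr.addr_spec {Γ : Layout} {s : Mem} (h : Γ.WF s) {σ i : SExpr} (hσ : σ.ok) (hi : i.ok)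
    (hw : σ.wt + i.wt ≤ 90) :
    (SExpr.addr Γ.TE σ i).eval s = Γ.addr (σ.eval (Γ.segs s)) (i.eval (Γ.segs s)) ∧
      2 * (SExpr.addr Γ.TE σ i).cost s + 1 ≤ Γ.w := by
  obtain ⟨h1, h2⟩ := SExpr.comp_spec h σ hσ
  obtain ⟨h3, h4⟩ := SExpr.comp_spec h i hi
  obtain ⟨h5, h6⟩ := Layout.inputSizeExpr_spec h
  refine ⟨?_, Layout.expr_cost_le ?_ ?_⟩
  · simp [SExpr.addr, addrExpr, Expr.eval, BinOp.eval, h1, h3, h5, Γ.eval_TE s h.1 h.2.1,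
      Layout.addr]
  · exact ⟨⟨h6, h4, Γ.loads_TE s h.1 h.2.1⟩, h2⟩
  · have h7 := SExpr.wt_comp_le Γ.TE σ
    have h8 := SExpr.wt_comp_le Γ.TE i
    have h9 : Nat.size 1 = 1 := Nat.size_one
    have h10 : Nat.size 2 = 2 := by decide
    simp only [SExpr.addr, addrExpr, inputSizeExpr, Expr.wt, Nat.size_zero, h9, h10]
    have h11 := Nat.mul_le_mul_right (Γ.TE.wt + 20) hw
    rw [Nat.add_mul] at h11
    generalize hy : Γ.TE.wt + 20 = y at *
    generalize σ.wt * y = x at *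
    generalize i.wt * y = z at *
    omega

/-! ## Triples -/

/-- Started in a memory with segments `v`, the program `c` halts within `t` steps in a memory whose
segments have the property `Q`, and the expected value of `W` is then at most `l`. -/
def HT (Γ : Layout) (c : Prog) (v : Segs) (t : ℕ) (Q : Segs → Prop) (W : Segs → ℝ≥0∞)
    (l : ℝ≥0∞) : Prop :=
  ∀ s, Γ.WF s → Γ.segs s = v → ∃ μ, Exec c s μ ∧
    (∀ p ∈ μ.support, p.2 ≤ t ∧ Γ.WF p.1 ∧ Q (Γ.segs p.1)) ∧
    ev μ (fun p => W (Γ.segs p.1)) ≤ l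

/-- Started in a memory with segments `v`, the program `c` halts within `t` steps in a memory whose
segments have the property `Q`. -/
def DT (Γ : Layout) (c : Prog) (v : Segs) (t : ℕ) (Q : Segs → Prop) : Prop :=
  HT Γ c v t Q (fun _ => 0) 0

section Rules

variable {Γ : Layout} {c d : Prog} {v : Segs} {t t' t₁ t₂ : ℕ} {Q Q' Q₁ : Segs → Prop}
  {W W' W₁ : Segs → ℝ≥0∞} {l l' : ℝ≥0∞}

lemma HT.mono (h : HT Γ c v t Q W l) (ht : t ≤ t') (hQ : ∀ v, Q v → Q' v)
    (hW : ∀ v, Q v → W' v ≤ W v) (hl : l ≤ l') : HT Γ c v t' Q' W' l' := by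
  intro s hs hv
  obtain ⟨μ, h1, h2, h3⟩ := h s hs hv
  exact ⟨μ, h1, fun p hp => ⟨(h2 p hp).1.trans ht, (h2 p hp).2.1, hQ _ (h2 p hp).2.2⟩,
    (ev_mono fun p hp => hW _ (h2 p hp).2.2).trans (h3.trans hl)⟩

lemma HT.of_sure (h : HT Γ c v t Q W l) (hW : ∀ v, Q v → W' v ≤ l') : HT Γ c v t Q W' l' := by
  intro s hs hv
  obtain ⟨μ, h1, h2, h3⟩ := h s hs hv
  exact ⟨μ, h1, h2, (ev_mono fun p hp => hW _ (h2 p hp).2.2).trans (ev_const μ l').le⟩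

lemma HT.add_const (h : HT Γ c v t Q W l) (x : ℝ≥0∞) :
    HT Γ c v t Q (fun v => W v + x) (l + x) := by
  intro s hs hv
  obtain ⟨μ, h1, h2, h3⟩ := h s hs hv
  refine ⟨μ, h1, h2, ?_⟩
  rw [ev_add, ev_const]
  exact add_le_add_left h3 x

lemma HT.mul_const (h : HT Γ c v t Q W l) (x : ℝ≥0∞) :
    HT Γ c v t Q (fun v => x * W v) (x * l) := by
  intro s hs hv
  obtain ⟨μ, h1, h2, h3⟩ := h s hs hv
  refine ⟨μ, h1, h2, ?_⟩
  rw [ev_mul]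
  exact mul_le_mul_right h3 x

lemma DT.mono (h : DT Γ c v t Q) (ht : t ≤ t') (hQ : ∀ v, Q v → Q' v) : DT Γ c v t' Q' :=
  HT.mono h ht hQ (fun _ _ => le_rfl) le_rfl

/-- The law of total expectation: `W₁` bounds the conditional expectation of `W`, given the
intermediate state. -/
lemma HT.seq (h₁ : HT Γ c v t₁ Q₁ W₁ l) (h₂ : ∀ v, Q₁ v → HT Γ d v t₂ Q W (W₁ v)) :
    HT Γ (.seq c d) v (t₁ + t₂) Q W l := by
  intro s hs hv
  obtain ⟨μ, h1, h2, h3⟩ := h₁ s hs hv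
  -- `Exec.seq` asks for a continuation at every memory; at memories that do not satisfy the
  -- intermediate assertion an arbitrary distribution will do.
  have key : ∀ s', ∃ ν, (Γ.WF s' ∧ Q₁ (Γ.segs s')) → Exec d s' ν ∧
      (∀ p ∈ ν.support, p.2 ≤ t₂ ∧ Γ.WF p.1 ∧ Q (Γ.segs p.1)) ∧
      ev ν (fun p => W (Γ.segs p.1)) ≤ W₁ (Γ.segs s') := by
    intro s'
    by_cases hc : Γ.WF s' ∧ Q₁ (Γ.segs s')
    · obtain ⟨ν, hν⟩ := h₂ _ hc.2 s' hc.1 rfl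
      exact ⟨ν, fun _ => hν⟩
    · exact ⟨PMF.pure (s', 0), fun h => absurd h hc⟩
  choose ν hν using key
  refine ⟨_, Exec.seq c d s μ ν h1 fun p hp => (hν p.1 (h2 p hp).2).1, ?_, ?_⟩
  · intro q hq
    rw [PMF.mem_support_bind_iff] at hq
    obtain ⟨p, hp, hq⟩ := hq
    rw [PMF.mem_support_map_iff] at hq
    obtain ⟨r, hr, rfl⟩ := hq
    have h4 := h2 p hp
    have h5 := (hν p.1 h4.2).2.1 r hr
    exact ⟨add_le_add h4.1 h5.1, h5.2⟩
  · rw [ev_bind]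
    refine le_trans (ev_mono fun p hp => ?_) h3
    rw [ev_map]
    exact (hν p.1 (h2 p hp).2).2.2

lemma HT.seq_right (h₁ : DT Γ c v t₁ Q₁) (h₂ : ∀ v, Q₁ v → HT Γ d v t₂ Q W l) :
    HT Γ (.seq c d) v (t₁ + t₂) Q W l :=
  HT.seq (HT.of_sure (W' := fun _ => l) h₁ fun _ _ => le_rfl) h₂

/-- For a second part that surely does not increase the weight; no expectation has to be taken
there. -/
lemma HT.seq_left (h₁ : HT Γ c v t₁ Q₁ W₁ l)
    (h₂ : ∀ v, Q₁ v → DT Γ d v t₂ (fun v' => Q v' ∧ W v' ≤ W₁ v)) :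
    HT Γ (.seq c d) v (t₁ + t₂) Q W l :=
  HT.seq h₁ fun v hv => ((h₂ v hv).of_sure fun _ h => h.2).mono le_rfl (fun _ h => h.1)
    (fun _ _ => le_rfl) le_rfl

lemma DT.seq (h₁ : DT Γ c v t₁ Q₁) (h₂ : ∀ v, Q₁ v → DT Γ d v t₂ Q) :
    DT Γ (.seq c d) v (t₁ + t₂) Q := HT.seq_right h₁ h₂

lemma HT.cond (e : SExpr) (he : e.ok) (hw : e.wt ≤ 100)
    (h₁ : e.eval v ≠ 0 → HT Γ c v t Q W l) (h₂ : e.eval v = 0 → HT Γ d v t Q W l) :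
    HT Γ (.cond (e.comp Γ.TE) c d) v (Γ.w + t) Q W l := by
  intro s hs hv
  have h3 := (SExpr.comp_spec hs e he).1
  have h4 := Layout.cost_le hs e he hw
  rw [hv] at h3
  have fin : ∀ μ : PMF (Mem × ℕ),
      (∀ p ∈ μ.support, p.2 ≤ t ∧ Γ.WF p.1 ∧ Q (Γ.segs p.1)) →
      ev μ (fun p => W (Γ.segs p.1)) ≤ l →
      (∀ p ∈ (μ.map fun p => (p.1, (e.comp Γ.TE).cost s + 1 + p.2)).support,
        p.2 ≤ Γ.w + t ∧ Γ.WF p.1 ∧ Q (Γ.segs p.1)) ∧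
      ev (μ.map fun p => (p.1, (e.comp Γ.TE).cost s + 1 + p.2)) (fun p => W (Γ.segs p.1)) ≤ l := by
    intro μ h5 h6
    refine ⟨?_, ?_⟩
    · intro q hq
      rw [PMF.mem_support_map_iff] at hq
      obtain ⟨r, hr, rfl⟩ := hq
      have := h5 r hr
      exact ⟨by simp only; omega, this.2⟩
    · rw [ev_map]; exact h6
  by_cases h0 : e.eval v = 0
  · obtain ⟨μ, h5, h6, h7⟩ := h₂ h0 s hs hv
    exact ⟨_, Exec.cond_false _ _ _ _ μ (h3.trans h0) h5, fin μ h6 h7⟩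
  · obtain ⟨μ, h5, h6, h7⟩ := h₁ h0 s hs hv
    exact ⟨_, Exec.cond_true _ _ _ _ μ (h3.trans_ne h0) h5, fin μ h6 h7⟩

lemma DT.skip (hQ : Q v) : DT Γ .skip v Γ.w Q := by
  intro s hs hv
  have h1 := Γ.hw
  refine ⟨_, Exec.skip s, fun p hp => ?_, ?_⟩
  · rw [PMF.mem_support_pure_iff] at hp
    subst hp
    exact ⟨by simp only; omega, hs, hv ▸ hQ⟩
  · rw [ev_pure]

/-- The program that writes into a cell of the segmented memory. -/
def setProg (TE : Expr) (σ i e : SExpr) : Prog := .store (SExpr.addr TE σ i) (e.comp TE)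

lemma DT.set {σ i e : SExpr} (hσ : σ.ok) (hi : i.ok) (he : e.ok) (hw : σ.wt + i.wt ≤ 90)
    (hw' : e.wt ≤ 100) (hT : σ.eval v < Γ.T) (h7 : σ.eval v ≠ 7)
    (hb : σ.eval v < 8 → e.eval v < 2 ^ Γ.b)
    (hQ : Q (v.set (σ.eval v) (i.eval v) (e.eval v))) :
    DT Γ (setProg Γ.TE σ i e) v Γ.w Q := by
  intro s hs hv
  obtain ⟨h1, h2⟩ := SExpr.addr_spec hs hσ hi hw
  have h3 := (SExpr.comp_spec hs e he).1
  have h4 := Layout.cost_le hs e he hw'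
  rw [hv] at h1 h3
  refine ⟨_, Exec.store _ _ s, fun p hp => ?_, ?_⟩
  · rw [PMF.mem_support_pure_iff] at hp
    subst hp
    simp only [h1, h3]
    refine ⟨by omega, hs.update hT h7 _ _ hb, ?_⟩
    rw [Γ.segs_update hT h7, hv]
    exact hQ
  · rw [ev_pure]

/-- `L` is a supermartingale along the loop: by induction on the number of remaining rounds, its
expected final value is at most its present one. The number of rounds is fixed by the invariant and
not random. -/
lemma HT.loop (e : SExpr) (he : e.ok) (hw : e.wt ≤ 100) (N t : ℕ) (Inv : ℕ → Segs → Prop)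
    (L : ℕ → Segs → ℝ≥0∞)
    (hN : ∀ v, Inv N v → e.eval v = 0)
    (hstep : ∀ i < N, ∀ v, Inv i v → e.eval v ≠ 0 ∧ HT Γ c v t (Inv (i + 1)) (L (i + 1)) (L i v))
    (i : ℕ) (hi : i ≤ N) (v : Segs) (hv : Inv i v) :
    HT Γ (.loop (e.comp Γ.TE) c) v ((N - i) * (Γ.w + t) + Γ.w) (Inv N) (L N) (L i v) := by
  obtain ⟨k, hk⟩ : ∃ k, N = i + k := ⟨N - i, by omega⟩
  induction k generalizing i v with
  | zero =>
    simp only [Nat.add_zero] at hk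
    subst hk
    intro s hs hsv
    have h3 := (SExpr.comp_spec hs e he).1
    have h4 := Layout.cost_le hs e he hw
    rw [hsv, hN v hv] at h3
    refine ⟨_, Exec.loop_stop _ _ s h3, fun p hp => ?_, ?_⟩
    · rw [PMF.mem_support_pure_iff] at hp
      subst hp
      exact ⟨by simp only; omega, hs, hsv ▸ hv⟩
    · rw [ev_pure, hsv]
  | succ k ih =>
    obtain ⟨h0, hbody⟩ := hstep i (by omega) v hv
    intro s hs hsv
    have h3 := (SExpr.comp_spec hs e he).1
    have h4 := Layout.cost_le hs e he hw
    rw [hsv] at h3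
    obtain ⟨μ, h1, h2, h5⟩ := hbody s hs hsv
    have key : ∀ s', ∃ ν, (Γ.WF s' ∧ Inv (i + 1) (Γ.segs s')) →
        Exec (.loop (e.comp Γ.TE) c) s' ν ∧
        (∀ p ∈ ν.support, p.2 ≤ (N - (i + 1)) * (Γ.w + t) + Γ.w ∧ Γ.WF p.1 ∧
          Inv N (Γ.segs p.1)) ∧
        ev ν (fun p => L N (Γ.segs p.1)) ≤ L (i + 1) (Γ.segs s') := by
      intro s'
      by_cases hc : Γ.WF s' ∧ Inv (i + 1) (Γ.segs s')
      · obtain ⟨ν, hν⟩ := ih (i + 1) (by omega) _ hc.2 (by omega) s' hc.1 rfl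
        exact ⟨ν, fun _ => hν⟩
      · exact ⟨PMF.pure (s', 0), fun h => absurd h hc⟩
    choose ν hν using key
    refine ⟨_, Exec.loop_step _ c s μ ν (h3.trans_ne h0) h1 fun p hp => (hν p.1 (h2 p hp).2).1,
      ?_, ?_⟩
    · intro q hq
      rw [PMF.mem_support_bind_iff] at hq
      obtain ⟨p, hp, hq⟩ := hq
      rw [PMF.mem_support_map_iff] at hq
      obtain ⟨r, hr, rfl⟩ := hq
      have h6 := h2 p hp
      have h7 := (hν p.1 h6.2).2.1 r hr
      refine ⟨?_, h7.2⟩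
      have e1 : N - i = (N - (i + 1)) + 1 := by omega
      rw [e1, Nat.add_mul, one_mul]
      simp only
      have h8 := h7.1
      have h9 := h6.1
      omega
    · rw [ev_bind]
      refine le_trans (ev_mono fun p hp => ?_) h5
      rw [ev_map]
      exact (hν p.1 (h2 p hp).2).2.2

/-- Register `r` as an expression. -/
def reg (r : ℕ) : SExpr := .ld 0 (.k r)

/-- The program that writes into register `r`. -/
def setReg (TE : Expr) (r : ℕ) (e : SExpr) : Prog := setProg TE (.k 0) (.k r) e

/-- A counting loop. -/
def forProg (TE : Expr) (r : ℕ) (N : SExpr) (c : Prog) : Prog :=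
  .seq (setReg TE r (.k 0)) (.loop ((SExpr.op .lt (reg r) N).comp TE)
    (.seq c (setReg TE r (.op .add (reg r) (.k 1)))))

lemma DT.setReg {r : ℕ} {e : SExpr} (he : e.ok) (hr : r ≤ 50) (hw : e.wt ≤ 100)
    (hb : e.eval v < 2 ^ Γ.b) (hQ : Q (v.set 0 r (e.eval v))) :
    DT Γ (setReg Γ.TE r e) v Γ.w Q :=
  DT.set rfl rfl he (by simp only [SExpr.wt]; omega) hw (by have := Γ.hT; simp only [SExpr.eval]; omega)
    (by simp [SExpr.eval]) (fun _ => hb) hQ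

/-- Invariant and potential must not depend on the counter register, since the loop itself writes to
it; the value of the counter is provided to the body separately. -/
lemma HT.forProg {r : ℕ} {N : SExpr} (hN : N.ok) (hr : r ≤ 40) (hw : N.wt ≤ 50) (k : ℕ)
    (hk : k < 2 ^ Γ.b) (Inv : ℕ → Segs → Prop) (L : ℕ → Segs → ℝ≥0∞)
    (hIr : ∀ i v x, Inv i v → Inv i (v.set 0 r x))
    (hLr : ∀ i v x, L i (v.set 0 r x) = L i v)
    (hNk : ∀ i v, Inv i v → N.eval v = k) (h0 : Inv 0 v)
    (hstep : ∀ i < k, ∀ v, Inv i v → v 0 r = i →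
      HT Γ c v t (fun v' => v' 0 r = i ∧ Inv (i + 1) v') (L (i + 1)) (L i v)) :
    HT Γ (forProg Γ.TE r N c) v (2 * Γ.w + k * (2 * Γ.w + t)) (Inv k) (L k) (L 0 v) := by
  have h1 : DT Γ (RAM.setReg Γ.TE r (.k 0)) v Γ.w (fun v' => v' = v.set 0 r 0) :=
    DT.setReg rfl (by omega) (by simp [SExpr.wt]) (by simp [SExpr.eval]) rfl
  have h2 := HT.loop (Γ := Γ) (c := .seq c (RAM.setReg Γ.TE r (.op .add (reg r) (.k 1))))
    (.op .lt (reg r) N) (by simp [SExpr.ok, reg, hN]) (by simp [SExpr.wt, reg]; omega) k (t + Γ.w)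
    (fun i v => Inv i v ∧ v 0 r = i) L
    (by
      rintro v ⟨h3, h4⟩
      simp [SExpr.eval, BinOp.eval, reg, h4, hNk _ _ h3])
    (by
      rintro i hi v ⟨h3, h4⟩
      refine ⟨by simp [SExpr.eval, BinOp.eval, reg, h4, hNk _ _ h3, hi], ?_⟩
      refine HT.seq_left (hstep i hi v h3 h4) ?_
      rintro v' ⟨h5, h6⟩
      refine DT.setReg (by simp [SExpr.ok, reg]) (by omega) (by simp [SExpr.wt, reg]; omega) ?_ ?_
      · simp only [SExpr.eval, BinOp.eval, reg, h5]; omega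
      · refine ⟨⟨hIr _ _ _ h6, ?_⟩, (hLr _ _ _).le⟩
        simp [Segs.set, SExpr.eval, BinOp.eval, reg, h5])
    0 (Nat.zero_le _) (v.set 0 r 0) ⟨hIr _ _ _ h0, by simp [Segs.set]⟩
  refine (HT.seq_right h1 (by rintro _ rfl; exact h2)).mono ?_ ?_
    (fun _ _ => le_rfl) (hLr _ _ _).le
  swap
  · exact fun _ h => h.1
  rw [Nat.sub_zero]
  nlinarith

lemma DT.forProg {r : ℕ} {N : SExpr} (hN : N.ok) (hr : r ≤ 40) (hw : N.wt ≤ 50) (k : ℕ)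
    (hk : k < 2 ^ Γ.b) (Inv : ℕ → Segs → Prop)
    (hIr : ∀ i v x, Inv i v → Inv i (v.set 0 r x))
    (hNk : ∀ i v, Inv i v → N.eval v = k) (h0 : Inv 0 v)
    (hstep : ∀ i < k, ∀ v, Inv i v → v 0 r = i →
      DT Γ c v t (fun v' => v' 0 r = i ∧ Inv (i + 1) v')) :
    DT Γ (forProg Γ.TE r N c) v (2 * Γ.w + k * (2 * Γ.w + t)) (Inv k) :=
  HT.forProg hN hr hw k hk Inv (fun _ _ => 0) hIr (fun _ _ _ => rfl) hNk h0 hstep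

end Rules

end RAM

namespace RAM

open scoped ENNReal

/-! ## Running a program inside one segment -/

/-- The translation of an expression that makes it refer to the segment with number `σ`. -/
def Expr.reloc (e TE σ : Expr) : Expr :=
  match e with
  | .const k => .const k
  | .load e => .load (addrExpr TE σ (e.reloc TE σ))
  | .op o x y => .op o (x.reloc TE σ) (y.reloc TE σ)

/-- The translation of a program that makes it work in the segment with number `σ`. -/
def Prog.reloc (TE σ : Expr) : Prog → Prog
  | .skip => .skip
  | .store a e => .store (addrExpr TE σ (a.reloc TE σ)) (e.reloc TE σ)
  | .flip a => .flip (addrExpr TE σ (a.reloc TE σ))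
  | .seq c d => .seq (c.reloc TE σ) (d.reloc TE σ)
  | .cond e c d => .cond (e.reloc TE σ) (c.reloc TE σ) (d.reloc TE σ)
  | .loop e c => .loop (e.reloc TE σ) (c.reloc TE σ)

lemma Prog.Deterministic.reloc {P : Prog} (h : P.Deterministic) (TE σ : Expr) :
    (P.reloc TE σ).Deterministic := by
  induction P with
  | skip => trivial
  | store => trivial
  | flip => exact h
  | seq c d ihc ihd => exact ⟨ihc h.1, ihd h.2⟩
  | cond e c d ihc ihd => exact ⟨ihc h.1, ihd h.2⟩
  | loop e c ih => exact ih h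

/-- The number of nodes of an expression. -/
def Expr.nodes : Expr → ℕ
  | .const _ => 1
  | .load e => e.nodes + 1
  | .op _ x y => x.nodes + y.nodes + 1

/-- The number of nodes of a program. -/
def Prog.nodes : Prog → ℕ
  | .skip => 1
  | .store a e => a.nodes + e.nodes + 1
  | .flip a => a.nodes + 1
  | .seq c d => c.nodes + d.nodes + 1
  | .cond e c d => e.nodes + c.nodes + d.nodes + 1
  | .loop e c => e.nodes + c.nodes + 1

lemma Expr.size_eval_le_cost (s : Mem) (e : Expr) : Nat.size (e.eval s) + 1 ≤ e.cost s := by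
  cases e <;> simp only [Expr.cost, Expr.eval] <;> omega

/-- The memory `s₀`, with segment `c` replaced by `s`. -/
def Layout.lift (Γ : Layout) (s₀ : Mem) (c : ℕ) (s : Mem) : Mem :=
  fun a => if Γ.R ≤ a ∧ (a - Γ.R) % Γ.T = c then s ((a - Γ.R) / Γ.T) else s₀ a

section Lift

variable {Γ : Layout} {s₀ : Mem} {c : ℕ}

lemma Layout.addr_sub_mod (hc : c < Γ.T) (a : ℕ) : (Γ.addr c a - Γ.R) % Γ.T = c := by
  have : Γ.addr c a - Γ.R = c + a * Γ.T := by unfold Layout.addr; omega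
  rw [this, Nat.add_mul_mod_self_right, Nat.mod_eq_of_lt hc]

lemma Layout.addr_sub_div (hc : c < Γ.T) (a : ℕ) : (Γ.addr c a - Γ.R) / Γ.T = a := by
  have : Γ.addr c a - Γ.R = c + a * Γ.T := by unfold Layout.addr; omega
  rw [this, Nat.add_mul_div_right _ _ Γ.T_pos, Nat.div_eq_of_lt hc, zero_add]

lemma Layout.lift_addr (hc : c < Γ.T) (s : Mem) (a : ℕ) : Γ.lift s₀ c s (Γ.addr c a) = s a := by
  unfold Layout.lift
  rw [if_pos ⟨Γ.R_le_addr c a, Layout.addr_sub_mod hc a⟩, Layout.addr_sub_div hc]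

/-- A store commutes with the embedding of a memory into a segment, so the relocated program
simulates the original one step by step. -/
lemma Layout.lift_update (hc : c < Γ.T) (s : Mem) (a x : ℕ) :
    Function.update (Γ.lift s₀ c s) (Γ.addr c a) x = Γ.lift s₀ c (Function.update s a x) := by
  funext a'
  by_cases h : a' = Γ.addr c a
  · subst h
    rw [Function.update_self, Layout.lift_addr hc, Function.update_self]
  · rw [Function.update_of_ne h]
    unfold Layout.lift
    split_ifs with h1
    · rw [Function.update_of_ne]
      rintro rfl
      apply h
      unfold Layout.addr
      have := Nat.div_add_mod (a' - Γ.R) Γ.T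
      rw [mul_comm, h1.2] at this
      omega
    · rfl

lemma Layout.segs_lift (hc : c < Γ.T) (h8 : 8 ≤ c) (s : Mem) :
    Γ.segs (Γ.lift s₀ c s) = fun σ => if σ = c then s else Γ.segs s₀ σ := by
  funext σ i
  by_cases h : σ = c
  · subst h
    have h7 : σ ≠ 7 := by omega
    simp only [Layout.segs, h7, hc, if_true, if_false, Layout.lift_addr hc]
  · simp only [Layout.segs, h, if_false]
    split_ifs with h1 h2 h3
    · unfold Layout.lift
      rw [if_neg (by omega)]
    · rfl
    · unfold Layout.lift
      rw [if_neg]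
      rintro ⟨-, h4⟩
      exact h ((Layout.addr_sub_mod h3 i).symm.trans h4)
    · rfl

lemma Layout.WF.lift (h : Γ.WF s₀) (hc : c < Γ.T) (h8 : 8 ≤ c) (s : Mem) :
    Γ.WF (Γ.lift s₀ c s) := by
  have h2 : 2 ≤ Γ.R := by unfold Layout.R; omega
  refine ⟨?_, ?_, ?_⟩
  · unfold Layout.lift; rw [if_neg (by omega)]; exact h.1
  · unfold Layout.lift; rw [if_neg (by omega)]; exact h.2.1
  · intro σ hσ i
    rw [Layout.segs_lift hc h8]
    have : σ ≠ c := by omega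
    simp only [this, if_false]
    exact h.2.2 σ hσ i

variable {CALL : ℕ} (h : Γ.WF s₀) (hc : c < Γ.T) (h8 : 8 ≤ c) (hC : Γ.segs s₀ 0 CALL = c)
  (hC50 : CALL ≤ 50)

include h hc h8 hC hC50

lemma Layout.reg_lift (s : Mem) : ((reg CALL).comp Γ.TE).eval (Γ.lift s₀ c s) = c ∧
    2 * ((reg CALL).comp Γ.TE).cost (Γ.lift s₀ c s) + 1 ≤ Γ.w := by
  have h1 := h.lift hc h8 s
  have hok : (reg CALL).ok = true := by simp [reg, SExpr.ok]
  refine ⟨?_, Layout.cost_le h1 _ hok (by simp only [reg, SExpr.wt]; omega)⟩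
  rw [(SExpr.comp_spec h1 _ hok).1, Layout.segs_lift hc h8]
  have : (0 : ℕ) ≠ c := by omega
  simp only [reg, SExpr.eval, this, if_false]
  exact hC

/-- The term `3 * Nat.size a` comes from the three intermediate results that involve `a`: the
product with `T` and the two sums. -/
lemma Layout.addrExpr_lift (s : Mem) (e : Expr) (a : ℕ)
    (he : e.eval (Γ.lift s₀ c s) = a) :
    (addrExpr Γ.TE ((reg CALL).comp Γ.TE) e).eval (Γ.lift s₀ c s) = Γ.addr c a ∧
    (addrExpr Γ.TE ((reg CALL).comp Γ.TE) e).cost (Γ.lift s₀ c s) ≤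
      e.cost (Γ.lift s₀ c s) + 3 * Nat.size a + 12 * Γ.w := by
  have h1 := h.lift hc h8 s
  obtain ⟨h2, h3⟩ := Layout.reg_lift h hc h8 hC hC50 s
  obtain ⟨h4, h5⟩ := Layout.inputSizeExpr_spec h1
  have h6 := Γ.eval_TE _ h1.1 h1.2.1
  have h7 := Layout.expr_cost_le (Γ.loads_TE _ h1.1 h1.2.1) (by omega)
  have h8' := Layout.expr_cost_le h5 (by
    have h9 : Nat.size 1 = 1 := Nat.size_one
    have h10 : Nat.size 2 = 2 := by decide
    simp only [inputSizeExpr, Expr.wt, Nat.size_zero, h9, h10]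
    omega)
  have g1 := Expr.size_eval_le_cost (Γ.lift s₀ c s) Γ.TE
  have g2 := Expr.size_eval_le_cost (Γ.lift s₀ c s) inputSizeExpr
  have g3 := Expr.size_eval_le_cost (Γ.lift s₀ c s) ((reg CALL).comp Γ.TE)
  rw [h6] at g1
  rw [h4] at g2
  rw [h2] at g3
  have k1 := size_mul_le a Γ.T
  have k2 := size_add_le Γ.R (a * Γ.T)
  have k3 := size_add_le (Γ.R + a * Γ.T) c
  refine ⟨?_, ?_⟩
  · simp only [addrExpr, Expr.eval, BinOp.eval, he, h2, h4, h6, Layout.addr]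
  · simp only [addrExpr, Expr.cost, Expr.eval, BinOp.eval, he, h2, h4, h6]
    omega

/-- The overhead at a load is linear in the length of the original address, which the original cost
already contains. The factor `e.nodes` leaves room for one such overhead per node. -/
lemma Layout.reloc_expr (s : Mem) (e : Expr) :
    (e.reloc Γ.TE ((reg CALL).comp Γ.TE)).eval (Γ.lift s₀ c s) = e.eval s ∧
    (e.reloc Γ.TE ((reg CALL).comp Γ.TE)).cost (Γ.lift s₀ c s) ≤
      20 * Γ.w * e.nodes * e.cost s := by
  have hw : 1 ≤ Γ.w := by have := Γ.hw; omega
  induction e with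
  | const k =>
    refine ⟨rfl, ?_⟩
    simp only [Expr.reloc, Expr.cost, Expr.nodes, mul_one]
    exact Nat.le_mul_of_pos_left _ (by omega)
  | load e ih =>
    obtain ⟨h1, h2⟩ := Layout.addrExpr_lift h hc h8 hC hC50 s _ _ ih.1
    have h3 := Expr.size_eval_le_cost s e
    refine ⟨?_, ?_⟩
    · simp only [Expr.reloc, Expr.eval, h1, Layout.lift_addr hc]
    · simp only [Expr.reloc, Expr.cost, Expr.eval, h1, Layout.lift_addr hc, Expr.nodes]
      have h4 := ih.2
      generalize (addrExpr Γ.TE ((reg CALL).comp Γ.TE)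
        (e.reloc Γ.TE ((reg CALL).comp Γ.TE))).cost (Γ.lift s₀ c s) = X at *
      generalize (e.reloc Γ.TE ((reg CALL).comp Γ.TE)).cost (Γ.lift s₀ c s) = X' at *
      generalize Nat.size (e.eval s) = z at *
      generalize Nat.size (s (e.eval s)) = z' at *
      generalize e.cost s = y at *
      generalize e.nodes = N at *
      generalize Γ.w = w at *
      have e1 : 20 * w * (N + 1) * (y + z' + 1) = 20 * w * N * y + 20 * (w * y) + 20 * w * z'
        + 20 * w + 20 * w * N * (z' + 1) := by ring
      have e2 : 1 * y ≤ w * y := Nat.mul_le_mul_right _ hw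
      have e3 : 1 * z' ≤ 20 * w * z' := Nat.mul_le_mul_right _ (by omega)
      have := Nat.zero_le (20 * w * N * (z' + 1))
      omega
  | op o x y ihx ihy =>
    refine ⟨?_, ?_⟩
    · simp only [Expr.reloc, Expr.eval, ihx.1, ihy.1]
    · simp only [Expr.reloc, Expr.cost, Expr.eval, ihx.1, ihy.1, Expr.nodes]
      have h1 := ihx.2
      have h2 := ihy.2
      generalize Nat.size (o.eval (x.eval s) (y.eval s)) = z at *
      generalize (x.reloc Γ.TE ((reg CALL).comp Γ.TE)).cost (Γ.lift s₀ c s) = X at *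
      generalize (y.reloc Γ.TE ((reg CALL).comp Γ.TE)).cost (Γ.lift s₀ c s) = Y at *
      generalize x.cost s = a at *
      generalize y.cost s = b at *
      generalize x.nodes = N at *
      generalize y.nodes = M at *
      generalize Γ.w = w at *
      have e1 : 20 * w * (N + M + 1) * (a + b + z + 1) = 20 * w * N * a + 20 * w * M * b
        + 20 * w * N * (b + z + 1) + 20 * w * M * (a + z + 1) + 20 * w * (a + b) + 20 * w * (z + 1)
        := by ring
      have e3 : 1 * (z + 1) ≤ 20 * w * (z + 1) := Nat.mul_le_mul_right _ (by omega)
      omega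

lemma Layout.reloc_addr (s : Mem) (e : Expr) (D : ℕ) (hD : e.nodes + 1 ≤ D) :
    (addrExpr Γ.TE ((reg CALL).comp Γ.TE) (e.reloc Γ.TE ((reg CALL).comp Γ.TE))).eval
      (Γ.lift s₀ c s) = Γ.addr c (e.eval s) ∧
    (addrExpr Γ.TE ((reg CALL).comp Γ.TE) (e.reloc Γ.TE ((reg CALL).comp Γ.TE))).cost
      (Γ.lift s₀ c s) ≤ 20 * Γ.w * D * e.cost s := by
  obtain ⟨h1, h2⟩ := Layout.reloc_expr h hc h8 hC hC50 s e
  obtain ⟨h3, h4⟩ := Layout.addrExpr_lift h hc h8 hC hC50 s _ _ h1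
  refine ⟨h3, ?_⟩
  have h5 := Expr.size_eval_le_cost s e
  have hw : 1 ≤ Γ.w := by have := Γ.hw; omega
  have h6 : 20 * Γ.w * (e.nodes + 1) * e.cost s ≤ 20 * Γ.w * D * e.cost s := by gcongr
  have e1 : 20 * Γ.w * (e.nodes + 1) * e.cost s =
      20 * Γ.w * e.nodes * e.cost s + 12 * (Γ.w * e.cost s) + 8 * (Γ.w * e.cost s) := by ring
  have e2 : 1 * e.cost s ≤ Γ.w * e.cost s := Nat.mul_le_mul_right _ hw
  have e3 : Γ.w * 1 ≤ Γ.w * e.cost s := Nat.mul_le_mul_left _ (by omega)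
  omega

lemma Layout.reloc_expr_le (s : Mem) (e : Expr) (D : ℕ) (hD : e.nodes ≤ D) :
    (e.reloc Γ.TE ((reg CALL).comp Γ.TE)).cost (Γ.lift s₀ c s) ≤ 20 * Γ.w * D * e.cost s := by
  refine (Layout.reloc_expr h hc h8 hC hC50 s e).2.trans ?_
  gcongr

/-- A relocated program has the same distribution of results, up to relocation, and its running
time grows only by a factor. -/
theorem reloc_exec (D : ℕ) {P : Prog} {s : Mem} {μ : PMF (Mem × ℕ)} (hP : Exec P s μ) :
    P.nodes ≤ D → ∃ μ' : PMF (Mem × ℕ),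
      Exec (P.reloc Γ.TE ((reg CALL).comp Γ.TE)) (Γ.lift s₀ c s) μ' ∧
      (∀ f : Mem → ℝ≥0∞, ev μ' (fun p => f p.1) = ev μ fun p => f (Γ.lift s₀ c p.1)) ∧
      ∀ p' ∈ μ'.support, ∃ p ∈ μ.support, p'.1 = Γ.lift s₀ c p.1 ∧
        p'.2 ≤ 20 * Γ.w * D * p.2 := by
  have hw : 1 ≤ Γ.w := by have := Γ.hw; omega
  have hsb : ∀ s, (fun a => Γ.lift s₀ c s (Γ.addr c a)) = s := fun s => by
    funext a; exact Layout.lift_addr hc s a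
  -- The common part of sequential composition and of a loop round; `k` and `k'` are the costs of
  -- the loop test before and after relocation.
  have hbind : ∀ (d d' : Prog) (s : Mem) (μ μ' : PMF (Mem × ℕ)) (ν : Mem → PMF (Mem × ℕ)) (k k' : ℕ),
      k' ≤ 20 * Γ.w * D * k →
      (∀ f : Mem → ℝ≥0∞, ev μ' (fun p => f p.1) = ev μ fun p => f (Γ.lift s₀ c p.1)) →
      (∀ p' ∈ μ'.support, ∃ p ∈ μ.support, p'.1 = Γ.lift s₀ c p.1 ∧
        p'.2 ≤ 20 * Γ.w * D * p.2) →
      (∀ p ∈ μ.support, ∃ ν' : PMF (Mem × ℕ), Exec d' (Γ.lift s₀ c p.1) ν' ∧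
        (∀ f : Mem → ℝ≥0∞, ev ν' (fun p => f p.1) = ev (ν p.1) fun p => f (Γ.lift s₀ c p.1)) ∧
        ∀ p' ∈ ν'.support, ∃ q ∈ (ν p.1).support, p'.1 = Γ.lift s₀ c q.1 ∧
          p'.2 ≤ 20 * Γ.w * D * q.2) →
      ∃ ν' : Mem → PMF (Mem × ℕ), (∀ p ∈ μ'.support, Exec d' p.1 (ν' p.1)) ∧
        (∀ f : Mem → ℝ≥0∞,
          ev (μ'.bind fun p => (ν' p.1).map fun q => (q.1, k' + p.2 + q.2)) (fun p => f p.1) =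
          ev (μ.bind fun p => (ν p.1).map fun q => (q.1, k + p.2 + q.2))
            fun p => f (Γ.lift s₀ c p.1)) ∧
        ∀ p' ∈ (μ'.bind fun p => (ν' p.1).map fun q => (q.1, k' + p.2 + q.2)).support,
          ∃ p ∈ (μ.bind fun p => (ν p.1).map fun q => (q.1, k + p.2 + q.2)).support,
            p'.1 = Γ.lift s₀ c p.1 ∧ p'.2 ≤ 20 * Γ.w * D * p.2 := by
    intro d d' s μ μ' ν k k' hk h1 h2 h3
    have key : ∀ s1, ∃ ν' : PMF (Mem × ℕ), (∃ p ∈ μ.support, p.1 = s1) →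
        Exec d' (Γ.lift s₀ c s1) ν' ∧
        (∀ f : Mem → ℝ≥0∞, ev ν' (fun p => f p.1) = ev (ν s1) fun p => f (Γ.lift s₀ c p.1)) ∧
        ∀ p' ∈ ν'.support, ∃ q ∈ (ν s1).support, p'.1 = Γ.lift s₀ c q.1 ∧
          p'.2 ≤ 20 * Γ.w * D * q.2 := by
      intro s1
      by_cases hs : ∃ p ∈ μ.support, p.1 = s1
      · obtain ⟨p, hp, rfl⟩ := hs
        obtain ⟨ν', hν'⟩ := h3 p hp
        exact ⟨ν', fun _ => hν'⟩
      · exact ⟨PMF.pure (s1, 0), fun h => absurd h hs⟩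
    choose ν' hν' using key
    -- A continuation is indexed by the large memory. The small memory that determines it is
    -- recovered by reading segment `c`.
    refine ⟨fun x => ν' fun a => x (Γ.addr c a), ?_, ?_, ?_⟩
    · intro p' hp'
      obtain ⟨p, hp, e, -⟩ := h2 p' hp'
      rw [e]
      simp only [hsb]
      exact (hν' p.1 ⟨p, hp, rfl⟩).1
    · intro f
      rw [ev_bind, ev_bind]
      simp_rw [ev_map]
      rw [h1 fun x => ev (ν' fun a => x (Γ.addr c a)) fun q => f q.1]
      simp_rw [hsb]
      have : ∀ p ∈ μ.support, ev (ν' p.1) (fun q => f q.1) =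
          ev (ν p.1) fun q => f (Γ.lift s₀ c q.1) := fun p hp => (hν' p.1 ⟨p, hp, rfl⟩).2.1 f
      exact le_antisymm (ev_mono fun p hp => (this p hp).le) (ev_mono fun p hp => (this p hp).ge)
    · intro q' hq'
      rw [PMF.mem_support_bind_iff] at hq'
      obtain ⟨p', hp', hq'⟩ := hq'
      rw [PMF.mem_support_map_iff] at hq'
      obtain ⟨r', hr', rfl⟩ := hq'
      obtain ⟨p, hp, e, h4⟩ := h2 p' hp'
      rw [e] at hr'
      simp only [hsb] at hr'
      obtain ⟨r, hr, e', h5⟩ := (hν' p.1 ⟨p, hp, rfl⟩).2.2 r' hr'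
      refine ⟨(r.1, k + p.2 + r.2), ?_, e', ?_⟩
      · rw [PMF.mem_support_bind_iff]
        exact ⟨p, hp, (PMF.mem_support_map_iff _ _ _).2 ⟨r, hr, rfl⟩⟩
      · simp only [Nat.mul_add]
        omega
  have hmap : ∀ (μ μ' : PMF (Mem × ℕ)) (k k' : ℕ), k' ≤ 20 * Γ.w * D * k →
      (∀ f : Mem → ℝ≥0∞, ev μ' (fun p => f p.1) = ev μ fun p => f (Γ.lift s₀ c p.1)) →
      (∀ p' ∈ μ'.support, ∃ p ∈ μ.support, p'.1 = Γ.lift s₀ c p.1 ∧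
        p'.2 ≤ 20 * Γ.w * D * p.2) →
      (∀ f : Mem → ℝ≥0∞,
          ev (μ'.map fun q => (q.1, k' + q.2)) (fun p => f p.1) =
          ev (μ.map fun q => (q.1, k + q.2)) fun p => f (Γ.lift s₀ c p.1)) ∧
        ∀ p' ∈ (μ'.map fun q => (q.1, k' + q.2)).support,
          ∃ p ∈ (μ.map fun q => (q.1, k + q.2)).support,
            p'.1 = Γ.lift s₀ c p.1 ∧ p'.2 ≤ 20 * Γ.w * D * p.2 := by
    intro μ μ' k k' hk h1 h2
    refine ⟨fun f => by rw [ev_map, ev_map]; exact h1 f, ?_⟩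
    intro q' hq'
    rw [PMF.mem_support_map_iff] at hq'
    obtain ⟨r', hr', rfl⟩ := hq'
    obtain ⟨r, hr, e, h4⟩ := h2 r' hr'
    refine ⟨(r.1, k + r.2), (PMF.mem_support_map_iff _ _ _).2 ⟨r, hr, rfl⟩, e, ?_⟩
    simp only [Nat.mul_add]
    omega
  have hcost : ∀ (s : Mem) (e : Expr), e.nodes + 1 ≤ D →
      (e.reloc Γ.TE ((reg CALL).comp Γ.TE)).cost (Γ.lift s₀ c s) + 1 ≤
        20 * Γ.w * D * (e.cost s + 1) := by
    intro s e hD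
    have h1 := Layout.reloc_expr_le h hc h8 hC hC50 s e D (by omega)
    have h2 : 1 ≤ 20 * Γ.w * D := Nat.mul_pos (by omega) (by omega)
    rw [Nat.mul_add]
    omega
  have heval : ∀ (s : Mem) (e : Expr),
      (e.reloc Γ.TE ((reg CALL).comp Γ.TE)).eval (Γ.lift s₀ c s) = e.eval s := fun s e =>
    (Layout.reloc_expr h hc h8 hC hC50 s e).1
  induction hP with
  | skip s =>
    intro hD
    simp only [Prog.nodes] at hD
    refine ⟨_, Exec.skip _, fun f => by rw [ev_pure, ev_pure], fun p' hp' => ⟨_, PMF.mem_support_pure_iff _ _ |>.2 rfl, ?_⟩⟩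
    rw [PMF.mem_support_pure_iff] at hp'
    subst hp'
    have h2 : 1 ≤ 20 * Γ.w * D := Nat.mul_pos (by omega) (by omega)
    exact ⟨rfl, by simpa using h2⟩
  | store a e s =>
    intro hD
    simp only [Prog.nodes] at hD
    obtain ⟨h1, h2⟩ := Layout.reloc_addr h hc h8 hC hC50 s a D (by omega)
    have h3 := hcost s e (by have : 1 ≤ a.nodes := by cases a <;> simp [Expr.nodes]
                             omega)
    refine ⟨_, Exec.store _ _ _, fun f => ?_, fun p' hp' => ⟨_, PMF.mem_support_pure_iff _ _ |>.2 rfl, ?_⟩⟩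
    · rw [ev_pure, ev_pure]
      simp only [h1, heval, Layout.lift_update hc]
    · rw [PMF.mem_support_pure_iff] at hp'
      subst hp'
      refine ⟨by simp only [h1, heval, Layout.lift_update hc], ?_⟩
      simp only [Nat.mul_add] at h3 ⊢
      omega
  | flip a s =>
    intro hD
    simp only [Prog.nodes] at hD
    obtain ⟨h1, h2⟩ := Layout.reloc_addr h hc h8 hC hC50 s a D (by omega)
    refine ⟨_, Exec.flip _ _, fun f => ?_, fun p' hp' => ?_⟩
    · rw [ev_map, ev_map]
      simp only [h1, Layout.lift_update hc]
    · rw [PMF.mem_support_map_iff] at hp'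
      obtain ⟨b, hb, rfl⟩ := hp'
      refine ⟨_, (PMF.mem_support_map_iff _ _ _).2 ⟨b, hb, rfl⟩, ?_, ?_⟩
      · simp only [h1, Layout.lift_update hc]
      · have h4 : 1 ≤ 20 * Γ.w * D := Nat.mul_pos (by omega) (by omega)
        simp only [Nat.mul_add]
        omega
  | seq P Q s μ ν hP hQ ihP ihQ =>
    intro hD
    simp only [Prog.nodes] at hD
    obtain ⟨μ', h1, h2, h3⟩ := ihP (by omega)
    obtain ⟨ν', h4, h5, h6⟩ := hbind Q (Q.reloc Γ.TE ((reg CALL).comp Γ.TE)) s μ μ' ν 0 0 (by simp)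
      h2 h3 fun p hp => ihQ p hp (by omega)
    simp only [Nat.zero_add] at h5 h6
    exact ⟨_, Exec.seq _ _ _ _ _ h1 h4, h5, h6⟩
  | cond_true e P Q s μ he hP ih =>
    intro hD
    simp only [Prog.nodes] at hD
    obtain ⟨μ', h1, h2, h3⟩ := ih (by omega)
    have hn : 1 ≤ P.nodes := by cases P <;> simp [Prog.nodes]
    obtain ⟨h4, h5⟩ := hmap μ μ' _ _ (hcost s e (by omega)) h2 h3
    exact ⟨_, Exec.cond_true _ _ _ _ _ ((heval s e).trans_ne he) h1, h4, h5⟩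
  | cond_false e P Q s μ he hP ih =>
    intro hD
    simp only [Prog.nodes] at hD
    obtain ⟨μ', h1, h2, h3⟩ := ih (by omega)
    have hn : 1 ≤ P.nodes := by cases P <;> simp [Prog.nodes]
    obtain ⟨h4, h5⟩ := hmap μ μ' _ _ (hcost s e (by omega)) h2 h3
    exact ⟨_, Exec.cond_false _ _ _ _ _ ((heval s e).trans he) h1, h4, h5⟩
  | loop_stop e P s he =>
    intro hD
    simp only [Prog.nodes] at hD
    refine ⟨_, Exec.loop_stop _ _ _ ((heval s e).trans he), fun f => by rw [ev_pure, ev_pure],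
      fun p' hp' => ⟨_, PMF.mem_support_pure_iff _ _ |>.2 rfl, ?_⟩⟩
    rw [PMF.mem_support_pure_iff] at hp'
    subst hp'
    have hn : 1 ≤ P.nodes := by cases P <;> simp [Prog.nodes]
    exact ⟨rfl, hcost s e (by omega)⟩
  | loop_step e P s μ ν he hP hl ihP ihl =>
    intro hD
    have hD' := hD
    simp only [Prog.nodes] at hD
    obtain ⟨μ', h1, h2, h3⟩ := ihP (by omega)
    have hn : 1 ≤ P.nodes := by cases P <;> simp [Prog.nodes]
    obtain ⟨ν', h4, h5, h6⟩ := hbind (.loop e P)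
      (.loop (e.reloc Γ.TE ((reg CALL).comp Γ.TE)) (P.reloc Γ.TE ((reg CALL).comp Γ.TE)))
      s μ μ' ν _ _ (hcost s e (by omega)) h2 h3 fun p hp => ihl p hp hD'
    exact ⟨_, Exec.loop_step _ _ _ _ _ ((heval s e).trans_ne he) h1 h4, h5, h6⟩

end Lift

/-- The numbers in the memory become longer by at most the running time. -/
lemma Exec.size_le {P : Prog} {s : Mem} {μ : PMF (Mem × ℕ)} (h : Exec P s μ) :
    ∀ p ∈ μ.support, ∀ a, Nat.size (p.1 a) ≤ Nat.size (s a) + p.2 := by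
  induction h with
  | skip s =>
    intro p hp a
    rw [PMF.mem_support_pure_iff] at hp
    subst hp
    simp
  | store a e s =>
    intro p hp a'
    rw [PMF.mem_support_pure_iff] at hp
    subst hp
    have := Expr.size_eval_le_cost s e
    simp only [Function.update_apply]
    split_ifs <;> omega
  | flip a s =>
    intro p hp a'
    rw [PMF.mem_support_map_iff] at hp
    obtain ⟨b, -, rfl⟩ := hp
    have : Nat.size b.toNat ≤ 1 := by cases b <;> simp
    simp only [Function.update_apply]
    split_ifs <;> omega
  | seq c d s μ ν hc hd ihc ihd =>
    intro q hq a
    rw [PMF.mem_support_bind_iff] at hq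
    obtain ⟨p, hp, hq⟩ := hq
    rw [PMF.mem_support_map_iff] at hq
    obtain ⟨r, hr, rfl⟩ := hq
    have h1 := ihc p hp a
    have h2 := ihd p hp r hr a
    simp only
    omega
  | cond_true e c d s μ he hc ih =>
    intro q hq a
    rw [PMF.mem_support_map_iff] at hq
    obtain ⟨r, hr, rfl⟩ := hq
    have h1 := ih r hr a
    simp only
    omega
  | cond_false e c d s μ he hc ih =>
    intro q hq a
    rw [PMF.mem_support_map_iff] at hq
    obtain ⟨r, hr, rfl⟩ := hq
    have h1 := ih r hr a
    simp only
    omega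
  | loop_stop e c s he =>
    intro p hp a
    rw [PMF.mem_support_pure_iff] at hp
    subst hp
    simp
  | loop_step e c s μ ν he hc hl ihc ihl =>
    intro q hq a
    rw [PMF.mem_support_bind_iff] at hq
    obtain ⟨p, hp, hq⟩ := hq
    rw [PMF.mem_support_map_iff] at hq
    obtain ⟨r, hr, rfl⟩ := hq
    have h1 := ihc p hp a
    have h2 := ihl p hp r hr a
    simp only
    omega

end RAM

namespace RAM

open Finset

/-! ## Small subsets as numbers -/

/-- The subsets with at most `h` elements of `{0, …, j - 1}` in increasing order, as numbers, each
with its cardinality. -/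
def smallSubsets (h : ℕ) : ℕ → List (ℕ × ℕ)
  | 0 => [(0, 0)]
  | j + 1 => smallSubsets h j ++
      ((smallSubsets h j).filter (fun q => q.2 < h)).map fun q => (q.1 + 2 ^ j, q.2 + 1)

/-- The number of binary digits `1` of `X` among the first `j`. -/
def popCount (j X : ℕ) : ℕ := ((range j).filter fun i => X.testBit i).card

lemma popCount_succ_of_lt {j X : ℕ} (h : X < 2 ^ j) : popCount (j + 1) X = popCount j X := by
  unfold popCount
  rw [range_add_one, filter_insert, Nat.testBit_lt_two_pow h]
  simp

lemma popCount_succ_add {j X : ℕ} (h : X < 2 ^ j) :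
    popCount (j + 1) (X + 2 ^ j) = popCount j X + 1 := by
  unfold popCount
  have h1 : (X + 2 ^ j).testBit j = true := by
    rw [add_comm, Nat.testBit_two_pow_add_eq, Nat.testBit_lt_two_pow h]; rfl
  have h2 : (range j).filter (fun i => (X + 2 ^ j).testBit i) =
      (range j).filter fun i => X.testBit i := by
    refine filter_congr fun i hi => ?_
    rw [add_comm, Nat.testBit_two_pow_add_gt (mem_range.1 hi)]
  rw [range_add_one, filter_insert, h1, h2]
  simp

lemma mem_smallSubsets {h : ℕ} (j X p : ℕ) :
    (X, p) ∈ smallSubsets h j ↔ X < 2 ^ j ∧ p = popCount j X ∧ p ≤ h := by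
  induction j generalizing X p with
  | zero =>
    simp only [smallSubsets, List.mem_singleton, Prod.mk.injEq, pow_zero, Nat.lt_one_iff]
    constructor
    · rintro ⟨rfl, rfl⟩; simp [popCount]
    · rintro ⟨rfl, rfl, -⟩; simp [popCount]
  | succ j ih =>
    simp only [smallSubsets, List.mem_append, List.mem_map, List.mem_filter, Prod.exists,
      Prod.mk.injEq, decide_eq_true_eq, ih]
    constructor
    · rintro (⟨h1, rfl, h3⟩ | ⟨Y, q, ⟨⟨h1, h2, h3⟩, h4⟩, rfl, rfl⟩)
      · exact ⟨by rw [pow_succ]; omega, (popCount_succ_of_lt h1).symm, h3⟩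
      · exact ⟨by rw [pow_succ]; omega, by rw [popCount_succ_add h1, h2], by omega⟩
    · rintro ⟨h1, h2, h3⟩
      by_cases h4 : X < 2 ^ j
      · exact Or.inl ⟨h4, by rw [h2, popCount_succ_of_lt h4], h3⟩
      · right
        have h5 : X - 2 ^ j < 2 ^ j := by rw [pow_succ] at h1; omega
        have h6 : X - 2 ^ j + 2 ^ j = X := by omega
        have h7 := popCount_succ_add h5
        rw [h6, ← h2] at h7
        exact ⟨X - 2 ^ j, popCount j (X - 2 ^ j), ⟨⟨h5, rfl, by omega⟩, by omega⟩, h6, h7.symm⟩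

/-- The subsets that contain `j` come after all those that do not. The resulting numerical order
puts every set behind its proper subsets, as the dynamic program for the covering numbers needs. -/
lemma pairwise_smallSubsets (h j : ℕ) :
    (smallSubsets h j).Pairwise fun q q' => q.1 < q'.1 := by
  induction j with
  | zero => simp [smallSubsets]
  | succ j ih =>
    rw [smallSubsets, List.pairwise_append]
    refine ⟨ih, ?_, ?_⟩
    · rw [List.pairwise_map]
      exact (ih.filter _).imp fun h => by omega
    · rintro ⟨X, p⟩ hX q hq
      obtain ⟨q', -, rfl⟩ := List.mem_map.1 hq
      have := ((mem_smallSubsets j X p).1 hX).1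
      simp only
      omega

lemma length_smallSubsets_le (h j : ℕ) : (smallSubsets h j).length ≤ 2 ^ j := by
  induction j with
  | zero => simp [smallSubsets]
  | succ j ih =>
    have := List.length_filter_le (fun q : ℕ × ℕ => decide (q.2 < h)) (smallSubsets h j)
    rw [smallSubsets, List.length_append, List.length_map, pow_succ]
    omega

/-- The generating function of all subsets by cardinality is `(1 + x) ^ j`, and each subset with at
most `h` elements contributes at least `x ^ h` because `x ≤ 1`. This replaces an entropy estimate
for binomial sums. -/
lemma length_smallSubsets_le_real (h j : ℕ) {x : ℝ} (hx : 0 < x) (hx1 : x ≤ 1) :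
    ((smallSubsets h j).length : ℝ) * x ^ h ≤ (1 + x) ^ j := by
  have h1 : ((smallSubsets h j).map fun q => x ^ q.2).sum ≤ (1 + x) ^ j := by
    induction j with
    | zero => simp [smallSubsets]
    | succ j ih =>
      rw [smallSubsets, List.map_append, List.sum_append, List.map_map]
      have h2 : (((smallSubsets h j).filter fun q => q.2 < h).map
          ((fun q => x ^ q.2) ∘ fun q : ℕ × ℕ => (q.1 + 2 ^ j, q.2 + 1))).sum ≤
          x * ((smallSubsets h j).map fun q => x ^ q.2).sum := by
        generalize smallSubsets h j = l
        induction l with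
        | nil => simp
        | cons q l ih =>
          rw [List.filter_cons]
          split_ifs with hq
          · simp only [List.map_cons, List.sum_cons, Function.comp_apply] at ih ⊢
            rw [pow_succ]
            linarith
          · simp only [List.map_cons, List.sum_cons] at ih ⊢
            have : 0 ≤ x * x ^ q.2 := by positivity
            linarith
      rw [pow_succ]
      nlinarith
  refine le_trans ?_ h1
  have h3 : ∀ q ∈ smallSubsets h j, q.2 ≤ h := fun q hq =>
    ((mem_smallSubsets j q.1 q.2).1 hq).2.2
  clear h1
  generalize smallSubsets h j = l at h3
  induction l with
  | nil => simp
  | cons q l ih =>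
    have h4 := ih fun q hq => h3 q (List.mem_cons_of_mem _ hq)
    have h5 : x ^ h ≤ x ^ q.2 := pow_le_pow_of_le_one hx.le hx1 (h3 q List.mem_cons_self)
    simp only [List.length_cons, List.map_cons, List.sum_cons]
    push_cast
    linarith

lemma popCount_mono {j X Y : ℕ} (h : ∀ v, Y.testBit v → X.testBit v) :
    popCount j Y ≤ popCount j X :=
  card_le_card fun i hi => by
    rw [mem_filter] at hi ⊢
    exact ⟨hi.1, h i hi.2⟩

/-- The small subsets, without their cardinalities. -/
def smallList (h n : ℕ) : List ℕ := (smallSubsets h n).map Prod.fst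

lemma mem_smallList {h n X : ℕ} : X ∈ smallList h n ↔ X < 2 ^ n ∧ popCount n X ≤ h := by
  simp only [smallList, List.mem_map, Prod.exists, exists_and_right, exists_eq_right,
    mem_smallSubsets]
  constructor
  · rintro ⟨p, h1, rfl, h3⟩; exact ⟨h1, h3⟩
  · rintro ⟨h1, h2⟩; exact ⟨_, h1, rfl, h2⟩

lemma pairwise_smallList (h n : ℕ) : (smallList h n).Pairwise (· < ·) :=
  List.pairwise_map.2 (pairwise_smallSubsets h n)

/-! ## Numbers as sets -/

lemma land_eq_left_iff {X V : ℕ} : X &&& V = X ↔ ∀ v, X.testBit v → V.testBit v := by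
  constructor
  · intro h v hv
    rw [← h, Nat.testBit_and, Bool.and_eq_true] at hv
    exact hv.2
  · intro h
    refine Nat.eq_of_testBit_eq fun v => ?_
    rw [Nat.testBit_and]
    by_cases hv : X.testBit v
    · rw [hv, h v hv]; rfl
    · simp only [Bool.not_eq_true] at hv; rw [hv]; rfl

lemma testBit_diff (X M v : ℕ) :
    (X ^^^ (X &&& M)).testBit v = (X.testBit v && !M.testBit v) := by
  rw [Nat.testBit_xor, Nat.testBit_and]
  cases X.testBit v <;> cases M.testBit v <;> rfl

lemma le_of_subset {X Y : ℕ} (h : ∀ v, Y.testBit v → X.testBit v) : Y ≤ X := by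
  rw [← land_eq_left_iff.2 h]
  exact Nat.and_le_right

lemma land_ne_zero_iff {X M : ℕ} : X &&& M ≠ 0 ↔ ∃ v, X.testBit v ∧ M.testBit v := by
  constructor
  · intro h
    by_contra! hc
    refine h (Nat.eq_of_testBit_eq fun v => ?_)
    rw [Nat.testBit_and, Nat.zero_testBit]
    by_cases hv : X.testBit v
    · have := hc v hv; simp only [ne_eq, Bool.not_eq_true] at this; simp [this]
    · simp only [Bool.not_eq_true] at hv; rw [hv]; rfl
  · rintro ⟨v, h1, h2⟩ h
    have : (X &&& M).testBit v = true := by rw [Nat.testBit_and, h1, h2]; rfl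
    rw [h, Nat.zero_testBit] at this
    exact absurd this (by simp)

lemma diff_lt {X M : ℕ} (h : X &&& M ≠ 0) : X ^^^ (X &&& M) < X := by
  refine lt_of_le_of_ne (le_of_subset fun v hv => ?_) fun he => ?_
  · rw [testBit_diff, Bool.and_eq_true] at hv; exact hv.1
  · obtain ⟨v, h1, h2⟩ := land_ne_zero_iff.1 h
    have := testBit_diff X M v
    rw [he, h1, h2] at this
    exact absurd this (by simp)

lemma diff_mem_smallList {h n X : ℕ} (hX : X ∈ smallList h n) (M : ℕ) :
    X ^^^ (X &&& M) ∈ smallList h n := by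
  have hs : ∀ v, (X ^^^ (X &&& M)).testBit v → X.testBit v := fun v hv => by
    rw [testBit_diff, Bool.and_eq_true] at hv; exact hv.1
  rw [mem_smallList] at hX ⊢
  exact ⟨(le_of_subset hs).trans_lt hX.1, (popCount_mono hs).trans hX.2⟩

/-- At most `c` of the sets `M 0, …, M (m - 1)` cover the elements of `X` that are not in `V`. -/
def Covered (M : ℕ → ℕ) (m V X c : ℕ) : Prop :=
  ∃ A ⊆ range m, A.card ≤ c ∧ ∀ v, X.testBit v → V.testBit v ∨ ∃ i ∈ A, (M i).testBit v

/-- The recurrence behind the table of covering numbers: if something in `X` is outside of `V`, some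
chosen set contains it; remove that set from the choice and its elements from `X`. -/
lemma covered_iff {M : ℕ → ℕ} {m V X c : ℕ} : Covered M m V X c ↔
    X &&& V = X ∨ ∃ i < m, X &&& M i ≠ 0 ∧ 0 < c ∧ Covered M m V (X ^^^ (X &&& M i)) (c - 1) := by
  constructor
  · rintro ⟨A, h1, h2, h3⟩
    by_cases hX : X &&& V = X
    · exact Or.inl hX
    · right
      rw [land_eq_left_iff] at hX
      push Not at hX
      obtain ⟨v, hv, hV⟩ := hX
      obtain ⟨i, hi, hiv⟩ := (h3 v hv).resolve_left (by simpa using hV)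
      have hc : 0 < A.card := card_pos.2 ⟨i, hi⟩
      refine ⟨i, mem_range.1 (h1 hi), land_ne_zero_iff.2 ⟨v, hv, hiv⟩, by omega, A.erase i,
        (erase_subset _ _).trans h1, by rw [card_erase_of_mem hi]; omega, fun u hu => ?_⟩
      rw [testBit_diff, Bool.and_eq_true, Bool.not_eq_true'] at hu
      refine (h3 u hu.1).imp_right ?_
      rintro ⟨k, hk, hku⟩
      refine ⟨k, mem_erase.2 ⟨?_, hk⟩, hku⟩
      rintro rfl
      rw [hku] at hu
      exact absurd hu.2 (by simp)
  · rintro (h | ⟨i, hi, -, hc, A, h1, h2, h3⟩)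
    · exact ⟨∅, empty_subset _, by simp, fun v hv => Or.inl (land_eq_left_iff.1 h v hv)⟩
    · refine ⟨insert i A, insert_subset (mem_range.2 hi) h1, (card_insert_le _ _).trans (by omega),
        fun v hv => ?_⟩
      by_cases hM : (M i).testBit v
      · exact Or.inr ⟨i, mem_insert_self _ _, hM⟩
      · refine (h3 v ?_).imp_right ?_
        · rw [testBit_diff, hv]
          simpa using hM
        · rintro ⟨k, hk, hkv⟩
          exact ⟨k, mem_insert_of_mem hk, hkv⟩

/-! ## Instances given by lists of numbers -/

/-- The set system whose sets are given by the binary digits of a list of numbers. -/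
def SetSystem.ofRows (n : ℕ) (rows : List ℕ) (hd : rows.Nodup) (hlt : ∀ r ∈ rows, r < 2 ^ n) :
    SetSystem where
  n := n
  m := rows.length
  S i := univ.filter fun j : Fin n => (rows[i]).testBit j
  inj := by
    intro i i' h
    have h1 : rows[i] = rows[i'] := by
      refine Nat.eq_of_testBit_eq fun v => ?_
      by_cases hv : v < n
      · have := Finset.ext_iff.1 h ⟨v, hv⟩
        simp only [mem_filter, mem_univ, true_and] at this
        exact Bool.eq_iff_iff.2 this
      · have hp : 2 ^ n ≤ 2 ^ v := Nat.pow_le_pow_right (by norm_num) (by omega)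
        have h2 := hlt _ (List.getElem_mem i.2)
        have h3 := hlt _ (List.getElem_mem i'.2)
        exact (Nat.testBit_lt_two_pow (h2.trans_le hp)).trans
          (Nat.testBit_lt_two_pow (h3.trans_le hp)).symm
    exact Fin.ext ((List.Nodup.getElem_inj_iff hd).1 h1)

lemma SetSystem.mem_ofRows {n : ℕ} {rows : List ℕ} (hd : rows.Nodup) (hlt : ∀ r ∈ rows, r < 2 ^ n)
    (i : Fin rows.length) (j : Fin n) :
    j ∈ (SetSystem.ofRows n rows hd hlt).S i ↔ (rows[i]).testBit j = true := by
  change j ∈ univ.filter (fun j : Fin n => (rows[i]).testBit j = true) ↔ _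
  rw [mem_filter]
  simp

lemma SetSystem.ofRows_input {n : ℕ} (hn : 0 < n) {rows : List ℕ} (hd : rows.Nodup)
    (hlt : ∀ r ∈ rows, r < 2 ^ n) (a : ℕ) :
    (SetSystem.ofRows n rows hd hlt).input (a + 2) =
      ((rows.getD (a / n) 0).testBit (a % n)).toNat := by
  simp only [SetSystem.input]
  by_cases h1 : a / n < rows.length
  · rw [List.getD_eq_getElem _ _ h1]
    by_cases h2 : (rows[a / n]).testBit (a % n) = true
    · rw [h2, if_pos]
      · rfl
      · refine ⟨⟨a / n, h1⟩, ⟨a % n, Nat.mod_lt _ hn⟩, ?_, ?_⟩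
        · have := Nat.div_add_mod a n
          rw [mul_comm] at this
          exact this.symm
        · exact (SetSystem.mem_ofRows hd hlt ⟨a / n, h1⟩ ⟨a % n, Nat.mod_lt _ hn⟩).2 h2
    · rw [if_neg]
      · simp only [Bool.not_eq_true] at h2
        rw [h2]; rfl
      · rintro ⟨i, j, e, hj⟩
        apply h2
        have hj' : (j : ℕ) < n := j.2
        have e1 : a / n = i := by
          rw [e]
          change ((i : ℕ) * n + j) / n = i
          rw [mul_comm, Nat.mul_add_div hn, Nat.div_eq_of_lt hj', add_zero]
        have e2 : a % n = j := by
          rw [e]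
          change ((i : ℕ) * n + j) % n = j
          rw [mul_comm, Nat.mul_add_mod, Nat.mod_eq_of_lt hj']
        simp only [e1, e2]
        exact (SetSystem.mem_ofRows hd hlt i j).1 hj
  · rw [List.getD_eq_default _ _ (by omega), Nat.zero_testBit, if_neg]
    · rfl
    · rintro ⟨i, j, e, hj⟩
      apply h1
      have hj' : (j : ℕ) < n := j.2
      have e1 : a / n = i := by
        rw [e]
        change ((i : ℕ) * n + j) / n = i
        rw [mul_comm, Nat.mul_add_div hn, Nat.div_eq_of_lt hj', add_zero]
      rw [e1]
      exact i.2

/-- The rows that come from one set `X`: for all `j` with `F X ≤ κ j`, the set `X` with the extra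
element `n + j`. -/
def rowsOne (n : ℕ) (F κ : ℕ → ℕ) (X t : ℕ) : List ℕ :=
  ((List.range t).filter fun j => F X ≤ κ j).map fun j => X + 2 ^ (n + j)

/-- The rows that come from a list of sets. -/
def rowsAll (n t : ℕ) (F κ : ℕ → ℕ) (l : List ℕ) : List ℕ := l.flatMap fun X => rowsOne n F κ X t

lemma testBit_tagged {n X j : ℕ} (hX : X < 2 ^ n) (v : ℕ) :
    (X + 2 ^ (n + j)).testBit v = (X.testBit v || decide (v = n + j)) := by
  have hX' : X < 2 ^ (n + j) := hX.trans_le (Nat.pow_le_pow_right (by norm_num) (by omega))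
  rw [add_comm]
  rcases lt_trichotomy v (n + j) with h | rfl | h
  · rw [Nat.testBit_two_pow_add_gt h]
    simp [h.ne]
  · rw [Nat.testBit_two_pow_add_eq, Nat.testBit_lt_two_pow hX']
    simp
  · have h1 : 2 ^ (n + j) + X < 2 ^ v := by
      calc 2 ^ (n + j) + X < 2 ^ (n + j + 1) := by rw [pow_succ]; omega
        _ ≤ 2 ^ v := Nat.pow_le_pow_right (by norm_num) h
    rw [Nat.testBit_lt_two_pow h1, Nat.testBit_lt_two_pow (x := X) (by omega)]
    simp [h.ne']

lemma tagged_lt {n X j t : ℕ} (hX : X < 2 ^ n) (hj : j < t) : X + 2 ^ (n + j) < 2 ^ (n + t) := by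
  have hX' : X < 2 ^ (n + j) := hX.trans_le (Nat.pow_le_pow_right (by norm_num) (by omega))
  calc X + 2 ^ (n + j) < 2 ^ (n + j + 1) := by rw [pow_succ]; omega
    _ ≤ 2 ^ (n + t) := Nat.pow_le_pow_right (by norm_num) (by omega)

/-- The label is the only binary digit at a position `≥ n`. Labelled copies of sets are therefore
distinct, as a set system demands. -/
lemma tagged_inj {n X j X' j' : ℕ} (hX : X < 2 ^ n) (hX' : X' < 2 ^ n)
    (h : X + 2 ^ (n + j) = X' + 2 ^ (n + j')) : X = X' ∧ j = j' := by
  have h1 := testBit_tagged hX (j := j) (n + j)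
  rw [h, testBit_tagged hX'] at h1
  have h2 : X'.testBit (n + j) = false :=
    Nat.testBit_lt_two_pow (hX'.trans_le (Nat.pow_le_pow_right (by norm_num) (by omega)))
  rw [h2] at h1
  have h3 : j = j' := by simpa using h1
  subst h3
  exact ⟨by omega, rfl⟩

lemma mem_rowsAll {n t : ℕ} {F κ : ℕ → ℕ} {l : List ℕ} {r : ℕ} :
    r ∈ rowsAll n t F κ l ↔ ∃ X ∈ l, ∃ j < t, F X ≤ κ j ∧ X + 2 ^ (n + j) = r := by
  simp only [rowsAll, rowsOne, List.mem_flatMap, List.mem_map, List.mem_filter, List.mem_range,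
    decide_eq_true_eq, and_assoc]

lemma nodup_rowsAll {n t : ℕ} {F κ : ℕ → ℕ} {l : List ℕ} (hl : l.Nodup)
    (hlt : ∀ X ∈ l, X < 2 ^ n) : (rowsAll n t F κ l).Nodup := by
  rw [rowsAll, List.nodup_flatMap]
  refine ⟨fun X hX => ?_, ?_⟩
  · refine List.Nodup.map_on ?_ (List.nodup_range.filter _)
    intro j _ j' _ h
    exact (tagged_inj (hlt X hX) (hlt X hX) h).2
  · refine List.Pairwise.imp_of_mem ?_ hl
    intro X Y hX hY hne r hr hr'
    simp only [rowsOne, List.mem_map] at hr hr'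
    obtain ⟨j, -, rfl⟩ := hr
    obtain ⟨j', -, h⟩ := hr'
    exact hne (tagged_inj (hlt Y hY) (hlt X hX) h).1.symm

lemma rowsAll_lt {n t : ℕ} {F κ : ℕ → ℕ} {l : List ℕ} (hlt : ∀ X ∈ l, X < 2 ^ n) :
    ∀ r ∈ rowsAll n t F κ l, r < 2 ^ (n + t) := by
  intro r hr
  obtain ⟨X, hX, j, hj, -, rfl⟩ := mem_rowsAll.1 hr
  exact tagged_lt (hlt X hX) hj

lemma length_rowsOne_le (n : ℕ) (F κ : ℕ → ℕ) (X t : ℕ) : (rowsOne n F κ X t).length ≤ t := by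
  rw [rowsOne, List.length_map]
  exact (List.length_filter_le _ _).trans (by simp)

lemma length_rowsAll_le (n t : ℕ) (F κ : ℕ → ℕ) (l : List ℕ) :
    (rowsAll n t F κ l).length ≤ l.length * t := by
  induction l with
  | nil => simp [rowsAll]
  | cons X l ih =>
    have := length_rowsOne_le n F κ X t
    rw [rowsAll, List.flatMap_cons, List.length_append, List.length_cons, Nat.add_mul]
    rw [rowsAll] at ih
    omega

/-- The instance of Exact Cover in which one looks for a partition of the ground set into sets
`X 0, …, X (t - 1)` from `l` with `F (X j) ≤ κ j`. -/
def partitionInstance (n t : ℕ) (F κ : ℕ → ℕ) (l : List ℕ) (hl : l.Nodup)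
    (hlt : ∀ X ∈ l, X < 2 ^ n) : SetSystem :=
  .ofRows (n + t) (rowsAll n t F κ l) (nodup_rowsAll hl hlt) (rowsAll_lt hlt)

lemma SetSystem.ofRows_hasExactCover_iff {n : ℕ} {rows : List ℕ} (hd : rows.Nodup)
    (hlt : ∀ r ∈ rows, r < 2 ^ n) :
    (SetSystem.ofRows n rows hd hlt).HasExactCover ↔ ∃ B : Finset ℕ, (∀ r ∈ B, r ∈ rows) ∧
      (∀ v < n, ∃ r ∈ B, r.testBit v) ∧
      ∀ r ∈ B, ∀ r' ∈ B, ∀ v < n, r.testBit v → r'.testBit v → r = r' := by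
  classical
  change (∃ A : Finset (Fin rows.length),
    (A.biUnion fun i => univ.filter fun j : Fin n => rows[i].testBit j) = univ ∧
    (A : Set (Fin rows.length)).PairwiseDisjoint
      fun i => univ.filter fun j : Fin n => rows[i].testBit j) ↔ _
  constructor
  · rintro ⟨A, h1, h2⟩
    refine ⟨A.image fun i => rows[i], ?_, ?_, ?_⟩
    · intro r hr
      obtain ⟨i, -, rfl⟩ := mem_image.1 hr
      exact List.getElem_mem i.2
    · intro v hv
      have h3 := mem_univ (⟨v, hv⟩ : Fin n)
      rw [← h1, mem_biUnion] at h3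
      obtain ⟨i, hi, h4⟩ := h3
      exact ⟨rows[i], mem_image_of_mem _ hi, (mem_filter.1 h4).2⟩
    · intro r hr r' hr' v hv h3 h4
      obtain ⟨i, hi, rfl⟩ := mem_image.1 hr
      obtain ⟨i', hi', rfl⟩ := mem_image.1 hr'
      by_contra hne
      have : i ≠ i' := by rintro rfl; exact hne rfl
      exact Finset.disjoint_left.1 (h2 hi hi' this)
        (mem_filter.2 ⟨mem_univ (⟨v, hv⟩ : Fin n), h3⟩) (mem_filter.2 ⟨mem_univ _, h4⟩)
  · rintro ⟨B, h1, h2, h3⟩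
    refine ⟨univ.filter fun i => rows[i] ∈ B, ?_, ?_⟩
    · refine eq_univ_of_forall fun v => mem_biUnion.2 ?_
      obtain ⟨r, hr, h4⟩ := h2 v v.2
      obtain ⟨i, hi, rfl⟩ := List.getElem_of_mem (h1 r hr)
      exact ⟨⟨i, hi⟩, mem_filter.2 ⟨mem_univ _, hr⟩, mem_filter.2 ⟨mem_univ _, h4⟩⟩
    · intro i hi i' hi' hne
      rw [mem_coe, mem_filter] at hi hi'
      refine Finset.disjoint_left.2 fun v h4 h5 => hne ?_
      have := h3 _ hi.2 _ hi'.2 v v.2 (mem_filter.1 h4).2 (mem_filter.1 h5).2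
      exact Fin.ext ((List.Nodup.getElem_inj_iff hd).1 this)

/-- Each label is covered, and each row of the cover carries a label, so disjointness makes the rows
correspond one to one to the labels. Disjointness of the `X j` themselves is not recorded, as a
cover is all that is needed. -/
lemma exists_of_hasExactCover {n t : ℕ} {F κ : ℕ → ℕ} {l : List ℕ} {hl : l.Nodup}
    {hlt : ∀ X ∈ l, X < 2 ^ n} (h : (partitionInstance n t F κ l hl hlt).HasExactCover) :
    ∃ X : ℕ → ℕ, (∀ j < t, X j ∈ l ∧ F (X j) ≤ κ j) ∧ ∀ v < n, ∃ j < t, (X j).testBit v := by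
  obtain ⟨B, hB, hcov, huniq⟩ := (SetSystem.ofRows_hasExactCover_iff _ _).1 h
  have hX : ∀ j, ∃ X, j < t → (X ∈ l ∧ F X ≤ κ j) ∧ X + 2 ^ (n + j) ∈ B := by
    intro j
    by_cases hj : j < t
    · obtain ⟨r, hr, hv⟩ := hcov (n + j) (by omega)
      obtain ⟨X, hX, j', hj', hF, rfl⟩ := mem_rowsAll.1 (hB r hr)
      rw [testBit_tagged (hlt X hX), Nat.testBit_lt_two_pow
        ((hlt X hX).trans_le (Nat.pow_le_pow_right (by norm_num) (by omega)))] at hv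
      have : j = j' := by simpa using hv
      subst this
      exact ⟨X, fun _ => ⟨⟨hX, hF⟩, hr⟩⟩
    · exact ⟨0, fun h => absurd h hj⟩
  choose X hX using hX
  refine ⟨X, fun j hj => (hX j hj).1, fun v hv => ?_⟩
  obtain ⟨r, hr, hrv⟩ := hcov v (by omega)
  obtain ⟨Y, hY, j, hj, hF, rfl⟩ := mem_rowsAll.1 (hB r hr)
  obtain ⟨⟨h1, -⟩, h2⟩ := hX j hj
  have h3 := huniq _ hr _ h2 (n + j) (by omega)
    (by rw [testBit_tagged (hlt Y hY)]; simp) (by rw [testBit_tagged (hlt _ h1)]; simp)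
  have := (tagged_inj (hlt Y hY) (hlt _ h1) h3).1
  subst this
  rw [testBit_tagged (hlt _ hY)] at hrv
  simp only [Bool.or_eq_true, decide_eq_true_eq] at hrv
  exact ⟨j, hj, hrv.resolve_right (by omega)⟩

lemma hasExactCover_of_exists {n t : ℕ} {F κ : ℕ → ℕ} {l : List ℕ} {hl : l.Nodup}
    {hlt : ∀ X ∈ l, X < 2 ^ n} (X : ℕ → ℕ) (hX : ∀ j < t, X j ∈ l ∧ F (X j) ≤ κ j)
    (hcov : ∀ v < n, ∃ j < t, (X j).testBit v)
    (hdisj : ∀ j < t, ∀ j' < t, ∀ v, (X j).testBit v → (X j').testBit v → j = j') :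
    (partitionInstance n t F κ l hl hlt).HasExactCover := by
  have hXlt : ∀ j < t, X j < 2 ^ n := fun j hj => hlt _ (hX j hj).1
  have hbit : ∀ j < t, ∀ v, (X j).testBit v = true → v < n := by
    intro j hj v h
    by_contra hv
    rw [Nat.testBit_lt_two_pow
      ((hXlt j hj).trans_le (Nat.pow_le_pow_right (by norm_num) (by omega)))] at h
    exact absurd h (by simp)
  refine (SetSystem.ofRows_hasExactCover_iff _ _).2
    ⟨(range t).image fun j => X j + 2 ^ (n + j), ?_, ?_, ?_⟩
  · intro r hr
    obtain ⟨j, hj, rfl⟩ := mem_image.1 hr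
    rw [mem_range] at hj
    exact mem_rowsAll.2 ⟨X j, (hX j hj).1, j, hj, (hX j hj).2, rfl⟩
  · intro v hv
    have : ∃ j < t, (X j + 2 ^ (n + j)).testBit v = true := by
      by_cases hv : v < n
      · obtain ⟨j, hj, h1⟩ := hcov v hv
        exact ⟨j, hj, by rw [testBit_tagged (hXlt j hj), h1]; rfl⟩
      · refine ⟨v - n, by omega, ?_⟩
        rw [testBit_tagged (hXlt _ (by omega))]
        have : v = n + (v - n) := by omega
        simp [← this]
    obtain ⟨j, hj, h1⟩ := this
    exact ⟨_, mem_image.2 ⟨j, mem_range.2 hj, rfl⟩, h1⟩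
  · intro r hr r' hr' v _ h3 h4
    obtain ⟨j, hj, rfl⟩ := mem_image.1 hr
    obtain ⟨j', hj', rfl⟩ := mem_image.1 hr'
    rw [mem_range] at hj hj'
    suffices j = j' by subst this; rfl
    rw [testBit_tagged (hXlt j hj), Bool.or_eq_true, decide_eq_true_eq] at h3
    rw [testBit_tagged (hXlt j' hj'), Bool.or_eq_true, decide_eq_true_eq] at h4
    rcases h3 with h3 | h3
    · have := hbit j hj v h3
      exact hdisj j hj j' hj' v h3 (h4.resolve_right (by omega))
    · rcases h4 with h4 | h4
      · have := hbit j' hj' v h4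
        omega
      · omega

/-! ## Covers by few sets -/

/-- The sets with indices in `A` cover `{0, …, n - 1}`. -/
def IsCover (M : ℕ → ℕ) (m n : ℕ) (A : Finset ℕ) : Prop :=
  A ⊆ range m ∧ ∀ v < n, ∃ i ∈ A, (M i).testBit v

/-- `b` is the minimal size of a cover, or `m + 1` if there is none. -/
def IsOpt (M : ℕ → ℕ) (m n b : ℕ) : Prop :=
  b ≤ m + 1 ∧ ∀ c ≤ m, b ≤ c ↔ ∃ A, IsCover M m n A ∧ A.card ≤ c

/-- The union of the sets with indices `d 0, …, d (t - 1)`. -/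
def unionOf (M d : ℕ → ℕ) : ℕ → ℕ
  | 0 => 0
  | t + 1 => unionOf M d t ||| M (d t)

lemma testBit_unionOf (M d : ℕ → ℕ) (t v : ℕ) :
    (unionOf M d t).testBit v ↔ ∃ j < t, (M (d j)).testBit v := by
  induction t with
  | zero => simp [unionOf]
  | succ t ih =>
    rw [unionOf, Nat.testBit_or, Bool.or_eq_true, ih]
    constructor
    · rintro (⟨j, hj, h⟩ | h)
      · exact ⟨j, by omega, h⟩
      · exact ⟨t, by omega, h⟩
    · rintro ⟨j, hj, h⟩
      by_cases hjt : j = t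
      · subst hjt; exact Or.inr h
      · exact Or.inl ⟨j, by omega, h⟩

/-- The number of sets that a guess uses: those with indices `d 0, …, d (t - 1)`, and
`d t, …, d (2 t - 1)` further ones. -/
def guessCost (m : ℕ) (d : ℕ → ℕ) (t s : ℕ) : ℕ :=
  ∑ j ∈ range s, (d (t + j) + if d j < m then 1 else 0)

/-- `F` contains the numbers of sets that are needed to cover the sets in `l` outside of `V`. -/
def IsCoverTable (M : ℕ → ℕ) (m V : ℕ) (l : List ℕ) (F : ℕ → ℕ) : Prop :=
  ∀ X ∈ l, ∀ c ≤ m, F X ≤ c ↔ Covered M m V X c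

/-- Soundness of a guess: unite the guessed exceptional sets with an optimal choice for each part of
the partition. Index `m` stands for the empty set, which pads the list of exceptional sets and is
not counted. -/
theorem exists_cover_of_hasExactCover {n m t : ℕ} {M d F : ℕ → ℕ} {l : List ℕ} {hl : l.Nodup}
    {hlt : ∀ X ∈ l, X < 2 ^ n} (hM : M m = 0) (hd : ∀ j < 2 * t, d j ≤ m)
    (hF : IsCoverTable M m (unionOf M d t) l F)
    (h : (partitionInstance n t F (fun j => d (t + j)) l hl hlt).HasExactCover) :
    ∃ A, IsCover M m n A ∧ A.card ≤ guessCost m d t t := by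
  classical
  obtain ⟨X, hX, hcov⟩ := exists_of_hasExactCover h
  have h1 : ∀ j, ∃ A : Finset ℕ, j < t → A ⊆ range m ∧ A.card ≤ d (t + j) ∧
      ∀ v, (X j).testBit v → (unionOf M d t).testBit v ∨ ∃ i ∈ A, (M i).testBit v := by
    intro j
    by_cases hj : j < t
    · obtain ⟨A, hA⟩ := (hF _ (hX j hj).1 _ (hd (t + j) (by omega))).1 (hX j hj).2
      exact ⟨A, fun _ => hA⟩
    · exact ⟨∅, fun h => absurd h hj⟩
  choose A hA using h1
  refine ⟨((range t).image d).filter (· < m) ∪ (range t).biUnion A, ⟨?_, ?_⟩, ?_⟩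
  · refine union_subset (fun i hi => mem_range.2 (mem_filter.1 hi).2) ?_
    exact biUnion_subset.2 fun j hj => (hA j (mem_range.1 hj)).1
  · intro v hv
    obtain ⟨j, hj, hjv⟩ := hcov v hv
    rcases (hA j hj).2.2 v hjv with h2 | ⟨i, hi, hiv⟩
    · obtain ⟨k, hk, hkv⟩ := (testBit_unionOf M d t v).1 h2
      refine ⟨d k, mem_union_left _ (mem_filter.2 ⟨mem_image_of_mem _ (mem_range.2 hk), ?_⟩), hkv⟩
      refine lt_of_le_of_ne (hd k (by omega)) fun he => ?_
      rw [he, hM, Nat.zero_testBit] at hkv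
      exact absurd hkv (by simp)
    · exact ⟨i, mem_union_right _ (mem_biUnion.2 ⟨j, mem_range.2 hj, hi⟩), hiv⟩
  · refine (card_union_le _ _).trans ?_
    rw [guessCost, sum_add_distrib, add_comm (∑ x ∈ range t, d (t + x))]
    refine add_le_add ?_ ?_
    · rw [← card_filter]
      have : ((range t).image d).filter (· < m) ⊆ ((range t).filter fun j => d j < m).image d := by
        intro i hi
        obtain ⟨h2, h3⟩ := mem_filter.1 hi
        obtain ⟨j, hj, rfl⟩ := mem_image.1 h2
        exact mem_image_of_mem _ (mem_filter.2 ⟨hj, h3⟩)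
      exact (card_le_card this).trans card_image_le
    · exact card_biUnion_le.trans (sum_le_sum fun j hj => (hA j (mem_range.1 hj)).2.1)

/-- Completeness: cut the elements, sorted by the set that serves them, into `t` chunks. Only sets
in use at the beginning of a chunk can serve several chunks, and there are at most `t` of these. -/
theorem exists_guess_of_cover {n m t : ℕ} (ht : 0 < t) {M : ℕ → ℕ} {A : Finset ℕ}
    (hA : IsCover M m n A) :
    ∃ d : ℕ → ℕ, (∀ j, d j ≤ m) ∧ guessCost m d t t ≤ A.card ∧
      ∀ F (hl : (smallList (n / t + 1) n).Nodup) (hlt : ∀ X ∈ smallList (n / t + 1) n, X < 2 ^ n),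
        IsCoverTable M m (unionOf M d t) (smallList (n / t + 1) n) F →
        (partitionInstance n t F (fun j => d (t + j)) _ hl hlt).HasExactCover := by
  classical
  set h := n / t + 1 with hh
  -- The `+ 1` in the chunk length makes `t` chunks suffice even if `t` does not divide `n`.
  have hnt : n < t * h := Nat.lt_mul_div_succ n ht
  have h0 : 0 < h := Nat.succ_pos _
  have key : ∀ v : Fin n, ∃ i ∈ A, (M i).testBit v := fun v => hA.2 v v.2
  choose σ hσ hσM using key
  set π := Tuple.sort σ
  have hmono : Monotone (σ ∘ π) := Tuple.monotone_sort σ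
  set pos : Fin n → ℕ := fun v => π.symm v with hpos
  set chunk : Fin n → ℕ := fun v => pos v / h with hchunk
  have hchunk_lt : ∀ v, chunk v < t := fun v => by
    rw [hchunk]
    exact (Nat.div_lt_iff_lt_mul h0).2 ((π.symm v).2.trans hnt)
  -- the sets that meet several chunks
  set D : Finset ℕ := ((univ : Finset (Fin n)).filter fun p : Fin n => (p : ℕ) % h = 0).image
    fun p => σ (π p) with hD
  have hDA : D ⊆ A := by
    intro i hi
    obtain ⟨p, -, rfl⟩ := mem_image.1 hi
    exact hσ _
  have hDcard : D.card ≤ t := by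
    refine card_image_le.trans ?_
    rw [← card_range t]
    refine card_le_card_of_injOn (fun p => (p : ℕ) / h) ?_ ?_
    · intro p _
      exact mem_coe.2 (mem_range.2 ((Nat.div_lt_iff_lt_mul h0).2 (p.2.trans hnt)))
    · intro p hp q hq he
      rw [mem_coe, mem_filter] at hp hq
      have h1 := Nat.div_add_mod (p : ℕ) h
      have h2 := Nat.div_add_mod (q : ℕ) h
      simp only at he
      rw [he, hp.2] at h1
      rw [hq.2] at h2
      exact Fin.ext (by omega)
  -- The first position of the chunk of `v` lies between the positions of `u` and `v`; since the
  -- elements are sorted, it has the same assigned set.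
  have hcut : ∀ u v, chunk u < chunk v → σ u = σ v → σ v ∈ D := by
    intro u v huv he
    have h1 : chunk v * h ≤ pos v := Nat.div_mul_le_self _ _
    have h2 : pos u < chunk v * h := (Nat.div_lt_iff_lt_mul h0).1 huv
    have h3 : chunk v * h < n := h1.trans_lt (π.symm v).2
    refine mem_image.2 ⟨⟨chunk v * h, h3⟩, mem_filter.2 ⟨mem_univ _, Nat.mul_mod_left _ _⟩, ?_⟩
    have h4 : σ u ≤ σ (π ⟨chunk v * h, h3⟩) := by
      have := hmono (show π.symm u ≤ ⟨chunk v * h, h3⟩ from h2.le)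
      simpa using this
    have h5 : σ (π ⟨chunk v * h, h3⟩) ≤ σ v := by
      have := hmono (show (⟨chunk v * h, h3⟩ : Fin n) ≤ π.symm v from h1)
      simpa using this
    omega
  set B : ℕ → Finset ℕ := fun j => (A \ D).filter fun i => ∃ v, σ v = i ∧ chunk v = j with hB
  have hcardA : A.card ≤ m := by
    simpa using card_le_card hA.1
  have hBcard : ∀ j, (B j).card ≤ m := fun j =>
    (card_le_card ((filter_subset _ _).trans sdiff_subset)).trans hcardA
  -- The default value `m` of the list access is the index of the empty dummy set.
  set d : ℕ → ℕ := fun j => if j < t then D.toList.getD j m else (B (j - t)).card with hd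
  have hDlt : ∀ i ∈ D, i < m := fun i hi => mem_range.1 (hA.1 (hDA hi))
  have hdl : ∀ j < t, d j = D.toList.getD j m := fun j hj => by simp [hd, hj]
  have hdr : ∀ j, d (t + j) = (B j).card := fun j => by simp [hd]
  have hlen : D.toList.length = D.card := length_toList D
  have hDd : ∀ i ∈ D, ∃ j < t, d j = i := by
    intro i hi
    obtain ⟨j, hj, rfl⟩ := List.getElem_of_mem (mem_toList.2 hi)
    exact ⟨j, by omega, by rw [hdl j (by omega), List.getD_eq_getElem _ _ hj]⟩
  refine ⟨d, ?_, ?_, ?_⟩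
  · intro j
    by_cases hj : j < t
    · rw [hdl j hj]
      by_cases hj' : j < D.toList.length
      · rw [List.getD_eq_getElem _ _ hj']
        exact (hDlt _ (mem_toList.1 (List.getElem_mem hj'))).le
      · rw [List.getD_eq_default _ _ (by omega)]
    · obtain ⟨k, rfl⟩ : ∃ k, j = t + k := ⟨j - t, by omega⟩
      rw [hdr]
      exact hBcard k
  · rw [guessCost, sum_add_distrib, ← card_sdiff_add_card_eq_card hDA]
    refine add_le_add ?_ ?_
    · simp_rw [hdr]
      -- By `hcut` the sets `B j` are disjoint for distinct chunks, so their sizes add up to at most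
      -- the size of `A \ D`.
      rw [← card_biUnion]
      · exact card_le_card (biUnion_subset.2 fun j _ => filter_subset _ _)
      · intro j _ k _ hjk
        refine Finset.disjoint_left.2 fun i hi hi' => ?_
        obtain ⟨h1, v, rfl, rfl⟩ := mem_filter.1 hi
        obtain ⟨h2, u, he, rfl⟩ := mem_filter.1 hi'
        rw [mem_sdiff] at h1
        rcases lt_or_gt_of_ne hjk with hlt | hlt
        · exact h1.2 (he ▸ hcut v u hlt he.symm)
        · exact h1.2 (hcut u v hlt he)
    · rw [← card_filter, ← hlen, ← card_range D.toList.length]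
      refine card_le_card fun j hj => ?_
      rw [mem_filter, mem_range] at hj
      rw [mem_range]
      by_contra hc
      rw [hdl j hj.1, List.getD_eq_default _ _ (by omega)] at hj
      omega
  · intro F hl hlt hF
    set X : ℕ → ℕ := fun j => Nat.ofBits fun v : Fin n => decide (chunk v = j) with hX
    have hXbit : ∀ j v, (X j).testBit v = true ↔ ∃ hv : v < n, chunk ⟨v, hv⟩ = j := by
      intro j v
      by_cases hv : v < n
      · rw [hX, Nat.testBit_ofBits_lt _ _ hv]
        simp [hv]
      · rw [hX, Nat.testBit_ofBits_ge _ _ (by omega)]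
        simp [hv]
    have hXmem : ∀ j, X j ∈ smallList h n := by
      intro j
      refine mem_smallList.2 ⟨Nat.ofBits_lt_two_pow _, ?_⟩
      unfold popCount
      have h1 : ((range n).filter fun v => (X j).testBit v) ⊆
          (univ.filter fun v : Fin n => chunk v = j).image (fun v : Fin n => (v : ℕ)) := by
        intro v hv
        rw [mem_filter] at hv
        obtain ⟨hv', hc⟩ := (hXbit j v).1 hv.2
        exact mem_image.2 ⟨⟨v, hv'⟩, mem_filter.2 ⟨mem_univ _, hc⟩, rfl⟩
      refine (card_le_card h1).trans (card_image_le.trans ?_)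
      have h2 : (Finset.Ico (j * h) (j * h + h)).card = h := by simp
      rw [← h2]
      -- Chunk `j` occupies positions in `[j * h, j * h + h)`, and positions are distinct.
      refine card_le_card_of_injOn pos ?_ ?_
      · intro v hv
        rw [mem_coe, mem_filter] at hv
        have h3 := hv.2
        have h4 := Nat.div_add_mod (pos v) h
        have h5 := Nat.mod_lt (pos v) h0
        rw [hchunk] at h3
        simp only at h3
        rw [h3, mul_comm] at h4
        exact mem_coe.2 (mem_Ico.2 ⟨by omega, by omega⟩)
      · intro u _ v _ he
        exact π.symm.injective (Fin.ext he)
    refine hasExactCover_of_exists X (fun j hj => ⟨hXmem j, ?_⟩) ?_ ?_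
    · simp only [hdr]
      refine (hF _ (hXmem j) _ (hBcard j)).2 ⟨B j,
        ((filter_subset _ _).trans sdiff_subset).trans hA.1, le_rfl, fun v hv => ?_⟩
      obtain ⟨hv', hc⟩ := (hXbit j v).1 hv
      by_cases hD' : σ ⟨v, hv'⟩ ∈ D
      · left
        obtain ⟨k, hk, he⟩ := hDd _ hD'
        exact (testBit_unionOf M d t v).2 ⟨k, hk, by rw [he]; exact hσM ⟨v, hv'⟩⟩
      · exact Or.inr ⟨σ ⟨v, hv'⟩, mem_filter.2 ⟨mem_sdiff.2 ⟨hσ _, hD'⟩, ⟨v, hv'⟩, rfl, hc⟩,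
          hσM ⟨v, hv'⟩⟩
    · intro v hv
      exact ⟨chunk ⟨v, hv⟩, hchunk_lt _, (hXbit _ _).2 ⟨hv, rfl⟩⟩
    · intro j _ j' _ v h1 h2
      obtain ⟨hv, e1⟩ := (hXbit j v).1 h1
      obtain ⟨_, e2⟩ := (hXbit j' v).1 h2
      exact e1.symm.trans e2

end RAM

namespace RAM

open Finset

/-! ## Deleting superfluous sets -/

lemma IsCover.mono {M M' : ℕ → ℕ} {m n : ℕ} {A : Finset ℕ} (h : IsCover M m n A)
    (hM : ∀ i, M i = 0 ∨ M i = M' i) : IsCover M' m n A :=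
  ⟨h.1, fun v hv => by
    obtain ⟨i, hi, hiv⟩ := h.2 v hv
    refine ⟨i, hi, ?_⟩
    rcases hM i with h0 | h0
    · rw [h0, Nat.zero_testBit] at hiv
      exact absurd hiv (by simp)
    · rwa [← h0]⟩

lemma update_zero_cases (M : ℕ → ℕ) (j i : ℕ) :
    Function.update M j 0 i = 0 ∨ Function.update M j 0 i = M i := by
  rw [Function.update_apply]
  split_ifs
  · exact Or.inl rfl
  · exact Or.inr rfl

/-- The deletion of any of the sets with index less than `i` makes covers larger. -/
def NeededBelow (M : ℕ → ℕ) (m n b i : ℕ) : Prop :=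
  ∀ j < i, M j ≠ 0 → ¬ ∃ A, IsCover (Function.update M j 0) m n A ∧ A.card ≤ b

lemma NeededBelow.keep {M : ℕ → ℕ} {m n b b' i : ℕ} (h : NeededBelow M m n b i) (hb : b ≤ m)
    (hb' : IsOpt (Function.update M i 0) m n b') (hlt : b < b') : NeededBelow M m n b (i + 1) := by
  intro j hj hMj
  by_cases hji : j = i
  · subst hji
    rw [← hb'.2 b hb]
    omega
  · exact h j (by omega) hMj

/-- A deletion only removes covers: it cannot lower the optimum, and sets that were needed before
remain needed. -/
lemma NeededBelow.delete {M : ℕ → ℕ} {m n b b' i : ℕ} (h : NeededBelow M m n b i) (hb : b ≤ m)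
    (hM : IsOpt M m n b) (hb' : IsOpt (Function.update M i 0) m n b') (hle : b' ≤ b) :
    IsOpt (Function.update M i 0) m n b ∧
      NeededBelow (Function.update M i 0) m n b (i + 1) := by
  refine ⟨⟨by omega, fun c hc => ⟨fun h1 => (hb'.2 c hc).1 (by omega), ?_⟩⟩, ?_⟩
  · rintro ⟨A, hA, hc'⟩
    exact (hM.2 c hc).2 ⟨A, hA.mono (update_zero_cases M i), hc'⟩
  · rintro j hj hMj ⟨A, hA, hc⟩
    by_cases hji : j = i
    · subst hji
      simp at hMj
    · rw [Function.update_of_ne hji] at hMj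
      refine h j (by omega) hMj ⟨A, hA.mono fun k => ?_, hc⟩
      rw [Function.update_comm (Ne.symm hji)]
      exact update_zero_cases _ _ _

section Masks

variable {I : SetSystem} {S₀ : ℕ → ℕ}
  (hS : ∀ (i : Fin I.m) (v : Fin I.n), (S₀ i).testBit v = true ↔ v ∈ I.S i)

include hS

lemma SetSystem.isSubCover_iff (A : Finset (Fin I.m)) :
    I.IsSubCover A ↔ IsCover S₀ I.m I.n (A.map Fin.valEmbedding) := by
  constructor
  · intro h
    refine ⟨fun i hi => ?_, fun v hv => ?_⟩
    · obtain ⟨i', -, rfl⟩ := mem_map.1 hi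
      exact mem_range.2 i'.2
    · have h1 := mem_univ (⟨v, hv⟩ : Fin I.n)
      rw [SetSystem.IsSubCover] at h
      rw [← h, mem_biUnion] at h1
      obtain ⟨i, hi, hiv⟩ := h1
      exact ⟨i, mem_map.2 ⟨i, hi, rfl⟩, (hS i ⟨v, hv⟩).2 hiv⟩
  · intro h
    refine eq_univ_of_forall fun v => mem_biUnion.2 ?_
    obtain ⟨i, hi, hiv⟩ := h.2 v v.2
    obtain ⟨i', hi', rfl⟩ := mem_map.1 hi
    exact ⟨i', hi', (hS i' v).1 hiv⟩

omit hS in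
lemma exists_map_valEmbedding {m : ℕ} {A : Finset ℕ} (h : A ⊆ range m) :
    ∃ B : Finset (Fin m), B.map Fin.valEmbedding = A := by
  refine ⟨A.attachFin fun i hi => mem_range.1 (h hi), ?_⟩
  ext i
  simp only [mem_map, mem_attachFin, Fin.valEmbedding_apply]
  exact ⟨by rintro ⟨j, hj, rfl⟩; exact hj, fun hi => ⟨⟨i, mem_range.1 (h hi)⟩, hi, rfl⟩⟩

lemma SetSystem.exists_isSubCover_iff {b : ℕ} (hb : IsOpt S₀ I.m I.n b) :
    (∃ A, I.IsSubCover A) ↔ b ≤ I.m := by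
  constructor
  · rintro ⟨A, hA⟩
    refine (hb.2 I.m le_rfl).2 ⟨_, (SetSystem.isSubCover_iff hS A).1 hA, ?_⟩
    rw [card_map]
    simpa using card_le_univ A
  · intro h
    obtain ⟨A, hA, -⟩ := (hb.2 b h).1 le_rfl
    obtain ⟨B, rfl⟩ := exists_map_valEmbedding hA.1
    exact ⟨B, (SetSystem.isSubCover_iff hS B).2 hA⟩

/-- An optimal cover of the reduced family contains every nonempty remaining set, as otherwise one
could be deleted. So the remaining sets are no more than the optimum, and they cover because they
include all useful members of that optimal cover. -/
lemma SetSystem.isMinSubCover_of_needed {M : ℕ → ℕ} {b : ℕ} (hb : b ≤ I.m)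
    (h₀ : IsOpt S₀ I.m I.n b) (hM : IsOpt M I.m I.n b) (hMS : ∀ i, M i = 0 ∨ M i = S₀ i)
    (hneed : NeededBelow M I.m I.n b I.m) :
    I.IsMinSubCover (univ.filter fun i => M i ≠ 0) := by
  obtain ⟨A, hA, hAb⟩ := (hM.2 b hb).1 le_rfl
  have hsub : (univ.filter fun i : Fin I.m => M i ≠ 0).map Fin.valEmbedding ⊆ A := by
    intro i hi
    obtain ⟨i', hi', rfl⟩ := mem_map.1 hi
    by_contra hiA
    refine hneed i' i'.2 (mem_filter.1 hi').2 ⟨A, ⟨hA.1, fun v hv => ?_⟩, hAb⟩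
    obtain ⟨k, hk, hkv⟩ := hA.2 v hv
    refine ⟨k, hk, ?_⟩
    rw [Function.update_of_ne]
    · exact hkv
    · rintro rfl; exact hiA hk
  refine ⟨(SetSystem.isSubCover_iff hS _).2 ⟨hsub.trans hA.1, fun v hv => ?_⟩, fun B hB => ?_⟩
  · obtain ⟨k, hk, hkv⟩ := hA.2 v hv
    have hk0 : M k ≠ 0 := by
      intro h0
      rw [h0, Nat.zero_testBit] at hkv
      exact absurd hkv (by simp)
    refine ⟨k, mem_map.2 ⟨⟨k, mem_range.1 (hA.1 hk)⟩, mem_filter.2 ⟨mem_univ _, hk0⟩, rfl⟩, ?_⟩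
    rwa [← (hMS k).resolve_left hk0]
  · have h1 := card_le_card hsub
    rw [card_map] at h1
    have h2 : B.card ≤ I.m := by simpa using card_le_univ B
    have h3 : b ≤ B.card := (h₀.2 _ h2).2 ⟨_, (SetSystem.isSubCover_iff hS B).1 hB, by rw [card_map]⟩
    omega

end Masks

end RAM

namespace RAM

open scoped ENNReal

/-! ## Frames and sequences of assignments -/

/-- `v'` differs from `v` only in the registers in `rs` and in the segments in `ss`. -/
def Frame (rs ss : List ℕ) (v v' : Segs) : Prop :=
  (∀ r, r ∉ rs → v' 0 r = v 0 r) ∧ ∀ σ, σ ≠ 0 → σ ∉ ss → v' σ = v σ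

namespace Frame

variable {rs ss rs' ss' : List ℕ} {v v' v'' : Segs}

lemma refl : Frame rs ss v v := ⟨fun _ _ => rfl, fun _ _ _ => rfl⟩

lemma trans (h : Frame rs ss v v') (h' : Frame rs ss v' v'') : Frame rs ss v v'' :=
  ⟨fun r hr => (h'.1 r hr).trans (h.1 r hr), fun σ h0 hσ => (h'.2 σ h0 hσ).trans (h.2 σ h0 hσ)⟩

lemma mono (h : Frame rs ss v v') (hr : rs ⊆ rs') (hs : ss ⊆ ss') : Frame rs' ss' v v' :=
  ⟨fun r h1 => h.1 r fun h2 => h1 (hr h2), fun σ h0 h1 => h.2 σ h0 fun h2 => h1 (hs h2)⟩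

lemma setReg (h : Frame rs ss v v') {r : ℕ} (hr : r ∈ rs) (x : ℕ) :
    Frame rs ss v (v'.set 0 r x) := by
  refine ⟨fun r' h1 => ?_, fun σ h0 h1 => ?_⟩
  · have : r' ≠ r := fun h2 => h1 (h2 ▸ hr)
    simpa [Segs.set, this] using h.1 r' h1
  · funext i
    simpa [Segs.set, h0] using congrFun (h.2 σ h0 h1) i

lemma setSeg (h : Frame rs ss v v') {σ : ℕ} (hσ : σ ∈ ss) (h0 : σ ≠ 0) (i x : ℕ) :
    Frame rs ss v (v'.set σ i x) := by
  refine ⟨fun r' h1 => ?_, fun σ' h0' h1 => ?_⟩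
  · simpa [Segs.set, h0.symm] using h.1 r' h1
  · have : σ' ≠ σ := fun h2 => h1 (h2 ▸ hσ)
    funext i
    simpa [Segs.set, this] using congrFun (h.2 σ' h0' h1) i

end Frame

/-! ### Rules for single instructions on the segmented memory. -/

section

variable {Γ : Layout} {c d : Prog} {v : Segs} {t : ℕ} {Q : Segs → Prop}
  {W : Segs → ℝ≥0∞} {l : ℝ≥0∞}

lemma HT.of_wf (h : v 7 0 = Γ.n → v 7 1 = Γ.m → (∀ σ < 8, ∀ i, v σ i < 2 ^ Γ.b) →
    HT Γ c v t Q W l) : HT Γ c v t Q W l := by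
  intro s hs hv
  refine h ?_ ?_ ?_ s hs hv
  · rw [← hv, Γ.segs_input_zero]; exact hs.1
  · rw [← hv, Γ.segs_input_one]; exact hs.2.1
  · rw [← hv]; exact hs.2.2

lemma HT.setReg_seq {r : ℕ} {e : SExpr} (hb : e.eval v < 2 ^ Γ.b)
    (hQ : HT Γ d (v.set 0 r (e.eval v)) t Q W l) (he : e.ok = true := by decide)
    (hr : r ≤ 50 := by decide) (hw : e.wt ≤ 100 := by decide) :
    HT Γ (.seq (setReg Γ.TE r e) d) v (Γ.w + t) Q W l :=
  HT.seq_right (DT.setReg (Q := fun v' => v' = v.set 0 r (e.eval v)) he hr hw hb rfl)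
    (by rintro _ rfl; exact hQ)

lemma HT.set_seq {σ i e : SExpr} (hT : σ.eval v < Γ.T) (h7 : σ.eval v ≠ 7)
    (hb : σ.eval v < 8 → e.eval v < 2 ^ Γ.b)
    (hQ : HT Γ d (v.set (σ.eval v) (i.eval v) (e.eval v)) t Q W l)
    (hσ : σ.ok = true := by decide) (hi : i.ok = true := by decide) (he : e.ok = true := by decide)
    (hw : σ.wt + i.wt ≤ 90 := by decide) (hw' : e.wt ≤ 100 := by decide) :
    HT Γ (.seq (setProg Γ.TE σ i e) d) v (Γ.w + t) Q W l :=
  HT.seq_right (DT.set (Q := fun v' => v' = v.set (σ.eval v) (i.eval v) (e.eval v))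
    hσ hi he hw hw' hT h7 hb rfl) (by rintro _ rfl; exact hQ)

/-- The program that reads a cell of the input into register `r`. -/
def readProg (TE : Expr) (r : ℕ) (e : SExpr) : Prog :=
  .store (SExpr.addr TE (.k 0) (.k r)) (.load (e.comp TE))

lemma DT.read {r : ℕ} {e : SExpr} (he : e.ok = true) (hr : r ≤ 50) (hw : e.wt + 1 ≤ 100)
    (hlt : e.eval v < Γ.R) (hQ : Q (v.set 0 r (v 7 (e.eval v)))) :
    DT Γ (readProg Γ.TE r e) v Γ.w Q := by
  intro s hs hv
  obtain ⟨h1, h2⟩ := SExpr.addr_spec hs (σ := .k 0) (i := .k r) rfl rfl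
    (by simp only [SExpr.wt]; omega)
  obtain ⟨h3, h4⟩ := SExpr.comp_spec hs e he
  rw [hv] at h1 h3
  have hval : s (e.eval v) = v 7 (e.eval v) := by
    rw [← hv] at hlt ⊢
    simp [Layout.segs, hlt]
  have hlt' : v 7 (e.eval v) < 2 ^ Γ.b := by rw [← hv]; exact hs.2.2 7 (by norm_num) _
  have h5 : (Expr.load (e.comp Γ.TE)).LoadsLe s Γ.b := by
    refine ⟨h4, ?_⟩
    rw [h3, hval]
    exact size_le_of_le_pow hlt'
  have h6 := Layout.expr_cost_le h5 (by
    have := SExpr.wt_comp_le Γ.TE e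
    have h7 := Nat.mul_le_mul_right (Γ.TE.wt + 20) hw
    rw [Nat.add_mul] at h7
    simp only [Expr.wt]
    omega)
  have hT := Γ.T_pos
  refine ⟨_, Exec.store _ _ s, fun p hp => ?_, ?_⟩
  · rw [PMF.mem_support_pure_iff] at hp
    subst hp
    have h8 : (Expr.load (e.comp Γ.TE)).eval s = v 7 (e.eval v) := by
      simp only [Expr.eval, h3, hval]
    simp only [h1, h8, SExpr.eval]
    refine ⟨by omega, hs.update hT (by norm_num) _ _ fun _ => hlt', ?_⟩
    rw [Γ.segs_update hT (by norm_num), hv]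
    exact hQ
  · rw [ev_pure]

/-- The program that writes into a cell of the input region. -/
def writeProg (TE : Expr) (i e : SExpr) : Prog := .store (i.comp TE) (e.comp TE)

/-- The input region serves for the output as well. The cells `0` and `1` are excluded, because all
address computations depend on them. -/
lemma DT.write {i e : SExpr} (hi : i.ok = true) (he : e.ok = true) (hwi : i.wt ≤ 100)
    (hw : e.wt ≤ 100) (h2 : 2 ≤ i.eval v) (hR : i.eval v < Γ.R) (hb : e.eval v < 2 ^ Γ.b)
    (hQ : Q (v.set 7 (i.eval v) (e.eval v))) : DT Γ (writeProg Γ.TE i e) v Γ.w Q := by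
  intro s hs hv
  have h1 := (SExpr.comp_spec hs i hi).1
  have h3 := (SExpr.comp_spec hs e he).1
  have h4 := Layout.cost_le hs e he hw
  have h5 := Layout.cost_le hs i hi hwi
  rw [hv] at h1 h3
  refine ⟨_, Exec.store _ _ s, fun p hp => ?_, ?_⟩
  · rw [PMF.mem_support_pure_iff] at hp
    subst hp
    simp only [h1, h3]
    refine ⟨by omega, ⟨?_, ?_, ?_⟩, ?_⟩
    · rw [Function.update_of_ne (by omega)]; exact hs.1
    · rw [Function.update_of_ne (by omega)]; exact hs.2.1
    · intro σ hσ a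
      rw [Γ.segs_update_input hR]
      unfold Segs.set
      split_ifs
      · exact hb
      · exact hs.2.2 σ hσ a
    · rw [Γ.segs_update_input hR, hv]
      exact hQ
  · rw [ev_pure]

end

lemma Layout.lt_pow_of_le {Γ : Layout} {x : ℕ} (h : x ≤ Γ.b) : x < 2 ^ Γ.b :=
  h.trans_lt Nat.lt_two_pow_self

local notation "rI" => (0 : ℕ)
local notation "rJ" => (1 : ℕ)
local notation "rLen" => (2 : ℕ)
local notation "rOld" => (3 : ℕ)
local notation "rPos" => (4 : ℕ)
local notation "rGuess" => (5 : ℕ)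
local notation "rRep" => (6 : ℕ)
local notation "rCall" => (7 : ℕ)
local notation "rUnion" => (8 : ℕ)
local notation "rCount" => (9 : ℕ)
local notation "rBest" => (10 : ℕ)
local notation "rCur" => (11 : ℕ)
local notation "rMin" => (12 : ℕ)
local notation "rPtr" => (13 : ℕ)
local notation "rRow" => (14 : ℕ)
local notation "rCol" => (15 : ℕ)
local notation "rOpt" => (16 : ℕ)
local notation "rDel" => (17 : ℕ)
local notation "rTmp" => (18 : ℕ)
local notation "rCost" => (19 : ℕ)
local notation "rGuesses" => (20 : ℕ)
local notation "rReps" => (21 : ℕ)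
local notation "rChunks" => (22 : ℕ)
local notation "rBound" => (23 : ℕ)
local notation "rTagged" => (24 : ℕ)
local notation "rWidth" => (25 : ℕ)

/-- Write the binary digits of register `rTagged` into the current sandbox. -/
def emitProg (TE : Expr) : Prog :=
  forProg TE rCol (reg rWidth) (.seq
    (setProg TE (reg rCall) (reg rPtr)
      (.op .mod (.op .div (reg rTagged) (.ld 5 (reg rCol))) (.k 2)))
    (setReg TE rPtr (.op .add (reg rPtr) (.k 1))))

/-- Digit `j` of a number is its quotient by `2 ^ j` modulo `2`; the powers are tabulated in segment
`5`. -/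
lemma emitProg_spec {Γ : Layout} {v : Segs} {c N : ℕ} (hc : v 0 rCall = c) (h8 : 8 ≤ c)
    (hT : c < Γ.T) (hN : v 0 rWidth = N) (hpow : ∀ j < N, v 5 j = 2 ^ j)
    (hb : v 0 rPtr + N < 2 ^ Γ.b) :
    DT Γ (emitProg Γ.TE) v (2 * Γ.w + N * (2 * Γ.w + (Γ.w + Γ.w))) fun v' =>
      Frame [rPtr, rCol] [c] v v' ∧ v' 0 rPtr = v 0 rPtr + N ∧
      ∀ a, v' c a = if v 0 rPtr ≤ a ∧ a < v 0 rPtr + N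
        then ((v 0 rTagged).testBit (a - v 0 rPtr)).toNat else v c a := by
  have hc0 : c ≠ 0 := by omega
  refine DT.forProg (by decide) (by decide) (by decide) N (by omega) (fun i v' =>
    Frame [rPtr, rCol] [c] v v' ∧ v' 0 rPtr = v 0 rPtr + i ∧
      ∀ a, v' c a = if v 0 rPtr ≤ a ∧ a < v 0 rPtr + i
        then ((v 0 rTagged).testBit (a - v 0 rPtr)).toNat else v c a) ?_ ?_ ?_ ?_
  · rintro i v' x ⟨h1, h2, h3⟩
    refine ⟨h1.setReg (by decide) x, ?_, fun a => ?_⟩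
    · simpa [Segs.set] using h2
    · simpa [Segs.set, hc0] using h3 a
  · rintro i v' ⟨h1, -⟩
    simp only [reg, SExpr.eval]
    rw [h1.1 _ (by decide), hN]
  · refine ⟨Frame.refl, rfl, fun a => ?_⟩
    rw [if_neg (by omega)]
  · rintro i hi v' ⟨h1, h2, h3⟩ hcol
    have e1 : v' 0 rCall = c := (h1.1 _ (by decide)).trans hc
    have e2 : v' 5 i = 2 ^ i := by rw [h1.2 5 (by decide) (by simp; omega), hpow i hi]
    have e3 : v' 0 rTagged = v 0 rTagged := h1.1 _ (by decide)
    refine HT.set_seq ?_ ?_ ?_ ?_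
    · simp only [reg, SExpr.eval, e1]; exact hT
    · simp only [reg, SExpr.eval, e1]; omega
    · simp only [reg, SExpr.eval, e1]; omega
    · refine DT.setReg (by decide) (by decide) (by decide) ?_ ?_
      · simp [reg, SExpr.eval, BinOp.eval, Segs.set, e1, hc0.symm, h2]; omega
      · simp only [reg, SExpr.eval, BinOp.eval, e1, h2, hcol, e2, e3]
        refine ⟨?_, (h1.setSeg (by simp) hc0 _ _).setReg (by decide) _, ?_, fun a => ?_⟩
        · simp [Segs.set, hc0.symm, hcol]
        · simp [Segs.set, hc0.symm, h2]; omega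
        · have h4 := h3 a
          by_cases ha : a = v 0 rPtr + i
          · subst ha
            simp [Segs.set, hc0]
            rw [Nat.toNat_testBit]
          · simp only [Segs.set, hc0, ha, if_false, false_and, and_false, h4]
            congr 1
            simp only [eq_iff_iff]
            omega

/-- Tabulate the powers of `2`. -/
def powProg (TE : Expr) : Prog :=
  .seq (setProg TE (.k 5) (.k 0) (.k 1))
    (forProg TE rJ (reg rWidth)
      (setProg TE (.k 5) (.op .add (reg rJ) (.k 1)) (.op .add (.ld 5 (reg rJ)) (.ld 5 (reg rJ)))))

lemma powProg_spec {Γ : Layout} {v : Segs} {N : ℕ} (hN : v 0 rWidth = N) (hb : N < Γ.b) :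
    DT Γ (powProg Γ.TE) v (Γ.w + (2 * Γ.w + N * (2 * Γ.w + Γ.w))) fun v' =>
      Frame [rJ] [5] v v' ∧ ∀ j ≤ N, v' 5 j = 2 ^ j := by
  have hT := Γ.hT
  refine HT.set_seq (by simp only [SExpr.eval]; omega) (by simp [SExpr.eval]) (fun _ => ?_) ?_
  · simp only [SExpr.eval]
    exact Nat.one_lt_two_pow (by omega)
  refine (DT.forProg (by decide) (by decide) (by decide) N (Layout.lt_pow_of_le hb.le) (fun i v' =>
    Frame [rJ] [5] v v' ∧ ∀ j ≤ i, v' 5 j = 2 ^ j) ?_ ?_ ?_ ?_)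
  · rintro i v' x ⟨h1, h2⟩
    exact ⟨h1.setReg (by decide) x, fun j hj => by simpa [Segs.set] using h2 j hj⟩
  · rintro i v' ⟨h1, -⟩
    simp only [reg, SExpr.eval]
    rw [h1.1 _ (by decide), hN]
  · refine ⟨Frame.refl.setSeg (by simp [SExpr.eval]) (by simp [SExpr.eval]) _ _, fun j hj => ?_⟩
    have : j = 0 := by omega
    subst this
    simp [Segs.set, SExpr.eval]
  · rintro i hi v' ⟨h1, h2⟩ hJ
    have e1 := h2 i le_rfl
    have e2 : 2 ^ i + 2 ^ i = 2 ^ (i + 1) := by rw [pow_succ]; omega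
    refine DT.set (by decide) (by decide) (by decide) (by decide) (by decide)
      (by simp only [SExpr.eval]; omega) (by simp [SExpr.eval]) (fun _ => ?_) ?_
    · simp only [reg, SExpr.eval, BinOp.eval, hJ, e1, e2]
      exact Nat.pow_lt_pow_right (by norm_num) (by omega)
    · simp only [reg, SExpr.eval, BinOp.eval, hJ, e1, e2]
      refine ⟨by simp [Segs.set, hJ], h1.setSeg (by simp) (by simp) _ _, fun j hj => ?_⟩
      by_cases hji : j = i + 1
      · subst hji; simp [Segs.set]
      · simpa [Segs.set, hji] using h2 j (by omega)

/-- The number with binary digits `f 0, …, f (j - 1)`. -/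
def ofDigits (f : ℕ → ℕ) : ℕ → ℕ
  | 0 => 0
  | j + 1 => ofDigits f j + f j * 2 ^ j

lemma ofDigits_lt {f : ℕ → ℕ} (hf : ∀ j, f j ≤ 1) (j : ℕ) : ofDigits f j < 2 ^ j := by
  induction j with
  | zero => simp [ofDigits]
  | succ j ih =>
    have := Nat.mul_le_mul_right (2 ^ j) (hf j)
    rw [ofDigits, pow_succ]
    omega

lemma testBit_ofDigits {f : ℕ → ℕ} (hf : ∀ j, f j ≤ 1) (j v : ℕ) :
    (ofDigits f j).testBit v = true ↔ v < j ∧ f v = 1 := by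
  induction j with
  | zero => simp [ofDigits]
  | succ j ih =>
    have h1 := ofDigits_lt hf j
    have h2 := hf j
    rw [ofDigits]
    interval_cases h : f j
    · rw [zero_mul, add_zero, ih]
      constructor
      · rintro ⟨h3, h4⟩; exact ⟨by omega, h4⟩
      · rintro ⟨h3, h4⟩
        have : v ≠ j := by rintro rfl; omega
        exact ⟨by omega, h4⟩
    · have := testBit_tagged (n := j) (j := 0) h1 v
      rw [add_zero] at this
      rw [one_mul, this, Bool.or_eq_true, ih, decide_eq_true_eq]
      constructor
      · rintro (⟨h3, h4⟩ | rfl)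
        · exact ⟨by omega, h4⟩
        · exact ⟨by omega, h⟩
      · rintro ⟨h3, h4⟩
        by_cases hv : v = j
        · exact Or.inr hv
        · exact Or.inl ⟨by omega, h4⟩

/-- Compute the sets of the instance as numbers. -/
def maskProg (TE : Expr) : Prog :=
  forProg TE rI .m (forProg TE rJ .n (.seq
    (readProg TE rTmp (.op .add (.k 2) (.op .add (.op .mul (reg rI) .n) (reg rJ))))
    (setProg TE (.k 1) (reg rI)
      (.op .add (.ld 1 (reg rI)) (.op .mul (reg rTmp) (.ld 5 (reg rJ)))))))

/-- Index `Γ.m` keeps the mask `0`; this is the empty set that pads the guesses. -/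
lemma maskProg_spec {Γ : Layout} {v : Segs} (f : ℕ → ℕ → ℕ)
    (hf : ∀ i j, f i j ≤ 1)
    (hin : ∀ i < Γ.m, ∀ j < Γ.n, v 7 (2 + (i * Γ.n + j)) = f i j)
    (h1 : ∀ i, v 1 i = 0) (hpow : ∀ j ≤ Γ.n, v 5 j = 2 ^ j) (hb : Γ.n ≤ Γ.b)
    (hn7 : v 7 0 = Γ.n) (hm7 : v 7 1 = Γ.m) :
    DT Γ (maskProg Γ.TE) v
      (2 * Γ.w + Γ.m * (2 * Γ.w + (2 * Γ.w + Γ.n * (2 * Γ.w + (Γ.w + Γ.w))))) fun v' =>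
      Frame [rI, rJ, rTmp] [1] v v' ∧
      ∀ i, v' 1 i = if i < Γ.m then ofDigits (f i) Γ.n else 0 := by
  have hT := Γ.hT
  have hnb := Γ.hn
  have hmb := Γ.hm
  refine (DT.forProg (by decide) (by decide) (by decide) Γ.m hmb (fun i v' =>
    Frame [rI, rJ, rTmp] [1] v v' ∧
      ∀ k, v' 1 k = if k < i then ofDigits (f k) Γ.n else 0) ?_ ?_ ?_ ?_)
  · rintro i v' x ⟨h2, h3⟩
    exact ⟨h2.setReg (by decide) x, fun k => by simpa [Segs.set] using h3 k⟩
  · rintro i v' ⟨h2, -⟩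
    simp only [SExpr.eval]
    rw [h2.2 7 (by decide) (by decide), hm7]
  · exact ⟨Frame.refl, fun k => by simp [h1]⟩
  · rintro i hi v' ⟨h2, h3⟩ hI
    refine (DT.forProg (by decide) (by decide) (by decide) Γ.n hnb (fun j v'' =>
      Frame [rI, rJ, rTmp] [1] v v'' ∧ v'' 0 rI = i ∧
        ∀ k, v'' 1 k = if k < i then ofDigits (f k) Γ.n else if k = i then ofDigits (f i) j else 0)
        ?_ ?_ ?_ ?_).mono le_rfl ?_
    · rintro j v' x ⟨h2, h3, h4⟩
      exact ⟨h2.setReg (by decide) x, by simpa [Segs.set] using h3,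
        fun k => by simpa [Segs.set] using h4 k⟩
    · rintro i v' ⟨h2, -⟩
      simp only [SExpr.eval]
      rw [h2.2 7 (by decide) (by decide), hn7]
    · refine ⟨h2, hI, fun k => ?_⟩
      rw [h3]
      split_ifs <;> rfl
    · rintro j hj v'' ⟨h4, h5, h6⟩ hJ
      have e1 : v'' 7 0 = Γ.n := by rw [h4.2 7 (by decide) (by decide), hn7]
      have e2 : v'' 5 j = 2 ^ j := by rw [h4.2 5 (by decide) (by decide), hpow j hj.le]
      have e3 : v'' 7 (2 + (i * Γ.n + j)) = f i j := by
        rw [h4.2 7 (by decide) (by decide), hin i hi j hj]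
      have e4 : v'' 1 i = ofDigits (f i) j := by rw [h6]; simp
      have hlt : 2 + (i * Γ.n + j) < Γ.R := by
        have := Nat.mul_le_mul_right Γ.n (show i + 1 ≤ Γ.m by omega)
        unfold Layout.R
        rw [mul_comm Γ.n]
        rw [Nat.add_mul] at this
        omega
      have hval : (SExpr.op .add (.k 2) (.op .add (.op .mul (reg rI) .n) (reg rJ))).eval v'' =
          2 + (i * Γ.n + j) := by
        simp only [reg, SExpr.eval, BinOp.eval, h5, e1, hJ]
      refine HT.seq_right (DT.read (Q := fun v3 => v3 = v''.set 0 rTmp (f i j)) (by decide)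
        (by decide) (by decide) (by rw [hval]; exact hlt) (by rw [hval, e3])) ?_
      rintro _ rfl
      have e5 : ofDigits (f i) j + f i j * 2 ^ j = ofDigits (f i) (j + 1) := rfl
      refine DT.set (by decide) (by decide) (by decide) (by decide) (by decide)
        (by simp only [SExpr.eval]; omega) (by simp [SExpr.eval]) (fun _ => ?_) ?_
      · simp only [reg, SExpr.eval, BinOp.eval, Segs.set]
        simp only [h5, hJ]
        simp
        rw [e4, e2, e5]
        exact (ofDigits_lt (hf i) (j + 1)).trans_le
          (Nat.pow_le_pow_right (by norm_num) (by omega))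
      · refine ⟨?_, (h4.setReg (by decide) _).setSeg (by simp [SExpr.eval]) (by simp [SExpr.eval]) _ _, ?_, fun k => ?_⟩
        · simp [Segs.set, SExpr.eval, hJ]
        · simp [Segs.set, SExpr.eval, h5]
        · by_cases hk : k = i
          · subst hk
            simp [Segs.set, SExpr.eval, reg, h5, hJ, BinOp.eval, e4, e2, e5]
          · simpa [Segs.set, SExpr.eval, reg, h5, hk] using h6 k
    · rintro v'' ⟨h4, h5, h6⟩
      refine ⟨h5, h4, fun k => ?_⟩
      rw [h6]
      by_cases hk : k = i
      · subst hk; simp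
      · have : k < i ↔ k < i + 1 := by omega
        simp [hk, this]

/-- The list `l` of numbers with cardinalities is stored in the memory. -/
def Stored (v : Segs) (l : List (ℕ × ℕ)) : Prop :=
  v 0 rLen = l.length ∧ ∀ i q, l[i]? = some q → v 2 i = q.1 ∧ v 3 i = q.2

/-- List the small subsets. -/
def listProg (TE : Expr) : Prog :=
  .seq (setProg TE (.k 2) (.k 0) (.k 0)) (.seq (setProg TE (.k 3) (.k 0) (.k 0))
  (.seq (setReg TE rLen (.k 1))
  (forProg TE rJ .n (.seq (setReg TE rOld (reg rLen))
    (forProg TE rPos (reg rOld)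
      (.cond ((SExpr.op .lt (.ld 3 (reg rPos)) (reg rBound)).comp TE)
        (.seq (setProg TE (.k 2) (reg rLen) (.op .add (.ld 2 (reg rPos)) (.ld 5 (reg rJ))))
        (.seq (setProg TE (.k 3) (reg rLen) (.op .add (.ld 3 (reg rPos)) (.k 1)))
          (setReg TE rLen (.op .add (reg rLen) (.k 1)))))
        .skip))))))

lemma Stored.append {v : Segs} {l : List (ℕ × ℕ)} (h : Stored v l) (q : ℕ × ℕ) :
    Stored (((v.set 2 l.length q.1).set 3 l.length q.2).set 0 rLen (l.length + 1)) (l ++ [q]) := by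
  refine ⟨by simp [Segs.set], fun i r hi => ?_⟩
  rw [List.getElem?_append] at hi
  split_ifs at hi with hlt
  · have := h.2 i r hi
    simpa [Segs.set, hlt.ne] using this
  · have hle := (List.getElem?_eq_some_iff.1 hi).1
    simp only [List.length_singleton] at hle
    have : i = l.length := by omega
    subst this
    simp at hi
    subst hi
    simp [Segs.set]

/-- The inner loop runs up to the old length, which is saved in `rOld`, while the list grows behind
it; it thereby follows the recursion of `smallSubsets`. The time is stated through a bound `N` for
all intermediate lengths, since it must be of the order of the number of small subsets and not of `2
^ n`. -/
lemma listProg_spec {Γ : Layout} {v : Segs} {h : ℕ} (hh : v 0 rBound = h) (hhb : h ≤ Γ.b)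
    (hb : Γ.n + 1 ≤ Γ.b) (hpow : ∀ j ≤ Γ.n, v 5 j = 2 ^ j) (hn7 : v 7 0 = Γ.n) {N : ℕ}
    (hN : ∀ j ≤ Γ.n, (smallSubsets h j).length ≤ N) :
    DT Γ (listProg Γ.TE) v (Γ.w + (Γ.w + (Γ.w + (2 * Γ.w + Γ.n * (2 * Γ.w + (Γ.w +
      (2 * Γ.w + N * (2 * Γ.w + (Γ.w + (Γ.w + (Γ.w + Γ.w)))))))))) ) fun v' =>
      Frame [rJ, rLen, rOld, rPos] [2, 3] v v' ∧ Stored v' (smallSubsets h Γ.n) := by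
  have hT := Γ.hT
  have hnb := Γ.hn
  have hpb : ∀ x ≤ 2 ^ Γ.n, x < 2 ^ Γ.b := fun x hx =>
    hx.trans_lt (Nat.pow_lt_pow_right (by norm_num) (by omega))
  have h1b : 1 < 2 ^ Γ.b := Nat.one_lt_two_pow (by omega)
  refine HT.set_seq (by simp only [SExpr.eval]; omega) (by simp [SExpr.eval])
    (fun _ => by simp [SExpr.eval]) ?_
  refine HT.set_seq (by simp only [SExpr.eval]; omega) (by simp [SExpr.eval])
    (fun _ => by simp [SExpr.eval]) ?_
  refine HT.setReg_seq (by simpa [SExpr.eval] using h1b) ?_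
  refine (DT.forProg (by decide) (by decide) (by decide) Γ.n hnb (fun j v' =>
    Frame [rJ, rLen, rOld, rPos] [2, 3] v v' ∧ Stored v' (smallSubsets h j)) ?_ ?_ ?_ ?_)
  · rintro i v' x ⟨h2, h3, h4⟩
    exact ⟨h2.setReg (by decide) x, by simpa [Segs.set] using h3,
      fun i q hq => by simpa [Segs.set] using h4 i q hq⟩
  · rintro i v' ⟨h2, -⟩
    simp only [SExpr.eval]
    rw [h2.2 7 (by decide) (by decide), hn7]
  · refine ⟨((Frame.refl.setSeg (by simp [SExpr.eval]) (by simp [SExpr.eval]) _ _).setSeg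
      (by simp [SExpr.eval]) (by simp [SExpr.eval]) _ _).setReg (by decide) _, ?_, fun i q hq => ?_⟩
    · simp [Segs.set, SExpr.eval, smallSubsets]
    · have hi := (List.getElem?_eq_some_iff.1 hq).1
      simp only [smallSubsets, List.length_singleton] at hi
      have : i = 0 := by omega
      subst this
      simp only [smallSubsets, List.getElem?_cons_zero, Option.some.injEq] at hq
      subst hq
      simp [Segs.set, SExpr.eval]
  · rintro j hj v' ⟨h2, h3⟩ hJ
    set S := smallSubsets h j with hS
    have hlenS : S.length ≤ 2 ^ j := length_smallSubsets_le h j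
    have hjn : 2 ^ (j + 1) ≤ 2 ^ Γ.n := Nat.pow_le_pow_right (by norm_num) hj
    have hjs : 2 ^ (j + 1) = 2 ^ j + 2 ^ j := by rw [pow_succ]; omega
    have hlenb : S.length < 2 ^ Γ.b := hpb _ (by omega)
    refine HT.setReg_seq (by simpa [SExpr.eval, reg, h3.1] using hlenb) ?_
    have := hN j hj.le
    refine (DT.forProg (t := Γ.w + (Γ.w + (Γ.w + Γ.w))) (by decide) (by decide) (by decide) S.length
      hlenb (fun i v'' =>
      Frame [rJ, rLen, rOld, rPos] [2, 3] v v'' ∧ v'' 0 rJ = j ∧ v'' 0 rOld = S.length ∧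
      Stored v'' (S ++ ((S.take i).filter (fun q => q.2 < h)).map
        fun q => (q.1 + 2 ^ j, q.2 + 1))) ?_ ?_ ?_ ?_).mono ?_ ?_
    · rintro i v' x ⟨h2, h5, h6, h3, h4⟩
      exact ⟨h2.setReg (by decide) x, by simpa [Segs.set] using h5, by simpa [Segs.set] using h6,
        by simpa [Segs.set] using h3, fun i q hq => by simpa [Segs.set] using h4 i q hq⟩
    · rintro i v' ⟨-, -, h4, -⟩
      simp only [reg, SExpr.eval, h4]
    · refine ⟨h2.setReg (by decide) _, by simp [Segs.set, hJ], ?_, ?_, fun i q hq => ?_⟩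
      · simp [Segs.set, SExpr.eval, reg, h3.1]
      · simp [Segs.set, h3.1]
      · simp only [List.take_zero, List.filter_nil, List.map_nil, List.append_nil] at hq
        simpa [Segs.set] using h3.2 i q hq
    · rintro i hi v'' ⟨h4, h5, h6, h7⟩ hP
      set E := ((S.take i).filter (fun q => q.2 < h)).map
        (fun q : ℕ × ℕ => (q.1 + 2 ^ j, q.2 + 1)) with hE
      have hlenE : E.length ≤ i := by
        rw [hE, List.length_map]
        exact (List.length_filter_le _ _).trans (by rw [List.length_take]; omega)
      have hget : (S ++ E)[i]? = some S[i] := by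
        rw [List.getElem?_append_left hi, List.getElem?_eq_getElem hi]
      obtain ⟨e1, e2⟩ := h7.2 i _ hget
      have e3 : v'' 5 j = 2 ^ j := by rw [h4.2 5 (by decide) (by decide), hpow j hj.le]
      have e4 : v'' 0 rBound = h := (h4.1 _ (by decide)).trans hh
      have e5 := h7.1
      have hmem := (mem_smallSubsets j S[i].1 S[i].2).1 (List.getElem_mem hi)
      have htake : S.take (i + 1) = S.take i ++ [S[i]] := List.take_succ_eq_append_getElem hi
      have hlen' : (S ++ E).length + 1 ≤ 2 ^ Γ.n := by rw [List.length_append]; omega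
      refine HT.cond _ (by decide) (by decide) (fun hc => ?_) fun hc => ?_
      · have hlt : S[i].2 < h := by
          by_contra hlt
          simp [SExpr.eval, BinOp.eval, reg, hP, e2, e4, hlt] at hc
        refine HT.set_seq (by simp only [SExpr.eval]; omega) (by simp [SExpr.eval]) (fun _ => ?_) ?_
        · simp only [SExpr.eval, BinOp.eval, reg, hP, e1, h5, e3]
          exact hpb _ (by omega)
        refine HT.set_seq (by simp only [SExpr.eval]; omega) (by simp [SExpr.eval]) (fun _ => ?_) ?_
        · simp [SExpr.eval, BinOp.eval, reg, hP, e2, Segs.set]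
          exact Layout.lt_pow_of_le (by omega)
        refine DT.setReg (by decide) (by decide) (by decide) ?_ ?_
        · simp [SExpr.eval, BinOp.eval, reg, Segs.set, e5]
          rw [List.length_append] at hlen'
          exact hpb _ hlen'
        · have hst := h7.append (S[i].1 + 2 ^ j, S[i].2 + 1)
          simp only at hst
          have heq : S ++ ((S.take (i + 1)).filter (fun q => q.2 < h)).map
              (fun q : ℕ × ℕ => (q.1 + 2 ^ j, q.2 + 1)) =
              S ++ E ++ [(S[i].1 + 2 ^ j, S[i].2 + 1)] := by
            rw [htake, List.filter_append, List.map_append, ← hE, List.append_assoc]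
            simp [hlt]
          simp only [SExpr.eval, BinOp.eval, reg, hP, e1, h5, e3, e5]
          simp only [Segs.set, e5]
          rw [heq]
          refine ⟨by simp [hP], ?_, by simp [h5], by simp [h6], ?_⟩
          · exact ((h4.setSeg (by simp) (by simp) _ _).setSeg (by simp) (by simp) _ _).setReg
              (by decide) _
          · simpa [Segs.set, hP, e2] using hst
      · have hlt : ¬ S[i].2 < h := by
          intro hlt
          simp [SExpr.eval, BinOp.eval, reg, hP, e2, e4, hlt] at hc
        refine (DT.skip (Q := _) ?_).mono (by omega) (fun _ h => h)
        have heq : S ++ ((S.take (i + 1)).filter (fun q => q.2 < h)).map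
            (fun q : ℕ × ℕ => (q.1 + 2 ^ j, q.2 + 1)) = S ++ E := by
          rw [htake, List.filter_append, List.map_append, ← hE]
          simp [hlt]
        rw [heq]
        exact ⟨hP, h4, h5, h6, h7⟩
    · gcongr
    · rintro v'' ⟨h4, h5, h6, h7⟩
      rw [List.take_length] at h7
      exact ⟨h5, h4, h7⟩

/-! ### Decoding a guess and tabulating the covering numbers. -/

section

open Finset

/-- Compute the digits of register `rGuess` in base `m + 1`. -/
def digitProg (TE : Expr) : Prog :=
  .seq (setReg TE rTmp (reg rGuess))
    (forProg TE rJ (.op .add (reg rChunks) (reg rChunks)) (.seq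
      (setProg TE (.k 6) (reg rJ) (.op .mod (reg rTmp) (.op .add .m (.k 1))))
      (setReg TE rTmp (.op .div (reg rTmp) (.op .add .m (.k 1))))))

lemma digitProg_spec {Γ : Layout} {v : Segs} {t : ℕ} (ht : v 0 rChunks = t) (hb : t + t ≤ Γ.b) :
    DT Γ (digitProg Γ.TE) v (Γ.w + (2 * Γ.w + (t + t) * (2 * Γ.w + (Γ.w + Γ.w)))) fun v' =>
      Frame [rJ, rTmp] [6] v v' ∧
      ∀ j < t + t, v' 6 j = v 0 rGuess / (Γ.m + 1) ^ j % (Γ.m + 1) := by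
  have hT := Γ.hT
  refine HT.of_wf fun hn hm hwf => ?_
  have hgb := hwf 0 (by norm_num) rGuess
  refine HT.setReg_seq (by simpa [SExpr.eval, reg] using hgb) ?_
  refine (DT.forProg (by decide) (by decide) (by decide) (t + t) (Layout.lt_pow_of_le hb)
    (fun i v' => Frame [rJ, rTmp] [6] v v' ∧ v' 0 rTmp = v 0 rGuess / (Γ.m + 1) ^ i ∧
      ∀ j < i, v' 6 j = v 0 rGuess / (Γ.m + 1) ^ j % (Γ.m + 1)) ?_ ?_ ?_ ?_).mono le_rfl
    fun v' h => ⟨h.1, h.2.2⟩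
  · rintro i v' x ⟨h1, h2, h3⟩
    exact ⟨h1.setReg (by decide) x, by simpa [Segs.set] using h2,
      fun j hj => by simpa [Segs.set] using h3 j hj⟩
  · rintro i v' ⟨h1, -⟩
    simp only [reg, SExpr.eval, BinOp.eval]
    rw [h1.1 _ (by decide), ht]
  · exact ⟨Frame.refl.setReg (by decide) _, by simp [Segs.set, reg, SExpr.eval], by simp⟩
  · rintro i hi v' ⟨h1, h2, h3⟩ hJ
    have e1 : v' 7 1 = Γ.m := by rw [h1.2 7 (by decide) (by decide), hm]
    have hle : v 0 rGuess / (Γ.m + 1) ^ i < 2 ^ Γ.b := (Nat.div_le_self _ _).trans_lt hgb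
    refine HT.set_seq (by simp only [SExpr.eval]; omega) (by simp [SExpr.eval]) (fun _ => ?_) ?_
    · simp only [reg, SExpr.eval, BinOp.eval, e1, h2]
      exact (Nat.mod_le _ _).trans_lt hle
    · refine DT.setReg (by decide) (by decide) (by decide) ?_ ?_
      · simp [reg, SExpr.eval, BinOp.eval, e1, h2, Segs.set]
        exact (Nat.div_le_self _ _).trans_lt hle
      · simp only [reg, SExpr.eval, BinOp.eval, e1, h2, hJ]
        refine ⟨by simp [Segs.set, hJ], (h1.setSeg (by simp) (by simp) _ _).setReg (by decide) _,
          ?_, fun j hj => ?_⟩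
        · simp [Segs.set, e1, h2, Nat.div_div_eq_div_mul, pow_succ]
        · by_cases hji : j = i
          · subst hji; simp [Segs.set]
          · simpa [Segs.set, hji] using h3 j (by omega)

/-- Compute the union of the sets of a guess and its cost. -/
def unionProg (TE : Expr) : Prog :=
  .seq (setReg TE rUnion (.k 0)) (.seq (setReg TE rCost (.k 0))
    (forProg TE rJ (reg rChunks) (.seq
      (setReg TE rUnion (.op .lor (reg rUnion) (.ld 1 (.ld 6 (reg rJ)))))
      (setReg TE rCost (.op .add (reg rCost) (.op .add (.ld 6 (.op .add (reg rChunks) (reg rJ)))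
        (.op .lt (.ld 6 (reg rJ)) .m)))))))

lemma guessCost_le {m t s : ℕ} {d : ℕ → ℕ} (hd : ∀ j < s, d (t + j) ≤ m) :
    guessCost m d t s ≤ s * (m + 1) := by
  have : guessCost m d t s ≤ ∑ j ∈ range s, (m + 1) := by
    refine sum_le_sum fun j hj => ?_
    have := hd j (mem_range.1 hj)
    split_ifs <;> omega
  simpa using this

lemma unionProg_spec {Γ : Layout} {v : Segs} {t : ℕ} (ht : v 0 rChunks = t)
    (hb : t * (Γ.m + 1) ≤ Γ.b) (hd : ∀ j < t + t, v 6 j ≤ Γ.m) :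
    DT Γ (unionProg Γ.TE) v (Γ.w + (Γ.w + (2 * Γ.w + t * (2 * Γ.w + (Γ.w + Γ.w))))) fun v' =>
      Frame [rJ, rUnion, rCost] [] v v' ∧ v' 0 rUnion = unionOf (v 1) (v 6) t ∧
        v' 0 rCost = guessCost Γ.m (v 6) t t := by
  have hT := Γ.hT
  refine HT.of_wf fun hn hm hwf => ?_
  have htb : t ≤ Γ.b := (Nat.le_mul_of_pos_right t (by omega)).trans hb
  refine HT.setReg_seq (by simp [SExpr.eval]) ?_
  refine HT.setReg_seq (by simp [SExpr.eval]) ?_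
  refine DT.forProg (by decide) (by decide) (by decide) t (Layout.lt_pow_of_le htb)
    (fun i v' => Frame [rJ, rUnion, rCost] [] v v' ∧ v' 0 rUnion = unionOf (v 1) (v 6) i ∧
        v' 0 rCost = guessCost Γ.m (v 6) t i) ?_ ?_ ?_ ?_
  · rintro i v' x ⟨h1, h2, h3⟩
    exact ⟨h1.setReg (by decide) x, by simpa [Segs.set] using h2, by simpa [Segs.set] using h3⟩
  · rintro i v' ⟨h1, -⟩
    simp only [reg, SExpr.eval]
    rw [h1.1 _ (by decide), ht]
  · exact ⟨(Frame.refl.setReg (by decide) _).setReg (by decide) _,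
      by simp [Segs.set, SExpr.eval, unionOf], by simp [Segs.set, SExpr.eval, guessCost]⟩
  · rintro i hi v' ⟨h1, h2, h3⟩ hJ
    have e1 : v' 7 1 = Γ.m := by rw [h1.2 7 (by decide) (by decide), hm]
    have e2 : v' 1 = v 1 := h1.2 1 (by decide) (by decide)
    have e3 : v' 6 = v 6 := h1.2 6 (by decide) (by decide)
    have e4 : v' 0 rChunks = t := (h1.1 _ (by decide)).trans ht
    have e5 : unionOf (v 1) (v 6) i ||| v 1 (v 6 i) = unionOf (v 1) (v 6) (i + 1) := rfl
    have e6 : guessCost Γ.m (v 6) t i + (v 6 (t + i) + if v 6 i < Γ.m then 1 else 0) =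
        guessCost Γ.m (v 6) t (i + 1) := (sum_range_succ _ _).symm
    have hlt : unionOf (v 1) (v 6) (i + 1) < 2 ^ Γ.b := by
      have : ∀ k, unionOf (v 1) (v 6) k < 2 ^ Γ.b := by
        intro k
        induction k with
        | zero => simp [unionOf]
        | succ k ih => exact Nat.or_lt_two_pow ih (hwf 1 (by norm_num) _)
      exact this _
    refine HT.setReg_seq ?_ ?_
    · simpa [reg, SExpr.eval, BinOp.eval, h2, e2, e3, hJ, e5] using hlt
    · refine DT.setReg (by decide) (by decide) (by decide) ?_ ?_
      · simp [reg, SExpr.eval, BinOp.eval, h2, e1, e2, e3, e4, hJ, Segs.set, h3, e6]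
        refine Layout.lt_pow_of_le (le_trans (guessCost_le fun j hj => hd _ (by omega)) (le_trans ?_ hb))
        exact Nat.mul_le_mul_right _ hi
      · refine ⟨by simp [Segs.set, hJ], (h1.setReg (by decide) _).setReg (by decide) _, ?_, ?_⟩
        · simp [reg, SExpr.eval, BinOp.eval, h2, e2, e3, hJ, Segs.set, e5]
        · simp [reg, SExpr.eval, BinOp.eval, h2, e1, e2, e3, e4, hJ, Segs.set, h3, e6]

/-- Compute the numbers of sets that are needed to cover the small subsets outside of register
`rUnion`. -/
def tableProg (TE : Expr) : Prog :=
  forProg TE rPos (reg rLen) (.seq (setReg TE rCur (.ld 2 (reg rPos)))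
    (.seq (setReg TE rMin (.op .mul (.op .sub (.k 1)
      (.op .eq (.op .land (reg rCur) (reg rUnion)) (reg rCur))) (.op .add .m (.k 1))))
    (.seq (forProg TE rI .m
      (.cond ((SExpr.op .mul (.op .land (reg rCur) (.ld 1 (reg rI)))
        (.op .lt (.op .add (.ld 4 (.op .xor (reg rCur) (.op .land (reg rCur) (.ld 1 (reg rI)))))
          (.k 1)) (reg rMin))).comp TE)
        (setReg TE rMin (.op .add
          (.ld 4 (.op .xor (reg rCur) (.op .land (reg rCur) (.ld 1 (reg rI))))) (.k 1)))
        .skip))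
      (setProg TE (.k 4) (reg rCur) (reg rMin)))))

/-- Dynamic programming along the list of small subsets with the recurrence `covered_iff`. Removing
the elements of a set gives a subset that is again small and, if anything was removed, a smaller
number, so its entry is already there. -/
lemma tableProg_spec {Γ : Layout} {v : Segs} {h : ℕ}
    (hlen : v 0 rLen = (smallList h Γ.n).length)
    (hl : ∀ i X, (smallList h Γ.n)[i]? = some X → v 2 i = X)
    (hb : Γ.m + 1 ≤ Γ.b) :
    DT Γ (tableProg Γ.TE) v (2 * Γ.w + (smallList h Γ.n).length * (2 * Γ.w + (Γ.w + (Γ.w +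
        ((2 * Γ.w + Γ.m * (2 * Γ.w + (Γ.w + Γ.w))) + Γ.w))))) fun v' =>
      Frame [rI, rPos, rCur, rMin] [4] v v' ∧
        IsCoverTable (v 1) Γ.m (v 0 rUnion) (smallList h Γ.n) (v' 4) := by
  have hT := Γ.hT
  refine HT.of_wf fun hn hm hwf => ?_
  set l := smallList h Γ.n with hl_def
  have hlb : l.length < 2 ^ Γ.b := hlen ▸ hwf 0 (by norm_num) rLen
  refine (DT.forProg (by decide) (by decide) (by decide) l.length hlb (fun i v' =>
    Frame [rI, rPos, rCur, rMin] [4] v v' ∧ ∀ k X, l[k]? = some X → k < i → ∀ c ≤ Γ.m,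
      v' 4 X ≤ c ↔ Covered (v 1) Γ.m (v 0 rUnion) X c) ?_ ?_ ?_ ?_).mono le_rfl ?_
  · rintro i v' x ⟨h1, h2⟩
    exact ⟨h1.setReg (by decide) x, fun k X hk hki c hc => by
      simpa [Segs.set] using h2 k X hk hki c hc⟩
  · rintro i v' ⟨h1, -⟩
    simp only [reg, SExpr.eval]
    rw [h1.1 _ (by decide), hlen]
  · exact ⟨Frame.refl, fun k X _ hk => absurd hk (by omega)⟩
  · rintro i hi v' ⟨h1, h2⟩ hP
    obtain ⟨X, hX⟩ : ∃ X, l[i]? = some X := ⟨_, List.getElem?_eq_getElem hi⟩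
    have hXl : X ∈ l := List.mem_of_getElem? hX
    have e0 : v 2 i = X := hl i X hX
    have e1 : v' 2 i = X := by rw [h1.2 2 (by decide) (by decide), e0]
    have e2 : v' 0 rUnion = v 0 rUnion := h1.1 _ (by decide)
    have e3 : v' 7 1 = Γ.m := by rw [h1.2 7 (by decide) (by decide), hm]
    have hXb : X < 2 ^ Γ.b := e0 ▸ hwf 2 (by norm_num) i
    have hmb : Γ.m + 1 < 2 ^ Γ.b := Layout.lt_pow_of_le hb
    set V := v 0 rUnion with hV
    -- The smaller number has a smaller index in the sorted list, so the invariant of the outer loop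
    -- applies to it.
    have hsub : ∀ a, X &&& v 1 a ≠ 0 → ∀ c ≤ Γ.m, v' 4 (X ^^^ (X &&& v 1 a)) ≤ c ↔
        Covered (v 1) Γ.m V (X ^^^ (X &&& v 1 a)) c := by
      intro a ha
      obtain ⟨k, hk, he⟩ := List.getElem_of_mem (diff_mem_smallList hXl (v 1 a))
      refine h2 k _ (by rw [List.getElem?_eq_getElem hk, he]) ?_
      by_contra hki
      have h3 := diff_lt ha
      have h4 : X = l[i] := by
        rw [List.getElem?_eq_getElem hi] at hX
        exact (Option.some.inj hX).symm
      rcases Nat.lt_or_eq_of_le (Nat.le_of_not_lt hki) with h5 | h5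
      · have := List.pairwise_iff_getElem.1 (pairwise_smallList h Γ.n) i k hi hk h5
        rw [he, ← h4] at this
        omega
      · subst h5
        rw [← he, ← h4] at h3
        omega
    -- The minimum starts at `0` if `X` is contained in `V`, and otherwise at `m + 1`, which plays
    -- the part of infinity.
    have hinit : (1 - if X &&& V = X then 1 else 0) * (Γ.m + 1) ≤ Γ.m + 1 := by
      split_ifs <;> simp
    refine HT.setReg_seq (by simpa [reg, SExpr.eval, hP, e1] using hXb) ?_
    refine HT.setReg_seq ?_ ?_
    · simp [reg, SExpr.eval, BinOp.eval, Segs.set, hP, e1, e2, e3]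
      exact lt_of_le_of_lt hinit hmb
    refine HT.seq_right (DT.forProg (t := Γ.w + Γ.w) (by decide) (by decide) (by decide) Γ.m Γ.hm (fun a v'' =>
      Frame [rI, rPos, rCur, rMin] [] v' v'' ∧ v'' 0 rPos = i ∧ v'' 0 rCur = X ∧
      v'' 0 rMin ≤ Γ.m + 1 ∧ ∀ c ≤ Γ.m, v'' 0 rMin ≤ c ↔ X &&& V = X ∨ ∃ a' < a,
        X &&& v 1 a' ≠ 0 ∧ 0 < c ∧ Covered (v 1) Γ.m V (X ^^^ (X &&& v 1 a')) (c - 1))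
        ?_ ?_ ?_ ?_) ?_
    · rintro a v'' x ⟨h3, h4, h5, h6, h7⟩
      exact ⟨h3.setReg (by decide) x, by simpa [Segs.set] using h4, by simpa [Segs.set] using h5,
        by simpa [Segs.set] using h6, fun c hc => by simpa [Segs.set] using h7 c hc⟩
    · rintro a v'' ⟨h3, -⟩
      simp only [SExpr.eval]
      rw [h3.2 7 (by decide) (by decide), e3]
    · refine ⟨(Frame.refl.setReg (by decide) _).setReg (by decide) _, ?_, ?_, ?_, ?_⟩
      · simp [Segs.set, hP]
      · simp [Segs.set, reg, SExpr.eval, hP, e1]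
      · simp [reg, SExpr.eval, BinOp.eval, Segs.set, hP, e1, e2, e3]
      · intro c hc
        simp [reg, SExpr.eval, BinOp.eval, Segs.set, hP, e1, e2, e3]
        split_ifs with hXV
        · simp [hXV]
        · simp [hXV]
          omega
    · rintro a ha v'' ⟨h3, h4, h5, h6, h7⟩ hI
      have e4 : v'' 1 = v 1 := by
        rw [h3.2 1 (by decide) (by decide), h1.2 1 (by decide) (by decide)]
      have e5 : v'' 4 = v' 4 := h3.2 4 (by decide) (by decide)
      have hcond : (SExpr.op .mul (.op .land (reg rCur) (.ld 1 (reg rI)))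
        (.op .lt (.op .add (.ld 4 (.op .xor (reg rCur) (.op .land (reg rCur) (.ld 1 (reg rI)))))
          (.k 1)) (reg rMin))).eval v'' ≠ 0 ↔
          X &&& v 1 a ≠ 0 ∧ v' 4 (X ^^^ (X &&& v 1 a)) + 1 < v'' 0 rMin := by
        simp [reg, SExpr.eval, BinOp.eval, h5, hI, e4, e5, and_comm]
      refine HT.cond _ (by decide) (by decide) (fun hc => ?_) fun hc => ?_
      · rw [hcond] at hc
        obtain ⟨hc1, hc2⟩ := hc
        have hval : (SExpr.op .add (.ld 4 (.op .xor (reg rCur)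
            (.op .land (reg rCur) (.ld 1 (reg rI))))) (.k 1)).eval v'' =
            v' 4 (X ^^^ (X &&& v 1 a)) + 1 := by
          simp [reg, SExpr.eval, BinOp.eval, h5, hI, e4, e5]
        refine DT.setReg (by decide) (by decide) (by decide) ?_ ?_
        · rw [hval]; omega
        · rw [hval]
          refine ⟨by simp [Segs.set, hI], h3.setReg (by decide) _, by simp [Segs.set, h4],
            by simp [Segs.set, h5], ?_, ?_⟩
          · simp [Segs.set]; omega
          · intro c hc
            have h8 := h7 c hc
            have h9 := hsub a hc1
            have e6 : (v''.set 0 rMin (v' 4 (X ^^^ (X &&& v 1 a)) + 1)) 0 rMin =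
              v' 4 (X ^^^ (X &&& v 1 a)) + 1 := by simp [Segs.set]
            rw [e6]
            constructor
            · intro h10
              exact Or.inr ⟨a, by omega, hc1, by omega, (h9 (c - 1) (by omega)).1 (by omega)⟩
            · rintro (h10 | ⟨a', ha', h11, h12, h13⟩)
              · have := h8.2 (Or.inl h10)
                omega
              · by_cases haa : a' = a
                · subst haa
                  have := (h9 (c - 1) (by omega)).2 h13
                  omega
                · have := h8.2 (Or.inr ⟨a', by omega, h11, h12, h13⟩)
                  omega
      · have hc' : ¬ (X &&& v 1 a ≠ 0 ∧ v' 4 (X ^^^ (X &&& v 1 a)) + 1 < v'' 0 rMin) := by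
          rw [← hcond]; exact fun h => h hc
        refine DT.skip ⟨hI, h3, h4, h5, h6, fun c hc => ?_⟩
        have h8 := h7 c hc
        constructor
        · intro h9
          refine (h8.1 h9).imp_right ?_
          rintro ⟨a', ha', h10⟩
          exact ⟨a', by omega, h10⟩
        · rintro (h10 | ⟨a', ha', h11, h12, h13⟩)
          · exact h8.2 (Or.inl h10)
          · by_cases haa : a' = a
            · subst haa
              have := (hsub a' h11 (c - 1) (by omega)).2 h13
              by_contra h14
              exact hc' ⟨h11, by omega⟩
            · exact h8.2 (Or.inr ⟨a', by omega, h11, h12, h13⟩)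
    · rintro v'' ⟨h3, h4, h5, h6, h7⟩
      have e5 : v'' 4 = v' 4 := h3.2 4 (by decide) (by decide)
      refine DT.set (by decide) (by decide) (by decide) (by decide) (by decide)
        (by simp only [SExpr.eval]; omega) (by simp [SExpr.eval]) (fun _ => ?_) ?_
      · simp only [reg, SExpr.eval]; omega
      · simp only [reg, SExpr.eval, h5]
        refine ⟨by simp [Segs.set, h4], (h1.trans (h3.mono (by simp) (by simp))).setSeg (by simp)
          (by simp) _ _, fun k Y hk hki c hc => ?_⟩
        by_cases hki' : k = i
        · subst hki'
          rw [hX] at hk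
          obtain rfl := Option.some.inj hk
          rw [covered_iff, ← h7 c hc]
          simp [Segs.set]
        · have hne : Y ≠ X := by
            rintro rfl
            obtain ⟨hk1, hk2⟩ := List.getElem?_eq_some_iff.1 hk
            obtain ⟨hi1, hi2⟩ := List.getElem?_eq_some_iff.1 hX
            have hnd : l.Nodup := (pairwise_smallList h Γ.n).imp fun h => h.ne
            exact hki' ((List.Nodup.getElem_inj_iff hnd).1 (hk2.trans hi2.symm))
          rw [← h2 k Y hk (by omega) c hc, ← e5]
          simp [Segs.set, hne]
  · rintro v' ⟨h1, h2⟩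
    refine ⟨h1, fun X hX c hc => ?_⟩
    obtain ⟨k, hk, he⟩ := List.getElem_of_mem hX
    exact h2 k X (by rw [List.getElem?_eq_getElem hk, he]) hk c hc

end

/-- Write the Exact Cover instance of a guess into the current sandbox. -/
def buildProg (TE : Expr) : Prog :=
  .seq (setReg TE rPtr (.k 2)) (.seq (setReg TE rRow (.k 0)) (.seq
    (forProg TE rPos (reg rLen) (.seq (setReg TE rCur (.ld 2 (reg rPos)))
      (forProg TE rJ (reg rChunks)
        (.cond ((SExpr.op .lt (.ld 6 (.op .add (reg rChunks) (reg rJ)))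
            (.ld 4 (reg rCur))).comp TE) .skip
          (.seq (setReg TE rTagged (.op .add (reg rCur) (.ld 5 (.op .add .n (reg rJ)))))
            (.seq (emitProg TE) (setReg TE rRow (.op .add (reg rRow) (.k 1)))))))))
    (.seq (setProg TE (reg rCall) (.k 0) (reg rWidth))
      (setProg TE (reg rCall) (.k 1) (reg rRow)))))

/-- Segment `c` contains a matrix with the given rows of length `N`. -/
def HasRows (v : Segs) (c N : ℕ) (rows : List ℕ) : Prop :=
  v 0 rPtr = 2 + rows.length * N ∧ v 0 rRow = rows.length ∧
    ∀ a, v c a = if a < 2 then 0 else ((rows.getD ((a - 2) / N) 0).testBit ((a - 2) % N)).toNat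

/-- Reading beyond the last row gives `0` on both sides, so the whole segment is described and not
only the part written so far. This is what makes it equal to an input memory in the end. -/
lemma HasRows.append {v v' : Segs} {c N y : ℕ} {rows : List ℕ} (hN : 0 < N)
    (h : HasRows v c N rows) (hp : v' 0 rPtr = v 0 rPtr + N) (hr : v' 0 rRow = v 0 rRow + 1)
    (ha : ∀ a, v' c a = if v 0 rPtr ≤ a ∧ a < v 0 rPtr + N
        then (y.testBit (a - v 0 rPtr)).toNat else v c a) : HasRows v' c N (rows ++ [y]) := by
  obtain ⟨h1, h2, h3⟩ := h
  refine ⟨?_, ?_, fun a => ?_⟩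
  · rw [hp, h1, List.length_append, List.length_singleton, Nat.add_mul]; omega
  · rw [hr, h2, List.length_append, List.length_singleton]
  · rw [ha, h1, h3]
    by_cases ha2 : a < 2
    · rw [if_neg (by omega)]
      simp [ha2]
    · simp only [ha2, if_false]
      obtain ⟨x, rfl⟩ : ∃ x, a = x + 2 := ⟨a - 2, by omega⟩
      simp only [Nat.add_sub_cancel]
      have hdm := Nat.div_add_mod x N
      have hml := Nat.mod_lt x hN
      rcases lt_trichotomy (x / N) rows.length with hlt | heq | hgt
      · rw [if_neg, List.getD_append _ _ _ _ hlt]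
        have := (Nat.div_lt_iff_lt_mul hN).1 hlt
        omega
      · rw [heq, mul_comm] at hdm
        rw [if_pos (by omega), heq, List.getD_append_right _ _ _ _ le_rfl, Nat.sub_self,
          List.getD_cons_zero]
        congr 2
        omega
      · rw [if_neg, List.getD_eq_default _ _ hgt.le,
          List.getD_eq_default _ _ (by simp; omega)]
        have := (Nat.le_div_iff_mul_le hN).1 (show rows.length + 1 ≤ x / N from hgt)
        rw [Nat.add_mul] at this
        omega

lemma HasRows.of_frame {v v' : Segs} {c N : ℕ} {rows : List ℕ} {rs ss : List ℕ}
    (h : HasRows v c N rows) (hf : Frame rs ss v v') (h1 : rPtr ∉ rs) (h2 : rRow ∉ rs)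
    (hc : c ≠ 0) (hs : c ∉ ss) : HasRows v' c N rows :=
  ⟨(hf.1 _ h1).trans h.1, (hf.1 _ h2).trans h.2.1, fun a => by rw [hf.2 c hc hs]; exact h.2.2 a⟩

/-- The constants and tables that are computed at the beginning. -/
structure Env (Γ : Layout) (t G r : ℕ) (v : Segs) : Prop where
  chunks : v 0 rChunks = t
  width : v 0 rWidth = Γ.n + t
  guesses : v 0 rGuesses = G
  reps : v 0 rReps = r
  len : v 0 rLen = (smallList (Γ.n / t + 1) Γ.n).length
  list : ∀ i X, (smallList (Γ.n / t + 1) Γ.n)[i]? = some X → v 2 i = X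
  pow : ∀ j ≤ Γ.n + t, v 5 j = 2 ^ j

lemma Env.of_frame {Γ : Layout} {t G r : ℕ} {v v' : Segs} (h : Env Γ t G r v) {rs ss : List ℕ}
    (hf : Frame rs ss v v')
    (hr : ∀ k ∈ [rChunks, rWidth, rGuesses, rReps, rLen], k ∉ rs) (h2 : 2 ∉ ss) (h5 : 5 ∉ ss) :
    Env Γ t G r v' where
  chunks := (hf.1 _ (hr _ (by simp))).trans h.chunks
  width := (hf.1 _ (hr _ (by simp))).trans h.width
  guesses := (hf.1 _ (hr _ (by simp))).trans h.guesses
  reps := (hf.1 _ (hr _ (by simp))).trans h.reps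
  len := (hf.1 _ (hr _ (by simp))).trans h.len
  list i X hX := by rw [hf.2 2 (by decide) h2]; exact h.list i X hX
  pow j hj := by rw [hf.2 5 (by decide) h5]; exact h.pow j hj

lemma smallList_nodup (h n : ℕ) : (smallList h n).Nodup :=
  (pairwise_smallList h n).imp fun h => h.ne

lemma smallList_lt (h n : ℕ) : ∀ X ∈ smallList h n, X < 2 ^ n := fun _ hX => (mem_smallList.1 hX).1

lemma length_smallList_le (h n : ℕ) : (smallList h n).length ≤ 2 ^ n := by
  rw [smallList, List.length_map]; exact length_smallSubsets_le h n

/-- The time for building an instance. -/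
def buildTime (w len t N : ℕ) : ℕ :=
  w + (w + ((2 * w + len * (2 * w + (w + (2 * w + t * (2 * w + (w + (w +
    ((2 * w + N * (2 * w + (w + w))) + w)))))))) + (w + w)))

/-- The segment has to be blank at the start, since an input memory is `0` outside of the input. The
number of rows depends on the table, so the two header cells are written last. -/
lemma buildProg_of_list {Γ : Layout} {v : Segs} {t c : ℕ} {l : List ℕ} (ht : 0 < t)
    (hchunks : v 0 rChunks = t) (hwidth : v 0 rWidth = Γ.n + t) (hElen : v 0 rLen = l.length)
    (hLmem : ∀ i X, l[i]? = some X → v 2 i = X) (hpow : ∀ j ≤ Γ.n + t, v 5 j = 2 ^ j)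
    (hl : l.Nodup) (hLlt : ∀ X ∈ l, X < 2 ^ Γ.n) (hL2 : l.length ≤ 2 ^ Γ.n)
    (hc : v 0 rCall = c) (h8 : 8 ≤ c) (hT : c < Γ.T) (hfresh : ∀ a, v c a = 0)
    (hb : 2 + 2 ^ Γ.n * t * (Γ.n + t) < 2 ^ Γ.b) (hb' : Γ.n + t < Γ.b) :
    DT Γ (buildProg Γ.TE) v (buildTime Γ.w l.length t (Γ.n + t)) fun v' =>
      Frame [rJ, rPos, rCur, rPtr, rRow, rCol, rTagged] [c] v v' ∧
      v' c = (partitionInstance Γ.n t (v 4) (fun j => v 6 (t + j)) l hl hLlt).input := by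
  have hc0 : c ≠ 0 := by omega
  refine HT.of_wf fun hn hm hwf => ?_
  have hLb : l.length < 2 ^ Γ.b := hElen ▸ hwf 0 (by norm_num) rLen
  set N := Γ.n + t with hNdef
  have hN0 : 0 < N := by omega
  have hbig : ∀ x, x ≤ 2 + 2 ^ Γ.n * t * N → x < 2 ^ Γ.b := fun x hx => hx.trans_lt hb
  have htb : t < 2 ^ Γ.b := Layout.lt_pow_of_le (by omega)
  refine HT.setReg_seq (hbig _ (by simp only [SExpr.eval]; omega)) ?_
  refine HT.setReg_seq (hbig _ (by simp only [SExpr.eval]; omega)) ?_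
  refine HT.seq_right (DT.forProg (by decide) (by decide) (by decide) l.length hLb (fun i v' =>
    Frame [rJ, rPos, rCur, rPtr, rRow, rCol, rTagged] [c] v v' ∧
    HasRows v' c N (rowsAll Γ.n t (v 4) (fun j => v 6 (t + j)) (l.take i))) ?_ ?_ ?_ ?_) ?_
  · rintro i v' x ⟨h1, h2⟩
    exact ⟨h1.setReg (by decide) x, h2.of_frame (rs := [rPos]) (ss := [])
      (Frame.refl.setReg (by decide) x) (by decide) (by decide) hc0 (by simp)⟩
  · rintro i v' ⟨h1, -⟩
    simp only [reg, SExpr.eval]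
    rw [h1.1 _ (by decide), hElen]
  · refine ⟨(Frame.refl.setReg (by decide) _).setReg (by decide) _, ?_, ?_, fun a => ?_⟩
    · simp [Segs.set, SExpr.eval, rowsAll]
    · simp [Segs.set, SExpr.eval, rowsAll]
    · simp [Segs.set, hc0, rowsAll, hfresh]
  · rintro i hi v' ⟨h1, h2⟩ hP
    obtain ⟨X, hX⟩ : ∃ X, l[i]? = some X := ⟨_, List.getElem?_eq_getElem hi⟩
    have hXl : X ∈ l := List.mem_of_getElem? hX
    have hXlt := hLlt X hXl
    have e1 : v' 2 i = X := by
      rw [h1.2 2 (by decide) (by simp; omega)]; exact hLmem i X hX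
    have htake : l.take (i + 1) = l.take i ++ [X] := by
      rw [List.take_add_one, hX]; rfl
    refine HT.setReg_seq ?_ ?_
    · simp only [reg, SExpr.eval, hP, e1]
      exact hXlt.trans (Nat.pow_lt_pow_right (by norm_num) (by omega))
    refine (DT.forProg (t := Γ.w + (Γ.w + ((2 * Γ.w + N * (2 * Γ.w + (Γ.w + Γ.w))) + Γ.w)))
      (by decide) (by decide) (by decide) t htb (fun j v'' =>
      Frame [rJ, rPos, rCur, rPtr, rRow, rCol, rTagged] [c] v v'' ∧
      v'' 0 rPos = i ∧ v'' 0 rCur = X ∧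
      HasRows v'' c N (rowsAll Γ.n t (v 4) (fun j => v 6 (t + j)) (l.take i) ++
        rowsOne Γ.n (v 4) (fun j => v 6 (t + j)) X j)) ?_ ?_ ?_ ?_).mono le_rfl ?_
    · rintro i v' x ⟨h3, h4, h5, h6⟩
      exact ⟨h3.setReg (by decide) x, by simpa [Segs.set] using h4, by simpa [Segs.set] using h5,
        h6.of_frame (rs := [rJ]) (ss := []) (Frame.refl.setReg (by decide) x)
          (by decide) (by decide) hc0 (by simp)⟩
    · rintro j v'' ⟨h3, -⟩
      simp only [reg, SExpr.eval]
      rw [h3.1 _ (by decide), hchunks]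
    · refine ⟨h1.setReg (by decide) _, by simp [Segs.set, hP], by simp [Segs.set, SExpr.eval, reg, hP, e1],
        ?_⟩
      have : rowsOne Γ.n (v 4) (fun j => v 6 (t + j)) X 0 = [] := rfl
      rw [this, List.append_nil]
      exact h2.of_frame (rs := [rCur]) (ss := [])
        (Frame.refl.setReg (by decide) _) (by decide) (by decide) hc0 (by simp)
    · rintro j hj v'' ⟨h3, h4, h5, h6⟩ hJ
      have e2 : v'' 4 = v 4 := h3.2 4 (by decide) (by simp; omega)
      have e3 : v'' 6 = v 6 := h3.2 6 (by decide) (by simp; omega)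
      have e4 : v'' 0 rChunks = t := (h3.1 _ (by decide)).trans hchunks
      have e5 : v'' 7 0 = Γ.n := by rw [h3.2 7 (by decide) (by simp; omega), hn]
      have e6 : ∀ k ≤ N, v'' 5 k = 2 ^ k := by
        rw [h3.2 5 (by decide) (by simp; omega)]; exact hpow
      have e7 : v'' 0 rCall = c := (h3.1 _ (by decide)).trans hc
      have e8 : v'' 0 rWidth = N := (h3.1 _ (by decide)).trans hwidth
      have hcond : (SExpr.op .lt (.ld 6 (.op .add (reg rChunks) (reg rJ)))
          (.ld 4 (reg rCur))).eval v'' ≠ 0 ↔ v 6 (t + j) < v 4 X := by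
        simp [reg, SExpr.eval, BinOp.eval, e2, e3, e4, h5, hJ]
      have hone : rowsOne Γ.n (v 4) (fun j => v 6 (t + j)) X (j + 1) =
          rowsOne Γ.n (v 4) (fun j => v 6 (t + j)) X j ++
            if v 4 X ≤ v 6 (t + j) then [X + 2 ^ (Γ.n + j)] else [] := by
        unfold rowsOne
        rw [List.range_succ, List.filter_append, List.map_append]
        congr 1
        split_ifs with h7 <;> simp [h7]
      -- The sets before `X` have at most `i * t` rows and `X` has at most `j < t` so far; this
      -- keeps row counter and write pointer within `b` bits.
      have hlen1 : (rowsAll Γ.n t (v 4) (fun j => v 6 (t + j)) (l.take i) ++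
          rowsOne Γ.n (v 4) (fun j => v 6 (t + j)) X j).length + 1 ≤ 2 ^ Γ.n * t := by
        rw [List.length_append]
        have h7 := length_rowsAll_le Γ.n t (v 4) (fun j => v 6 (t + j)) (l.take i)
        have h8 := length_rowsOne_le Γ.n (v 4) (fun j => v 6 (t + j)) X j
        rw [List.length_take, min_eq_left hi.le] at h7
        have h9 := Nat.mul_le_mul_right t (show i + 1 ≤ 2 ^ Γ.n by omega)
        rw [Nat.add_mul] at h9
        omega
      have hytag : X + 2 ^ (Γ.n + j) < 2 ^ N := tagged_lt hXlt hj
      refine HT.cond _ (by decide) (by decide) (fun hc' => ?_) fun hc' => ?_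
      · rw [hcond] at hc'
        refine (DT.skip (Q := _) ?_).mono (by omega) (fun _ h => h)
        rw [hone, if_neg (by omega), List.append_nil]
        exact ⟨hJ, h3, h4, h5, h6⟩
      · have hc' : ¬ v 6 (t + j) < v 4 X := by rw [← hcond]; exact fun h => h hc'
        rw [hone, if_pos (by omega), ← List.append_assoc]
        have hval : (SExpr.op .add (reg rCur) (.ld 5 (.op .add .n (reg rJ)))).eval v'' =
            X + 2 ^ (Γ.n + j) := by
          simp only [reg, SExpr.eval, BinOp.eval, h5, e5, hJ]
          rw [e6 _ (by omega)]
        refine HT.setReg_seq ?_ ?_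
        · rw [hval]
          exact hytag.trans (Nat.pow_lt_pow_right (by norm_num) (by omega))
        rw [hval]
        set v3 := v''.set 0 rTagged (X + 2 ^ (Γ.n + j)) with hv3
        have f3 : Frame [rTagged] [] v'' v3 := Frame.refl.setReg (by decide) _
        have h6' := h6.of_frame f3 (by decide) (by decide) hc0 (by simp)
        have hmul := Nat.mul_le_mul_right N hlen1
        rw [Nat.add_mul] at hmul
        refine HT.seq_right (emitProg_spec ((f3.1 _ (by decide)).trans e7) h8 hT
          ((f3.1 _ (by decide)).trans e8) (fun j hj => ?_) ?_) ?_
        · rw [f3.2 5 (by decide) (by decide)]; exact e6 j hj.le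
        · rw [h6'.1]
          exact hbig _ (by omega)
        · rintro v4 ⟨g1, g2, g3⟩
          have e9 : v4 0 rRow = (rowsAll Γ.n t (v 4) (fun j => v 6 (t + j)) (l.take i) ++
              rowsOne Γ.n (v 4) (fun j => v 6 (t + j)) X j).length := by
            rw [g1.1 _ (by decide), h6'.2.1]
          refine DT.setReg (by decide) (by decide) (by decide) ?_ ?_
          · simp only [reg, SExpr.eval, BinOp.eval, e9]
            refine hbig _ ?_
            have := Nat.le_mul_of_pos_right (2 ^ Γ.n * t) hN0
            omega
          · have f4 : Frame [rJ, rPos, rCur, rPtr, rRow, rCol, rTagged] [c] v'' v4 :=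
              (f3.mono (by simp) (by simp)).trans (g1.mono (by simp) (by simp))
            have f5 : Frame [rPtr, rCol, rTagged] [c] v'' v4 :=
              (f3.mono (by simp) (by simp)).trans (g1.mono (by simp) (by simp))
            refine ⟨?_, (h3.trans f4).setReg (by decide) _, ?_, ?_, ?_⟩
            · simp only [Segs.set]
              rw [if_neg (by decide), f5.1 _ (by decide), hJ]
            · simp only [Segs.set]
              rw [if_neg (by decide), f5.1 _ (by decide), h4]
            · simp only [Segs.set]
              rw [if_neg (by decide), f5.1 _ (by decide), h5]
            · have etag : v3 0 rTagged = X + 2 ^ (Γ.n + j) := by simp [hv3, Segs.set]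
              refine h6'.append hN0 ?_ ?_ fun a => ?_
              · rw [← g2]; simp [Segs.set]
              · rw [h6'.2.1]; simp [Segs.set, reg, SExpr.eval, BinOp.eval, e9]
              · rw [← etag, ← g3 a]; simp [Segs.set, hc0]
    · rintro v'' ⟨h3, h4, h5, h6⟩
      refine ⟨h4, h3, ?_⟩
      have : rowsAll Γ.n t (v 4) (fun j => v 6 (t + j)) (l.take (i + 1)) =
          rowsAll Γ.n t (v 4) (fun j => v 6 (t + j)) (l.take i) ++
            rowsOne Γ.n (v 4) (fun j => v 6 (t + j)) X t := by
        rw [htake, rowsAll, List.flatMap_append]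
        simp [rowsAll]
      rw [this]
      exact h6
  · rintro v' ⟨h1, h2⟩
    rw [List.take_length] at h2
    have e7 : v' 0 rCall = c := (h1.1 _ (by decide)).trans hc
    have e8 : v' 0 rWidth = N := (h1.1 _ (by decide)).trans hwidth
    have hTe : ∀ v'' : Segs, v'' 0 rCall = c → (reg rCall).eval v'' = c := fun v'' h => by
      simpa [reg, SExpr.eval] using h
    refine HT.set_seq (by rw [hTe _ e7]; exact hT) (by rw [hTe _ e7]; omega)
      (by rw [hTe _ e7]; omega) ?_
    rw [hTe _ e7]
    set v2 := v'.set c ((SExpr.k 0).eval v') ((reg rWidth).eval v') with hv2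
    have e7' : v2 0 rCall = c := by simpa [hv2, Segs.set, hc0.symm] using e7
    refine DT.set (by decide) (by decide) (by decide) (by decide) (by decide)
      (by rw [hTe _ e7']; exact hT) (by rw [hTe _ e7']; omega) (by rw [hTe _ e7']; omega) ?_
    rw [hTe _ e7']
    refine ⟨(h1.setSeg (by simp) hc0 _ _).setSeg (by simp) hc0 _ _, ?_⟩
    simp only [hv2]
    funext a
    match a with
    | 0 =>
      simp only [Segs.set, SExpr.eval, reg, SetSystem.input]
      simp [e8, partitionInstance, SetSystem.ofRows, hNdef]
    | 1 =>
      simp only [Segs.set, SExpr.eval, reg, SetSystem.input]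
      simp [hc0.symm, h2.2.1, partitionInstance, SetSystem.ofRows]
    | a + 2 =>
      have := h2.2.2 (a + 2)
      rw [partitionInstance, SetSystem.ofRows_input hN0]
      simp only [Segs.set, SExpr.eval]
      rw [if_neg (by omega), if_neg (by omega), this, if_neg (by omega)]
      simp

lemma buildProg_spec {Γ : Layout} {v : Segs} {t G r c : ℕ} (ht : 0 < t) (hE : Env Γ t G r v)
    (hc : v 0 rCall = c) (h8 : 8 ≤ c) (hT : c < Γ.T) (hfresh : ∀ a, v c a = 0)
    (hb : 2 + 2 ^ Γ.n * t * (Γ.n + t) < 2 ^ Γ.b) (hb' : Γ.n + t < Γ.b) :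
    DT Γ (buildProg Γ.TE) v
      (buildTime Γ.w (smallList (Γ.n / t + 1) Γ.n).length t (Γ.n + t)) fun v' =>
      Frame [rJ, rPos, rCur, rPtr, rRow, rCol, rTagged] [c] v v' ∧
      v' c = (partitionInstance Γ.n t (v 4) (fun j => v 6 (t + j)) (smallList (Γ.n / t + 1) Γ.n)
        (smallList_nodup _ _) (smallList_lt _ _)).input :=
  buildProg_of_list ht hE.chunks hE.width hE.len hE.list hE.pow _ _ (length_smallList_le _ _)
    hc h8 hT hfresh hb hb'

/-! ### Running the solver once and counting its answer. -/

lemma Layout.lift_self {Γ : Layout} {s : Mem} {c : ℕ} (hc : c < Γ.T) (h8 : 8 ≤ c) :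
    Γ.lift s c (Γ.segs s c) = s := by
  funext a
  unfold Layout.lift
  split_ifs with h
  · have h7 : c ≠ 7 := by omega
    simp only [Layout.segs, h7, hc, if_true, if_false]
    congr 1
    unfold Layout.addr
    have := Nat.div_add_mod (a - Γ.R) Γ.T
    rw [mul_comm, h.2] at this
    omega
  · rfl

/-- On all instances with `N` elements and at most `M` sets, the program halts within `t` steps and
its answer to Exact Cover is wrong with probability at most `e`. -/
def Decides (P : Prog) (N M t : ℕ) (e : ℝ≥0∞) : Prop :=
  ∀ I : SetSystem, I.n = N → I.m ≤ M → ∃ μ, Exec P I.input μ ∧ (∀ p ∈ μ.support, p.2 ≤ t) ∧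
    ev μ (fun p => ind (¬ ExactCover I p.1)) ≤ e

/-- Increase `rCount` if the answer in the current sandbox is `1`. -/
def tallyProg (TE : Expr) : Prog :=
  .store (SExpr.addr TE (.k 0) (.k rCount)) (.op .add ((reg rCount).comp TE)
    (.op .eq (.load (SExpr.addr TE (reg rCall) (.k 0))) (.const 1)))

open Classical in
/-- The correct answer to Exact Cover. -/
noncomputable def SetSystem.answer (I : SetSystem) : ℕ := if I.HasExactCover then 1 else 0

lemma SetSystem.answer_eq {I : SetSystem} {s : Mem} (h : ExactCover I s) : s 0 = I.answer := by
  unfold SetSystem.answer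
  split_ifs with hI
  · exact h.1 hI
  · exact h.2 hI

lemma SetSystem.answer_le (I : SetSystem) : I.answer ≤ 1 := by
  unfold SetSystem.answer
  split_ifs <;> omega

lemma size_le_one {x : ℕ} (h : x ≤ 1) : Nat.size x ≤ 1 :=
  size_le_of_le_pow (by omega)

/-- This is treated by hand, because the answer is read from a segment where the general length
bound does not hold. Its length enters the time as `B`. -/
lemma tally_exec {Γ : Layout} {s : Mem} {c B : ℕ} (hs : Γ.WF s) (hc : Γ.segs s 0 rCall = c)
    (h8 : 8 ≤ c) (hT : c < Γ.T) (hB : Nat.size (Γ.segs s c 0) ≤ B)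
    (hb : Γ.segs s 0 rCount + 1 < 2 ^ Γ.b) :
    ∃ k ≤ 6 * Γ.w + B, ∃ s', Exec (tallyProg Γ.TE) s (PMF.pure (s', k)) ∧ Γ.WF s' ∧
      Γ.segs s' = (Γ.segs s).set 0 rCount
        (Γ.segs s 0 rCount + if Γ.segs s c 0 = 1 then 1 else 0) := by
  obtain ⟨h1, h2⟩ := SExpr.addr_spec hs (σ := .k 0) (i := .k rCount) rfl rfl (by decide)
  obtain ⟨h3, h4⟩ := SExpr.addr_spec hs (σ := reg rCall) (i := .k 0) rfl rfl (by decide)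
  have h5 := (SExpr.comp_spec hs (reg rCount) rfl).1
  have h6 := Layout.cost_le hs (reg rCount) rfl (by decide)
  have h7 : c ≠ 7 := by omega
  have hTT := Γ.hT
  simp only [reg, SExpr.eval, hc] at h1 h3 h5
  have h9 : s (Γ.addr c 0) = Γ.segs s c 0 := by simp only [Layout.segs, h7, hT, if_true, if_false]
  have hval : (Expr.op .add ((reg rCount).comp Γ.TE)
      (.op .eq (.load (SExpr.addr Γ.TE (reg rCall) (.k 0))) (.const 1))).eval s =
      Γ.segs s 0 rCount + if Γ.segs s c 0 = 1 then 1 else 0 := by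
    simp only [Expr.eval, BinOp.eval, reg, h3, h5, h9]
  have hlt : (Γ.segs s 0 rCount + if Γ.segs s c 0 = 1 then 1 else 0) < 2 ^ Γ.b := by
    split_ifs <;> omega
  refine ⟨_, ?_, _, Exec.store _ _ s, ?_, ?_⟩
  · have k1 := size_le_of_le_pow hlt
    have k2 : Nat.size (BinOp.eq.eval (Γ.segs s c 0) 1) ≤ 1 :=
      size_le_one (by simp only [BinOp.eval]; split_ifs <;> omega)
    have k3 : Nat.size 1 = 1 := Nat.size_one
    have k4 : Γ.b + 1 ≤ Γ.w := by
      refine le_trans ?_ Γ.hw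
      have : 1 * (Γ.b + 1) ≤ (2 * (100 * (Γ.TE.wt + 20)) ^ 2) * (Γ.b + 1) :=
        Nat.mul_le_mul_right _ (Nat.mul_pos (by norm_num) (by positivity))
      omega
    have k5 : 10 ≤ Γ.w := by
      refine le_trans ?_ Γ.hw
      have h1 : 100 ^ 2 ≤ (100 * (Γ.TE.wt + 20)) ^ 2 := Nat.pow_le_pow_left (by omega) 2
      have h2 := Nat.le_mul_of_pos_right (2 * (100 * (Γ.TE.wt + 20)) ^ 2) (show 0 < Γ.b + 1 by omega)
      omega
    rw [← hval] at k1
    simp only [Expr.cost, k3] at k1 ⊢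
    have e1 : (Expr.load (SExpr.addr Γ.TE (reg rCall) (.k 0))).eval s = Γ.segs s c 0 := by
      simp only [Expr.eval, reg, h3, h9]
    have e2 : (Expr.op .eq (.load (SExpr.addr Γ.TE (reg rCall) (.k 0))) (.const 1)).eval s =
        BinOp.eq.eval (Γ.segs s c 0) 1 := by
      simp only [Expr.eval, reg, h3, h9]
    rw [e1, e2]
    omega
  · rw [h1, hval]
    exact hs.update (by omega) (by norm_num) _ _ fun _ => hlt
  · rw [h1, hval, Γ.segs_update (by omega) (by norm_num)]

/-- Whatever the solver answers, the counter grows by at most one. It grows by the true answer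
unless the solver errs. -/
lemma run_spec {Γ : Layout} {v : Segs} {P : Prog} {N M tP c : ℕ} {e : ℝ≥0∞} {I : SetSystem}
    (hP : Decides P N M tP e) (hN : I.n = N) (hM : I.m ≤ M) (hI : v c = I.input)
    (hc : v 0 rCall = c) (h8 : 8 ≤ c) (hT : c < Γ.T) (hb : v 0 rCount + 1 < 2 ^ Γ.b) :
    HT Γ (.seq (P.reloc Γ.TE ((reg rCall).comp Γ.TE)) (tallyProg Γ.TE)) v
      (20 * Γ.w * P.nodes * tP + (6 * Γ.w + (N + tP)))
      (fun v' => Frame [rCount] [c] v v' ∧ v 0 rCount ≤ v' 0 rCount ∧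
        v' 0 rCount ≤ v 0 rCount + 1)
      (fun v' => ind (v' 0 rCount ≠ v 0 rCount + I.answer)) e := by
  intro s hs hv
  have hc0 : c ≠ 0 := by omega
  have hC : Γ.segs s 0 rCall = c := by rw [hv, hc]
  obtain ⟨μ, h1, h2, h3⟩ := hP I hN hM
  obtain ⟨μ', h4, h5, h6⟩ := reloc_exec hs hT h8 hC (by norm_num) P.nodes h1 le_rfl
  have hself := Layout.lift_self (s := s) hT h8
  rw [hv, hI] at hself
  rw [hself] at h4
  have hsegs : ∀ s1, Γ.segs (Γ.lift s c s1) = fun σ => if σ = c then s1 else v σ := fun s1 => by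
    rw [Layout.segs_lift hT h8, hv]
  have key : ∀ s' : Mem, ∃ k s'', (∃ p ∈ μ.support, s' = Γ.lift s c p.1) →
      k ≤ 6 * Γ.w + (N + tP) ∧ Exec (tallyProg Γ.TE) s' (PMF.pure (s'', k)) ∧ Γ.WF s'' ∧
      Γ.segs s'' = (Γ.segs s').set 0 rCount
        (v 0 rCount + if Γ.segs s' c 0 = 1 then 1 else 0) := by
    intro s'
    by_cases h : ∃ p ∈ μ.support, s' = Γ.lift s c p.1
    · obtain ⟨p, hp, rfl⟩ := h
      -- The answer cell held the number of elements at the start and can only have become longer by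
      -- the running time; hence the term `N + tP`.
      have g1 := h1.size_le p hp 0
      have g2 := h2 p hp
      have g3 : Nat.size (I.input 0) ≤ N := by
        rw [SetSystem.input, hN]; exact size_le_self N
      obtain ⟨k, hk, s'', h7⟩ := tally_exec (hs.lift hT h8 p.1) (c := c) (B := N + tP)
        (by rw [hsegs]; simpa [hc0.symm] using hc) h8 hT
        (by rw [hsegs]; simp only [if_true]; omega)
        (by rw [hsegs]; simpa [hc0.symm] using hb)
      refine ⟨k, s'', fun _ => ⟨hk, h7.1, h7.2.1, ?_⟩⟩
      rw [h7.2.2]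
      congr 2
      rw [hsegs]
      simp [hc0.symm]
    · exact ⟨0, s', fun h' => absurd h' h⟩
  choose k s'' hk using key
  have hin : ∀ p' ∈ μ'.support, ∃ p ∈ μ.support, p'.1 = Γ.lift s c p.1 := fun p' hp' => by
    obtain ⟨p, hp, h7, -⟩ := h6 p' hp'
    exact ⟨p, hp, h7⟩
  refine ⟨_, Exec.seq _ _ s μ' (fun s' => PMF.pure (s'' s', k s')) h4
    fun p hp => (hk p.1 (hin p hp)).2.1, ?_, ?_⟩
  · intro q hq
    rw [PMF.mem_support_bind_iff] at hq
    obtain ⟨p', hp', hq⟩ := hq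
    rw [PMF.pure_map, PMF.mem_support_pure_iff] at hq
    subst hq
    obtain ⟨g1, g2, g3, g4⟩ := hk p'.1 (hin p' hp')
    obtain ⟨p, hp, h7, h9⟩ := h6 p' hp'
    refine ⟨?_, g3, ?_, ?_, ?_⟩
    · refine add_le_add (h9.trans ?_) g1
      exact Nat.mul_le_mul_left _ (h2 p hp)
    · simp only [g4]
      refine Frame.setReg ?_ (by decide) _
      rw [h7, hsegs]
      refine ⟨fun r _ => by simp [hc0.symm], fun σ _ h => ?_⟩
      have : σ ≠ c := by simpa using h
      simp [this]
    · simp only [g4, Segs.set, and_self, if_true]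
      exact Nat.le_add_right _ _
    · simp only [g4, Segs.set, and_self, if_true]
      split_ifs <;> omega
  · rw [ev_bind]
    simp only [PMF.pure_map, ev_pure]
    -- Relocation preserves expected values, so the error of the relocated run is the error of the
    -- solver itself.
    rw [h5 fun s' => ind (Γ.segs (s'' s') 0 rCount ≠ v 0 rCount + I.answer)]
    refine le_trans (ev_mono fun p hp => ?_) h3
    obtain ⟨g1, g2, g3, g4⟩ := hk _ ⟨p, hp, rfl⟩
    by_cases hw : ExactCover I p.1
    · rw [ind_false]
      · exact zero_le
      · rw [g4, hsegs]
        have h7 := SetSystem.answer_eq hw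
        have h9 := I.answer_le
        simp only [Segs.set, and_self, if_true, ne_eq, not_not, h7]
        split_ifs <;> omega
    · rw [ind_true hw]; exact ind_le_one _

/-- Solve the Exact Cover instance of a guess in the current sandbox. -/
def callProg (P : Prog) (TE : Expr) : Prog :=
  .seq (buildProg TE) (.seq (.seq (P.reloc TE ((reg rCall).comp TE)) (tallyProg TE))
    (setReg TE rCall (.op .add (reg rCall) (.k 1))))

/-- The instance of the guess that is stored in `v`. -/
noncomputable def guessInstance (Γ : Layout) (t : ℕ) (v : Segs) : SetSystem :=
  partitionInstance Γ.n t (v 4) (fun j => v 6 (t + j)) (smallList (Γ.n / t + 1) Γ.n)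
    (smallList_nodup _ _) (smallList_lt _ _)

/-- The time for building and solving an instance. -/
def callTime (w len t N D tP : ℕ) : ℕ :=
  buildTime w len t N + ((20 * w * D * tP + (6 * w + (N + tP))) + w)

lemma callProg_spec {Γ : Layout} {v : Segs} {P : Prog} {t G r c tP : ℕ} {e : ℝ≥0∞} (ht : 0 < t)
    (hP : Decides P (Γ.n + t) ((smallList (Γ.n / t + 1) Γ.n).length * t) tP e)
    (hE : Env Γ t G r v) (hc : v 0 rCall = c) (h8 : 8 ≤ c) (hT : c < Γ.T)
    (hfresh : ∀ σ, c ≤ σ → ∀ a, v σ a = 0)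
    (hb : 2 + 2 ^ Γ.n * t * (Γ.n + t) < 2 ^ Γ.b) (hb' : Γ.n + t < Γ.b) (hTb : Γ.T < 2 ^ Γ.b)
    (hcnt : v 0 rCount + 1 < 2 ^ Γ.b) :
    HT Γ (callProg P Γ.TE) v
      (callTime Γ.w (smallList (Γ.n / t + 1) Γ.n).length t (Γ.n + t) P.nodes tP)
      (fun v' => Frame [rJ, rPos, rCur, rPtr, rRow, rCol, rTagged, rCount, rCall] [c] v v' ∧
        v' 0 rCall = c + 1 ∧ v 0 rCount ≤ v' 0 rCount ∧
        v' 0 rCount ≤ v 0 rCount + 1)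
      (fun v' => ind (v' 0 rCount ≠ v 0 rCount + (guessInstance Γ t v).answer)) e := by
  refine HT.seq_right (buildProg_spec ht hE hc h8 hT (hfresh c le_rfl) hb hb') ?_
  rintro v1 ⟨h1, h2⟩
  have e1 : v1 0 rCall = c := (h1.1 _ (by decide)).trans hc
  have e2 : v1 0 rCount = v 0 rCount := h1.1 _ (by decide)
  refine HT.seq_left (run_spec hP (I := guessInstance Γ t v) rfl ?_ h2 e1 h8 hT (by omega)) ?_
  · exact length_rowsAll_le _ _ _ _ _
  · rintro v2 ⟨h3, h4⟩
    have e3 : v2 0 rCall = c := (h3.1 _ (by decide)).trans e1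
    refine DT.setReg (by decide) (by decide) (by decide) ?_ ?_
    · simp only [reg, SExpr.eval, BinOp.eval, e3]
      omega
    · have e4 : ∀ x, (v2.set 0 rCall x) 0 rCount = v2 0 rCount := fun x => by simp [Segs.set]
      refine ⟨⟨((h1.mono (by simp) (by simp)).trans (h3.mono (by simp) (by simp))).setReg
        (by simp) _, ?_, ?_, ?_⟩, ?_⟩
      · simp [Segs.set, reg, SExpr.eval, BinOp.eval, e3]
      · rw [e4]; omega
      · rw [e4]; omega
      · rw [e4, e2]

/-! ## Guesses -/

/-- A digit of a number in base `m + 1`. -/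
def digit (m g j : ℕ) : ℕ := g / (m + 1) ^ j % (m + 1)

lemma digit_le (m g j : ℕ) : digit m g j ≤ m := Nat.lt_succ_iff.1 (Nat.mod_lt _ (Nat.succ_pos m))

lemma unionOf_congr {M d d' : ℕ → ℕ} {t : ℕ} (h : ∀ j < t, d j = d' j) :
    unionOf M d t = unionOf M d' t := by
  induction t with
  | zero => rfl
  | succ t ih => simp only [unionOf, ih fun j hj => h j (by omega), h t (by omega)]

lemma guessCost_congr {m t : ℕ} {d d' : ℕ → ℕ} (h : ∀ j < t + t, d j = d' j) :
    guessCost m d t t = guessCost m d' t t := by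
  refine Finset.sum_congr rfl fun j hj => ?_
  have := Finset.mem_range.1 hj
  rw [h j (by omega), h (t + j) (by omega)]

lemma rowsAll_congr {n t : ℕ} {F κ κ' : ℕ → ℕ} (l : List ℕ) (h : ∀ j < t, κ j = κ' j) :
    rowsAll n t F κ l = rowsAll n t F κ' l := by
  have : ∀ X, rowsOne n F κ X t = rowsOne n F κ' X t := fun X => by
    unfold rowsOne
    congr 1
    refine List.filter_congr fun j hj => ?_
    rw [h j (List.mem_range.1 hj)]
  unfold rowsAll
  simp only [this]

/-- The digits `d` are a correct guess for the cover `A`. -/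
def IsGuess (M : ℕ → ℕ) (m n t : ℕ) (d : ℕ → ℕ) (A : Finset ℕ) : Prop :=
  guessCost m d t t ≤ A.card ∧ ∀ F (hl : (smallList (n / t + 1) n).Nodup)
    (hlt : ∀ X ∈ smallList (n / t + 1) n, X < 2 ^ n),
      IsCoverTable M m (unionOf M d t) (smallList (n / t + 1) n) F →
      (partitionInstance n t F (fun j => d (t + j)) _ hl hlt).HasExactCover

/-- Only the first `2 * t` entries of a guess matter, and a number below `(m + 1) ^ (2 * t)` encodes
exactly these. -/
lemma IsGuess.congr {M : ℕ → ℕ} {m n t : ℕ} {d d' : ℕ → ℕ} {A : Finset ℕ}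
    (h : IsGuess M m n t d A) (hd : ∀ j < t + t, d j = d' j) : IsGuess M m n t d' A := by
  refine ⟨guessCost_congr hd ▸ h.1, fun F hl hlt hF => ?_⟩
  have h1 := h.2 F hl hlt (by rwa [unionOf_congr fun j hj => hd j (by omega)])
  have h2 := rowsAll_congr (n := n) (t := t) (F := F) (κ := fun j => d (t + j))
    (κ' := fun j => d' (t + j)) (smallList (n / t + 1) n) fun j hj => hd (t + j) (by omega)
  unfold partitionInstance at h1 ⊢
  simpa only [h2] using h1

lemma exists_digit_isGuess {M : ℕ → ℕ} {m n t : ℕ} (ht : 0 < t) {A : Finset ℕ}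
    (hA : IsCover M m n A) : ∃ g < (m + 1) ^ (t + t), IsGuess M m n t (digit m g) A := by
  obtain ⟨d, hd, h⟩ := exists_guess_of_cover ht hA
  let f : Fin (t + t) → Fin (m + 1) := fun j => ⟨d j, Nat.lt_succ_of_le (hd j)⟩
  refine ⟨finFunctionFinEquiv f, (finFunctionFinEquiv f).2, IsGuess.congr (d := d) h fun j hj => ?_⟩
  have h1 : finFunctionFinEquiv.symm (finFunctionFinEquiv f) ⟨j, hj⟩ = f ⟨j, hj⟩ := by
    rw [Equiv.symm_apply_apply]
  have h2 := congrArg Fin.val h1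
  rw [finFunctionFinEquiv_symm_apply_val] at h2
  exact h2.symm

/-! ## Amplification -/

/-- The majority vote of `r` independent trials with error probability `e` has error probability
at most `η`, as a potential function shows. -/
def Amplifies (e η : ℝ≥0∞) (r : ℕ) : Prop :=
  ∃ (φ d : ℕ → ℝ≥0∞) (ρ : ℝ≥0∞), (∀ w, φ (w + 1) ≤ d w + φ w) ∧
    (∀ w, d w * e + φ w ≤ ρ * φ w) ∧ (∀ w, r ≤ 2 * w → 1 ≤ φ w) ∧ ρ ^ r * φ 0 ≤ η

/-- Solve the Exact Cover instance of a guess repeatedly. -/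
def repProg (P : Prog) (TE : Expr) : Prog :=
  .seq (setReg TE rCount (.k 0)) (forProg TE rRep (reg rReps) (callProg P TE))

/-- The segments in which the solver of Exact Cover runs. -/
def Layout.boxes (Γ : Layout) : List ℕ := List.range' 8 (Γ.T - 8)

lemma Layout.mem_boxes {Γ : Layout} {c : ℕ} : c ∈ Γ.boxes ↔ 8 ≤ c ∧ c < Γ.T := by
  have := Γ.hT
  simp only [boxes, List.mem_range'_1]
  omega

/-- All numbers that occur in the computation are in the range of the layout. -/
structure Ample (Γ : Layout) (t G r : ℕ) : Prop where
  pos : 0 < t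
  rows : 2 + 2 ^ Γ.n * t * (Γ.n + t) < 2 ^ Γ.b
  width : Γ.n + t < Γ.b
  segments : Γ.T < 2 ^ Γ.b
  reps : r + 1 < 2 ^ Γ.b
  guesses : G < 2 ^ Γ.b
  digits : t + t ≤ Γ.b
  cost : t * (Γ.m + 1) ≤ Γ.b
  sets : Γ.m + 1 ≤ Γ.b

/-- The tables are computed, and the sandboxes from number `c` on are fresh. -/
structure Ready (Γ : Layout) (t G r c : ℕ) (v : Segs) : Prop where
  env : Env Γ t G r v
  call : v 0 rCall = c
  le : 8 ≤ c
  fresh : ∀ σ, c ≤ σ → ∀ a, v σ a = 0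

lemma Ready.of_frame {Γ : Layout} {t G r c : ℕ} {v v' : Segs} (h : Ready Γ t G r c v)
    {rs ss : List ℕ} (hf : Frame rs ss v v')
    (hr : ∀ k ∈ [rChunks, rWidth, rGuesses, rReps, rLen, rCall], k ∉ rs)
    (hs : ∀ k ∈ ss, k < 8) (h2 : 2 ∉ ss) (h5 : 5 ∉ ss) : Ready Γ t G r c v' where
  env := h.env.of_frame hf (fun k hk => hr k (by
    simp only [List.mem_cons, List.not_mem_nil, or_false] at hk ⊢; tauto)) h2 h5
  call := (hf.1 _ (hr _ (by simp))).trans h.call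
  le := h.le
  fresh σ hσ a := by
    have h8 := h.le
    rw [hf.2 σ (by omega) fun hm => by have := hs σ hm; omega]
    exact h.fresh σ hσ a

lemma guessInstance_congr {Γ : Layout} {t : ℕ} {v v' : Segs} (h4 : v' 4 = v 4) (h6 : v' 6 = v 6) :
    guessInstance Γ t v' = guessInstance Γ t v := by
  unfold guessInstance; rw [h4, h6]

/-- The number of wrong answers among `i` answers of which `x` are yes, if the answer is `a`. -/
def errs (a i x : ℕ) : ℕ := if a = 1 then i - x else x

/-- A correct answer leaves the number of errors unchanged, and a wrong one raises it by one.
Written with an indicator, this can be averaged over the next run. -/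
lemma potential_step {φ d : ℕ → ℝ≥0∞} (h : ∀ w, φ (w + 1) ≤ d w + φ w) {a i x x' : ℕ} (ha : a ≤ 1)
    (hx : x ≤ i) (h1 : x ≤ x') (h2 : x' ≤ x + 1) :
    φ (errs a (i + 1) x') ≤ d (errs a i x) * ind (x' ≠ x + a) + φ (errs a i x) := by
  by_cases hw : x' = x + a
  · have : errs a (i + 1) x' = errs a i x := by
      unfold errs; split_ifs <;> omega
    rw [this]
    exact le_add_self
  · have : errs a (i + 1) x' = errs a i x + 1 := by
      unfold errs; split_ifs <;> omega
    rw [this, ind_true hw, mul_one]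
    exact h _

section

variable {Γ : Layout} {v : Segs} {P : Prog} {t G r c tP : ℕ} {e η : ℝ≥0∞}

/-- The registers that are changed by the repeated solution of an instance. -/
abbrev repRegs : List ℕ := [rJ, rPos, rCur, rPtr, rRow, rCol, rTagged, rCount, rCall, rRep]

/-- The time for the repeated solution of an instance. -/
def repTime (w r call : ℕ) : ℕ := w + (2 * w + r * (2 * w + call))

/-- Each trial multiplies the expected potential by at most `ρ`, whatever happened before, and the
potential is at least `1` if the majority is wrong. So the error is at most `ρ ^ r * φ 0`. Every
trial uses a new segment. -/
lemma repProg_spec (hA : Ample Γ t G r)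
    (hP : Decides P (Γ.n + t) ((smallList (Γ.n / t + 1) Γ.n).length * t) tP e)
    (hamp : Amplifies e η r) (hv : Ready Γ t G r c v) (hT : c + r ≤ Γ.T) :
    HT Γ (repProg P Γ.TE) v (repTime Γ.w r
        (callTime Γ.w (smallList (Γ.n / t + 1) Γ.n).length t (Γ.n + t) P.nodes tP))
      (fun v' => Frame repRegs Γ.boxes v v' ∧ Ready Γ t G r (c + r) v')
      (fun v' => ind (¬ (r < 2 * v' 0 rCount ↔ (guessInstance Γ t v).HasExactCover))) η := by
  obtain ⟨φ, d, ρ, h1, h2, h3, h4⟩ := hamp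
  have hTT := Γ.hT
  have hr := hA.reps
  set a := (guessInstance Γ t v).answer with ha
  have ha1 : a ≤ 1 := SetSystem.answer_le _
  refine HT.setReg_seq (by simp [SExpr.eval]) ?_
  have h5 := HT.forProg (Γ := Γ) (c := callProg P Γ.TE) (r := rRep) (N := reg rReps)
    (v := v.set 0 rCount ((SExpr.k 0).eval v))
    (t := callTime Γ.w (smallList (Γ.n / t + 1) Γ.n).length t (Γ.n + t) P.nodes tP)
    (by decide) (by decide) (by decide) r (by omega)
    (fun i v' => Frame repRegs Γ.boxes v v' ∧ Ready Γ t G r (c + i) v' ∧ v' 0 rCount ≤ i)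
    (fun i v' => ρ ^ (r - i) * φ (errs a i (v' 0 rCount))) ?_ ?_ ?_ ?_ ?_
  · refine h5.mono le_rfl (fun v' h => ⟨h.1, h.2.1⟩) ?_ ?_
    · rintro v' ⟨-, -, h6⟩
      rw [Nat.sub_self, pow_zero, one_mul]
      by_cases hw : r < 2 * v' 0 rCount ↔ (guessInstance Γ t v).HasExactCover
      · rw [ind_false (by simpa using hw)]; exact zero_le
      · rw [ind_true hw]
        refine h3 _ ?_
        rw [ha, SetSystem.answer, errs]
        split_ifs with h7 h8 h8
        · have : ¬ r < 2 * v' 0 rCount := fun h => hw ⟨fun _ => h7, fun _ => h⟩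
          omega
        · exact absurd rfl h8
        · exact absurd h8 (by norm_num)
        · have : r < 2 * v' 0 rCount := by
            by_contra h
            exact hw ⟨fun h' => absurd h' h, fun h' => absurd h' h7⟩
          omega
    · have : errs a 0 ((v.set 0 rCount ((SExpr.k 0).eval v)) 0 rCount) = 0 := by
        simp [errs, Segs.set, SExpr.eval]
      rw [this, Nat.sub_zero]
      exact h4
  · rintro i v' x ⟨h6, h7, h8⟩
    exact ⟨h6.setReg (by simp) x, h7.of_frame (rs := [rRep]) (ss := [])
      (Frame.refl.setReg (by simp) x) (by simp) (by simp) (by simp) (by simp),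
      by simpa [Segs.set] using h8⟩
  · intro i v' x
    simp [Segs.set]
  · rintro i v' ⟨-, h6, -⟩
    simpa [reg, SExpr.eval] using h6.env.reps
  · exact ⟨Frame.refl.setReg (by simp) _, hv.of_frame (rs := [rCount]) (ss := [])
      (Frame.refl.setReg (by simp) _) (by simp) (by simp) (by simp) (by simp),
      by simp [Segs.set, SExpr.eval]⟩
  · rintro i hi v' ⟨h6, h7, h8⟩ hrep
    have h8' := hv.le
    have e4 : v' 4 = v 4 := h6.2 4 (by decide) (by rw [Layout.mem_boxes]; omega)
    have e6 : v' 6 = v 6 := h6.2 6 (by decide) (by rw [Layout.mem_boxes]; omega)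
    have h9 := callProg_spec hA.pos hP h7.env h7.call h7.le (by omega) h7.fresh hA.rows hA.width
      hA.segments (by omega)
    rw [guessInstance_congr e4 e6, ← ha] at h9
    -- The error bound for one run, put into the form of the right side of `potential_step` and
    -- scaled by the factor for the remaining trials.
    have h10 := ((h9.mul_const (d (errs a i (v' 0 rCount)))).add_const
      (φ (errs a i (v' 0 rCount)))).mul_const (ρ ^ (r - (i + 1)))
    refine h10.mono le_rfl ?_ ?_ ?_
    · rintro v'' ⟨g1, g2, g3, g4⟩
      refine ⟨(g1.1 _ (by decide)).trans hrep, h6.trans (g1.mono (by simp) ?_), ?_, by omega⟩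
      · intro σ hσ
        rw [List.mem_singleton] at hσ
        rw [Layout.mem_boxes]
        omega
      · refine ⟨h7.env.of_frame g1 (by simp) (by simp; omega) (by simp; omega), g2, by omega,
          fun σ hσ b => ?_⟩
        rw [g1.2 σ (by omega) (by simp; omega)]
        exact h7.fresh σ (by omega) b
    · rintro v'' ⟨g1, g2, g3, g4⟩
      exact mul_le_mul_right (potential_step h1 ha1 h8 g3 g4) _
    · have e1 : r - i = r - (i + 1) + 1 := by omega
      rw [e1, pow_succ, mul_assoc]
      exact mul_le_mul_right (h2 _) _

end

section

variable {Γ : Layout} {v : Segs} {P : Prog} {t G r c tP g : ℕ} {e η : ℝ≥0∞}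

/-- Update the best cost, if the majority of the answers is yes. -/
def decideProg (TE : Expr) : Prog :=
  .cond ((SExpr.op .mul (.op .lt (reg rReps) (.op .add (reg rCount) (reg rCount)))
    (.op .lt (reg rCost) (reg rBest))).comp TE) (setReg TE rBest (reg rCost)) .skip

/-- Try the guess in register `rGuess`. -/
def guessProg (P : Prog) (TE : Expr) : Prog :=
  .seq (digitProg TE) (.seq (unionProg TE) (.seq (tableProg TE)
    (.seq (repProg P TE) (decideProg TE))))

/-- The registers that are changed when a guess is tried. -/
abbrev guessRegs : List ℕ :=
  [rJ, rPos, rCur, rPtr, rRow, rCol, rTagged, rCount, rCall, rRep, rTmp, rUnion, rCost, rI, rMin,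
    rBest]

/-- The time for trying a guess. -/
def guessTime (w len t m r call : ℕ) : ℕ :=
  (w + (2 * w + (t + t) * (2 * w + (w + w)))) + ((w + (w + (2 * w + t * (2 * w + (w + w))))) +
    ((2 * w + len * (2 * w + (w + (w + ((2 * w + m * (2 * w + (w + w))) + w))))) +
      (repTime w r call + (w + w))))

/-- The number `b'` is a correct update of the best cost `b` after trying the guess `d`. -/
def GoodUpdate (M : ℕ → ℕ) (m n t : ℕ) (d : ℕ → ℕ) (b b' : ℕ) : Prop :=
  (b' < b → ∃ A, IsCover M m n A ∧ A.card ≤ b') ∧ ∀ A, IsGuess M m n t d A → b' ≤ A.card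

/-- If the majority is right, then a yes certifies a cover within the cost of the guess, whether or
not the guess is sensible, and a correct guess is never rejected. So the only source of error is the
vote. -/
lemma guessProg_spec (hA : Ample Γ t G r)
    (hP : Decides P (Γ.n + t) ((smallList (Γ.n / t + 1) Γ.n).length * t) tP e)
    (hamp : Amplifies e η r) (hv : Ready Γ t G r c v) (hT : c + r ≤ Γ.T) (hg : v 0 rGuess = g)
    (hM : v 1 Γ.m = 0) :
    HT Γ (guessProg P Γ.TE) v (guessTime Γ.w (smallList (Γ.n / t + 1) Γ.n).length t Γ.m r
        (callTime Γ.w (smallList (Γ.n / t + 1) Γ.n).length t (Γ.n + t) P.nodes tP))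
      (fun v' => Frame guessRegs (4 :: 6 :: Γ.boxes) v v' ∧ Ready Γ t G r (c + r) v' ∧
        v' 0 rBest ≤ v 0 rBest)
      (fun v' => ind (¬ GoodUpdate (v 1) Γ.m Γ.n t (digit Γ.m g) (v 0 rBest) (v' 0 rBest))) η := by
  refine HT.seq_right (digitProg_spec hv.env.chunks hA.digits) ?_
  rintro v1 ⟨f1, h1⟩
  have r1 := hv.of_frame f1 (by simp) (by simp) (by simp) (by simp)
  have hd1 : ∀ j < t + t, v1 6 j = digit Γ.m g j := fun j hj => by rw [h1 j hj, hg]; rfl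
  refine HT.seq_right (unionProg_spec r1.env.chunks hA.cost fun j hj => ?_) ?_
  · rw [hd1 j hj]; exact digit_le _ _ _
  rintro v2 ⟨f2, h2, h3⟩
  have r2 := r1.of_frame f2 (by simp) (by simp) (by simp) (by simp)
  refine HT.seq_right (tableProg_spec r2.env.len r2.env.list hA.sets) ?_
  rintro v3 ⟨f3, h4⟩
  have r3 := r2.of_frame f3 (by simp) (by simp) (by simp) (by simp)
  have F3 : Frame [rJ, rTmp, rUnion, rCost, rI, rPos, rCur, rMin] [4, 6] v v3 :=
    ((f1.mono (by simp) (by simp)).trans (f2.mono (by simp) (by simp))).trans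
      (f3.mono (by simp) (by simp))
  have e21 : v2 1 = v 1 := (f2.2 1 (by decide) (by simp)).trans (f1.2 1 (by decide) (by simp))
  have e36 : v3 6 = v1 6 := (f3.2 6 (by decide) (by simp)).trans (f2.2 6 (by decide) (by simp))
  rw [h2, e21, f1.2 1 (by decide) (by simp), ← e36] at h4
  have hcost : v3 0 rCost = guessCost Γ.m (v3 6) t t := by
    rw [f3.1 _ (by decide), h3, e36]
  have hd3 : ∀ j < t + t, v3 6 j = digit Γ.m g j := fun j hj => by rw [e36, hd1 j hj]
  have hbest : v3 0 rBest = v 0 rBest := F3.1 _ (by decide)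
  refine HT.seq_left (repProg_spec hA hP hamp r3 hT) ?_
  rintro v4 ⟨f4, r4⟩
  have e46 : v4 0 rCost = v3 0 rCost := f4.1 _ (by decide)
  have e47 : v4 0 rBest = v 0 rBest := (f4.1 _ (by decide)).trans hbest
  have F4 : Frame guessRegs (4 :: 6 :: Γ.boxes) v v4 :=
    (F3.mono (by simp) (by simp)).trans (f4.mono (by simp) (by simp))
  have hcond : (SExpr.op .mul (.op .lt (reg rReps) (.op .add (reg rCount) (reg rCount)))
      (.op .lt (reg rCost) (reg rBest))).eval v4 ≠ 0 ↔
      r < 2 * v4 0 rCount ∧ v3 0 rCost < v 0 rBest := by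
    simp [reg, SExpr.eval, BinOp.eval, r4.env.reps, e46, e47, two_mul, and_comm]
  have hind : ∀ b', b' = (if r < 2 * v4 0 rCount ∧ v3 0 rCost < v 0 rBest then v3 0 rCost
      else v 0 rBest) →
      ind (¬ GoodUpdate (v 1) Γ.m Γ.n t (digit Γ.m g) (v 0 rBest) b') ≤
      ind (¬ (r < 2 * v4 0 rCount ↔ (guessInstance Γ t v3).HasExactCover)) := by
    intro b' hb'
    by_cases hw : r < 2 * v4 0 rCount ↔ (guessInstance Γ t v3).HasExactCover
    · rw [ind_false]
      · exact zero_le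
      · rw [not_not]
        refine ⟨fun hlt => ?_, fun A hGA => ?_⟩
        · have hc : r < 2 * v4 0 rCount ∧ v3 0 rCost < v 0 rBest := by
            by_contra hc
            rw [if_neg hc] at hb'
            omega
          rw [if_pos hc, hcost] at hb'
          rw [hb']
          refine exists_cover_of_hasExactCover hM (fun j hj => ?_) h4 (hw.1 hc.1)
          rw [hd3 j (by omega)]
          exact digit_le _ _ _
        · have hG := hGA.congr (d' := v3 6) fun j hj => (hd3 j hj).symm
          have h5 := hw.2 (hG.2 (v3 4) (smallList_nodup _ _) (smallList_lt _ _) h4)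
          have h6 := hG.1
          rw [hb', hcost]
          split_ifs with h7
          · exact h6
          · have : ¬ guessCost Γ.m (v3 6) t t < v 0 rBest := fun h => h7 ⟨h5, h⟩
            omega
    · rw [ind_true hw]; exact ind_le_one _
  refine HT.of_wf fun _ _ hwf => ?_
  refine HT.cond _ (by decide) (by decide) (fun h => ?_) fun h => ?_
  · rw [hcond] at h
    refine DT.setReg (by decide) (by decide) (by decide) ?_ ?_
    · simpa [reg, SExpr.eval] using hwf 0 (by norm_num) rCost
    · have e5 : (v4.set 0 rBest ((reg rCost).eval v4)) 0 rBest = v3 0 rCost := by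
        simp [Segs.set, reg, SExpr.eval, e46]
      refine ⟨⟨F4.setReg (by simp) _, r4.of_frame (rs := [rBest]) (ss := [])
        (Frame.refl.setReg (by simp) _) (by simp) (by simp) (by simp) (by simp), ?_⟩, ?_⟩
      · rw [e5]; exact h.2.le
      · exact hind _ (by rw [e5, if_pos h])
  · have h' : ¬ (r < 2 * v4 0 rCount ∧ v3 0 rCost < v 0 rBest) := by
      rw [← hcond]; exact fun hh => hh h
    exact DT.skip ⟨⟨F4, r4, e47.le⟩, hind _ (by rw [e47, if_neg h'])⟩

/-- Compute the minimal size of a cover, or `m + 1` if there is none. -/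
def optProg (P : Prog) (TE : Expr) : Prog :=
  .seq (setReg TE rBest (.op .add .m (.k 1)))
    (forProg TE rGuess (reg rGuesses) (guessProg P TE))

/-- The registers that are changed by the computation of the minimal size. -/
abbrev optRegs : List ℕ :=
  [rJ, rPos, rCur, rPtr, rRow, rCol, rTagged, rCount, rCall, rRep, rTmp, rUnion, rCost, rI, rMin,
    rBest, rGuess]

/-- The time for the computation of the minimal size. -/
def optTime (w G guess : ℕ) : ℕ := w + (2 * w + G * (2 * w + guess))

/-- A union bound over the guesses: the potential is the indicator that something has already gone
wrong, plus `η` for each guess still to come. If nothing goes wrong, the best cost is attained by a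
cover and is at most the size of each cover, as each has a correct guess. -/
lemma optProg_spec (hA : Ample Γ t G r) (hG : G = (Γ.m + 1) ^ (t + t))
    (hP : Decides P (Γ.n + t) ((smallList (Γ.n / t + 1) Γ.n).length * t) tP e)
    (hamp : Amplifies e η r) (hv : Ready Γ t G r c v) (hT : c + G * r ≤ Γ.T)
    (hM : v 1 Γ.m = 0) :
    HT Γ (optProg P Γ.TE) v (optTime Γ.w G
        (guessTime Γ.w (smallList (Γ.n / t + 1) Γ.n).length t Γ.m r
        (callTime Γ.w (smallList (Γ.n / t + 1) Γ.n).length t (Γ.n + t) P.nodes tP)))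
      (fun v' => Frame optRegs (4 :: 6 :: Γ.boxes) v v' ∧ Ready Γ t G r (c + G * r) v' ∧
        v' 0 rBest ≤ Γ.m + 1)
      (fun v' => ind (¬ IsOpt (v 1) Γ.m Γ.n (v' 0 rBest))) (G * η) := by
  have hTT := Γ.hT
  refine HT.of_wf fun hn hm hwf => ?_
  refine HT.setReg_seq (by
    simpa [SExpr.eval, BinOp.eval, hm] using Layout.lt_pow_of_le hA.sets) ?_
  have hbest0 : (v.set 0 rBest ((SExpr.op .add .m (.k 1)).eval v)) 0 rBest = Γ.m + 1 := by
    simp [Segs.set, SExpr.eval, BinOp.eval, hm]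
  let Good : ℕ → ℕ → Prop := fun i b => (b ≤ Γ.m → ∃ A, IsCover (v 1) Γ.m Γ.n A ∧ A.card ≤ b) ∧
    ∀ g < i, ∀ A, IsGuess (v 1) Γ.m Γ.n t (digit Γ.m g) A → b ≤ A.card
  have h5 := HT.forProg (Γ := Γ) (c := guessProg P Γ.TE) (r := rGuess) (N := reg rGuesses)
    (v := v.set 0 rBest ((SExpr.op .add .m (.k 1)).eval v))
    (t := guessTime Γ.w (smallList (Γ.n / t + 1) Γ.n).length t Γ.m r
        (callTime Γ.w (smallList (Γ.n / t + 1) Γ.n).length t (Γ.n + t) P.nodes tP))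
    (by decide) (by decide) (by decide) G hA.guesses
    (fun i v' => Frame optRegs (4 :: 6 :: Γ.boxes) v v' ∧ Ready Γ t G r (c + i * r) v' ∧
      v' 0 rBest ≤ Γ.m + 1)
    (fun i v' => ind (¬ Good i (v' 0 rBest)) + ((G - i : ℕ) : ℝ≥0∞) * η) ?_ ?_ ?_ ?_ ?_
  · refine h5.mono le_rfl (fun v' h => h) ?_ ?_
    · rintro v' ⟨-, -, h6⟩
      rw [Nat.sub_self, Nat.cast_zero, zero_mul, add_zero]
      by_cases hgood : Good G (v' 0 rBest)
      · rw [ind_false]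
        · exact zero_le
        · rw [not_not]
          refine ⟨h6, fun b hb => ⟨fun h7 => ?_, ?_⟩⟩
          · obtain ⟨A, hA1, hA2⟩ := hgood.1 (h7.trans hb)
            exact ⟨A, hA1, hA2.trans h7⟩
          · rintro ⟨A, hA1, hA2⟩
            obtain ⟨g, hg, hgA⟩ := exists_digit_isGuess hA.pos hA1
            exact (hgood.2 g (by rw [hG]; exact hg) A hgA).trans hA2
      · rw [ind_true hgood]; exact ind_le_one _
    · rw [hbest0, ind_false, zero_add, Nat.sub_zero]
      rw [not_not]
      exact ⟨fun h => absurd h (by omega), fun g hg => absurd hg (by omega)⟩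
  · rintro i v' x ⟨h6, h7, h8⟩
    exact ⟨h6.setReg (by simp) x, h7.of_frame (rs := [rGuess]) (ss := [])
      (Frame.refl.setReg (by simp) x) (by simp) (by simp) (by simp) (by simp),
      by simpa [Segs.set] using h8⟩
  · intro i v' x
    simp [Segs.set]
  · rintro i v' ⟨-, h6, -⟩
    simpa [reg, SExpr.eval] using h6.env.guesses
  · refine ⟨Frame.refl.setReg (by simp) _, ?_, hbest0.le⟩
    rw [zero_mul, add_zero]
    exact hv.of_frame (rs := [rBest]) (ss := [])
      (Frame.refl.setReg (by simp) _) (by simp) (by simp) (by simp) (by simp)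
  · rintro i hi v' ⟨h6, h7, h8⟩ hgi
    have e1 : v' 1 = v 1 := h6.2 1 (by decide) (by simp [Layout.mem_boxes])
    have hle : c + i * r + r ≤ Γ.T := by
      have := Nat.mul_le_mul_right r (show i + 1 ≤ G from hi)
      rw [Nat.add_mul] at this
      omega
    have h9 := guessProg_spec hA hP hamp h7 hle hgi (by rw [e1]; exact hM)
    rw [e1] at h9
    have h10 := h9.add_const (ind (¬ Good i (v' 0 rBest)) + ((G - (i + 1) : ℕ) : ℝ≥0∞) * η)
    refine h10.mono le_rfl ?_ ?_ ?_
    · rintro v'' ⟨g1, g2, g3⟩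
      refine ⟨(g1.1 _ (by decide)).trans hgi, h6.trans (g1.mono (by simp) (by simp)), ?_,
        by omega⟩
      have : c + (i + 1) * r = c + i * r + r := by ring
      rw [this]
      exact g2
    · rintro v'' ⟨g1, g2, g3⟩
      rw [← add_assoc]
      refine add_le_add_left ?_ _
      by_cases hgood : Good i (v' 0 rBest)
      · by_cases hup : GoodUpdate (v 1) Γ.m Γ.n t (digit Γ.m i) (v' 0 rBest) (v'' 0 rBest)
        · rw [ind_false]
          · exact zero_le
          · rw [not_not]
            refine ⟨fun h11 => ?_, fun g hg A hgA => ?_⟩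
            · rcases g3.lt_or_eq with h12 | h12
              · exact hup.1 h12
              · rw [h12] at h11 ⊢
                exact hgood.1 h11
            · rcases Nat.lt_or_eq_of_le (Nat.le_of_lt_succ hg) with h12 | rfl
              · exact g3.trans (hgood.2 g h12 A hgA)
              · exact hup.2 A hgA
        · rw [ind_true hup]
          exact (ind_le_one _).trans le_self_add
      · rw [ind_true hgood]
        exact (ind_le_one _).trans le_add_self
    · have e2 : G - i = G - (i + 1) + 1 := by omega
      rw [e2, Nat.cast_add, Nat.cast_one, add_mul, one_mul]
      exact le_of_eq (by ring)

end

/-! ## Deleting sets -/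

section

variable {Γ : Layout} {v : Segs} {P : Prog} {t G r c tP : ℕ} {e η : ℝ≥0∞}

/-- Delete all sets whose deletion does not increase the minimal size of a cover. -/
def deleteProg (P : Prog) (TE : Expr) : Prog :=
  forProg TE rDel .m (.seq (setReg TE rOld (.ld 1 (reg rDel)))
    (.seq (setProg TE (.k 1) (reg rDel) (.k 0)) (.seq (optProg P TE)
      (.cond ((SExpr.op .lt (reg rOpt) (reg rBest)).comp TE)
        (setProg TE (.k 1) (reg rDel) (reg rOld)) .skip))))

/-- The number `b` is the minimal size of a cover, and if there is a cover, then this is also true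
after the deletion of sets that has led to `M`, and no further set with index less than `i` can be
deleted. -/
def GoodDeletion (S : ℕ → ℕ) (m n b : ℕ) (M : ℕ → ℕ) (i : ℕ) : Prop :=
  IsOpt S m n b ∧ (b ≤ m → IsOpt M m n b ∧ NeededBelow M m n b i)

lemma GoodDeletion.keep {S M : ℕ → ℕ} {m n b b' i : ℕ} (h : GoodDeletion S m n b M i)
    (hb' : IsOpt (Function.update M i 0) m n b') (hlt : b < b') :
    GoodDeletion S m n b M (i + 1) :=
  ⟨h.1, fun hb => ⟨(h.2 hb).1, (h.2 hb).2.keep hb hb' hlt⟩⟩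

lemma GoodDeletion.delete {S M : ℕ → ℕ} {m n b b' i : ℕ} (h : GoodDeletion S m n b M i)
    (hb' : IsOpt (Function.update M i 0) m n b') (hle : b' ≤ b) :
    GoodDeletion S m n b (Function.update M i 0) (i + 1) :=
  ⟨h.1, fun hb => (h.2 hb).2.delete hb (h.2 hb).1 hb' hle⟩

lemma Segs.set_eq_update (v : Segs) (σ i x : ℕ) : v.set σ i x σ = Function.update (v σ) i x := by
  funext j
  simp [Segs.set, Function.update_apply]

/-- The registers that are changed by the deletion of sets. -/
abbrev deleteRegs : List ℕ :=
  [rJ, rPos, rCur, rPtr, rRow, rCol, rTagged, rCount, rCall, rRep, rTmp, rUnion, rCost, rI, rMin,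
    rBest, rGuess, rDel, rOld]

/-- The time for the deletion of sets. -/
def deleteTime (w m opt : ℕ) : ℕ := 2 * w + m * (2 * w + (w + (w + (opt + (w + w)))))

/-- Again a union bound, over the deletions. The initial weight also pays for the possibility that
the optimum in `rOpt` is wrong from the start. -/
lemma deleteProg_spec (hA : Ample Γ t G r) (hG : G = (Γ.m + 1) ^ (t + t))
    (hP : Decides P (Γ.n + t) ((smallList (Γ.n / t + 1) Γ.n).length * t) tP e)
    (hamp : Amplifies e η r) (hv : Ready Γ t G r c v) (hT : c + Γ.m * (G * r) ≤ Γ.T)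
    (hM : v 1 Γ.m = 0) :
    HT Γ (deleteProg P Γ.TE) v (deleteTime Γ.w Γ.m (optTime Γ.w G
        (guessTime Γ.w (smallList (Γ.n / t + 1) Γ.n).length t Γ.m r
        (callTime Γ.w (smallList (Γ.n / t + 1) Γ.n).length t (Γ.n + t) P.nodes tP))))
      (fun v' => Frame deleteRegs (1 :: 4 :: 6 :: Γ.boxes) v v' ∧
        ∀ j, v' 1 j = 0 ∨ v' 1 j = v 1 j)
      (fun v' => ind (¬ GoodDeletion (v 1) Γ.m Γ.n (v 0 rOpt) (v' 1) Γ.m))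
      (ind (¬ IsOpt (v 1) Γ.m Γ.n (v 0 rOpt)) + Γ.m * (G * η)) := by
  have hTT := Γ.hT
  refine HT.of_wf fun hn hm hwf => ?_
  set b := v 0 rOpt with hb
  have h5 := HT.forProg (Γ := Γ) (c := .seq (setReg Γ.TE rOld (.ld 1 (reg rDel)))
      (.seq (setProg Γ.TE (.k 1) (reg rDel) (.k 0)) (.seq (optProg P Γ.TE)
        (.cond ((SExpr.op .lt (reg rOpt) (reg rBest)).comp Γ.TE)
          (setProg Γ.TE (.k 1) (reg rDel) (reg rOld)) .skip)))) (r := rDel) (N := .m) (v := v)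
    (t := Γ.w + (Γ.w + (optTime Γ.w G
        (guessTime Γ.w (smallList (Γ.n / t + 1) Γ.n).length t Γ.m r
        (callTime Γ.w (smallList (Γ.n / t + 1) Γ.n).length t (Γ.n + t) P.nodes tP)) +
        (Γ.w + Γ.w))))
    (by decide) (by decide) (by decide) Γ.m Γ.hm
    (fun i v' => Frame deleteRegs (1 :: 4 :: 6 :: Γ.boxes) v v' ∧
      Ready Γ t G r (c + i * (G * r)) v' ∧ ∀ j, v' 1 j = 0 ∨ v' 1 j = v 1 j)
    (fun i v' => ind (¬ GoodDeletion (v 1) Γ.m Γ.n b (v' 1) i) +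
      ((Γ.m - i : ℕ) : ℝ≥0∞) * (G * η)) ?_ ?_ ?_ ?_ ?_
  · refine h5.mono le_rfl (fun v' h => ⟨h.1, h.2.2⟩) ?_ ?_
    · rintro v' -
      exact le_self_add
    · rw [Nat.sub_zero]
      refine add_le_add_left ?_ _
      by_cases hopt : IsOpt (v 1) Γ.m Γ.n b
      · rw [ind_false]
        · exact zero_le
        · exact fun h => h ⟨hopt, fun _ => ⟨hopt, fun j hj => absurd hj (Nat.not_lt_zero j)⟩⟩
      · rw [ind_true hopt]; exact ind_le_one _
  · rintro i v' x ⟨h6, h7, h8⟩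
    exact ⟨h6.setReg (by simp) x, h7.of_frame (rs := [rDel]) (ss := [])
      (Frame.refl.setReg (by simp) x) (by simp) (by simp) (by simp) (by simp),
      fun j => by simpa [Segs.set] using h8 j⟩
  · intro i v' x
    have : (v'.set 0 rDel x) 1 = v' 1 := by funext j; simp [Segs.set]
    rw [this]
  · rintro i v' ⟨h6, -⟩
    simp only [SExpr.eval]
    rw [h6.2 7 (by decide) (by simp [Layout.mem_boxes]), hm]
  · refine ⟨Frame.refl, ?_, fun j => Or.inr rfl⟩
    rw [zero_mul, add_zero]
    exact hv
  · rintro i hi v' ⟨h6, h7, h8⟩ hdel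
    have hM' : v' 1 Γ.m = 0 := (h8 Γ.m).elim id fun h => h.trans hM
    refine HT.of_wf fun hn' hm' hwf' => ?_
    have hx := hwf' 1 (by norm_num) i
    refine HT.setReg_seq (by simpa [reg, SExpr.eval, hdel] using hx) ?_
    set v1 := v'.set 0 rOld ((SExpr.ld 1 (reg rDel)).eval v') with hv1
    have f1 : Frame [rOld] [] v' v1 := Frame.refl.setReg (by simp) _
    have e1 : v1 0 rDel = i := (f1.1 _ (by decide)).trans hdel
    have e2 : v1 0 rOld = v' 1 i := by simp [hv1, Segs.set, reg, SExpr.eval, hdel]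
    have e3 : v1 1 = v' 1 := f1.2 1 (by decide) (by simp)
    refine HT.set_seq (by simp only [SExpr.eval]; omega) (by simp [SExpr.eval])
      (fun _ => by simp [SExpr.eval]) ?_
    set v2 := v1.set ((SExpr.k 1).eval v1) ((reg rDel).eval v1) ((SExpr.k 0).eval v1) with hv2
    have f2 : Frame [rOld] [1] v' v2 := (f1.mono (by simp) (by simp)).setSeg (by simp [SExpr.eval])
      (by simp [SExpr.eval]) _ _
    have e4 : v2 1 = Function.update (v' 1) i 0 := by
      rw [hv2, ← e3]
      simp only [SExpr.eval, reg, e1, Segs.set_eq_update]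
    have r2 := h7.of_frame f2 (by simp) (by simp) (by simp) (by simp)
    have hle : c + i * (G * r) + G * r ≤ Γ.T := by
      have := Nat.mul_le_mul_right (G * r) (show i + 1 ≤ Γ.m from hi)
      rw [Nat.add_mul] at this
      omega
    have h9 := optProg_spec hA hG hP hamp r2 hle (by
      rw [e4, Function.update_of_ne (by omega)]; exact hM')
    have h10 := h9.add_const (ind (¬ GoodDeletion (v 1) Γ.m Γ.n b (v' 1) i) +
      ((Γ.m - (i + 1) : ℕ) : ℝ≥0∞) * (G * η))
    -- Both outcomes of the comparison are treated together: the mask is either restored from `rOld`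
    -- or left at `0`.
    have hfin : ∀ v4, Frame deleteRegs (1 :: 4 :: 6 :: Γ.boxes) v2 v4 →
        Ready Γ t G r (c + i * (G * r) + G * r) v4 → v4 0 rDel = v2 0 rDel →
        ∀ b', v4 1 = (if b < b' then v' 1 else Function.update (v' 1) i 0) →
        ((v4 0 rDel = i ∧ Frame deleteRegs (1 :: 4 :: 6 :: Γ.boxes) v v4 ∧
          Ready Γ t G r (c + (i + 1) * (G * r)) v4 ∧ ∀ j, v4 1 j = 0 ∨ v4 1 j = v 1 j) ∧
          ind (¬ GoodDeletion (v 1) Γ.m Γ.n b (v4 1) (i + 1)) +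
            ((Γ.m - (i + 1) : ℕ) : ℝ≥0∞) * (G * η) ≤
          ind (¬ IsOpt (v2 1) Γ.m Γ.n b') + (ind (¬ GoodDeletion (v 1) Γ.m Γ.n b (v' 1) i) +
            ((Γ.m - (i + 1) : ℕ) : ℝ≥0∞) * (G * η))) := by
      intro v4 g1 g2 g3 b' g4
      refine ⟨⟨g3.trans ((f2.1 _ (by decide)).trans hdel),
        h6.trans ((f2.mono (by simp) (by simp)).trans g1), ?_, fun j => ?_⟩, ?_⟩
      · have : c + (i + 1) * (G * r) = c + i * (G * r) + G * r := by ring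
        rw [this]
        exact g2
      · rw [g4]
        split_ifs
        · exact h8 j
        · rcases update_zero_cases (v' 1) i j with h | h
          · exact Or.inl h
          · rw [h]; exact h8 j
      · rw [← add_assoc]
        refine add_le_add_left ?_ _
        by_cases hopt : IsOpt (v2 1) Γ.m Γ.n b'
        · by_cases hgood : GoodDeletion (v 1) Γ.m Γ.n b (v' 1) i
          · rw [ind_false]
            · exact zero_le
            · rw [not_not, g4]
              rw [e4] at hopt
              split_ifs with hlt
              · exact hgood.keep hopt hlt
              · exact hgood.delete hopt (Nat.le_of_not_lt hlt)
          · rw [ind_true hgood]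
            exact (ind_le_one _).trans le_add_self
        · rw [ind_true hopt]
          exact (ind_le_one _).trans le_self_add
    refine (HT.seq_left h10 ?_).mono le_rfl (fun _ h => h) (fun _ _ => le_rfl) ?_
    · rintro v3 ⟨g1, g2, g3⟩
      have g1' : Frame deleteRegs (1 :: 4 :: 6 :: Γ.boxes) v2 v3 := g1.mono (by simp) (by simp)
      have e5 : v3 0 rOpt = b := by
        rw [g1.1 _ (by decide), f2.1 _ (by decide), h6.1 _ (by decide)]
      have e6 : v3 0 rDel = v2 0 rDel := g1.1 _ (by decide)
      have e7 : v3 1 = v2 1 := g1.2 1 (by decide) (by simp [Layout.mem_boxes])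
      have e8 : v3 0 rOld = v' 1 i := by
        rw [g1.1 _ (by decide), hv2, ← e2]
        simp [Segs.set, SExpr.eval]
      have e9 : v3 0 rDel = i := by rw [e6, f2.1 _ (by decide), hdel]
      have hcond : (SExpr.op .lt (reg rOpt) (reg rBest)).eval v3 ≠ 0 ↔ b < v3 0 rBest := by
        simp [reg, SExpr.eval, BinOp.eval, e5]
      refine HT.cond _ (by decide) (by decide) (fun h => ?_) fun h => ?_
      · rw [hcond] at h
        refine DT.set (by decide) (by decide) (by decide) (by decide) (by decide)
          (by simp only [SExpr.eval]; omega) (by simp [SExpr.eval]) (fun _ => ?_) ?_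
        · simpa [reg, SExpr.eval, e8] using hx
        · simp only [reg, SExpr.eval, e8, e9]
          refine hfin _ (g1'.setSeg (by simp) (by simp) _ _) (g2.of_frame (rs := []) (ss := [1])
            (Frame.refl.setSeg (by simp) (by simp) _ _) (by simp) (by simp) (by simp) (by simp))
            ?_ (v3 0 rBest) ?_
          · rw [← e6]; simp [Segs.set]
          · rw [if_pos h, Segs.set_eq_update, e7, e4]
            simp
      · have h' : ¬ b < v3 0 rBest := by rw [← hcond]; exact fun hh => hh h
        refine DT.skip ?_
        exact hfin _ g1' g2 e6 _ (by rw [if_neg h', e7, e4])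
    · have e10 : Γ.m - i = Γ.m - (i + 1) + 1 := by omega
      rw [e10, Nat.cast_add, Nat.cast_one, add_mul, one_mul]
      exact le_of_eq (by ring)

/-! ## Output -/

/-- Write the characteristic vector of the sets that are left, except for the first one, into the
input region. -/
def outputProg (TE : Expr) : Prog :=
  forProg TE rI (.op .sub .m (.k 1)) (writeProg TE (.op .add (reg rI) (.k 2))
    (.op .lt (.k 0) (.ld 1 (.op .add (reg rI) (.k 1)))))

/-- The bit of set `0` belongs into cell `1`, which still holds `m`; it is left to `finishProg`.
Since `n > 0`, the cells up to `m` are within the input region. -/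
lemma outputProg_spec (hn : 0 < Γ.n) (hb : 0 < Γ.b) :
    DT Γ (outputProg Γ.TE) v (2 * Γ.w + (Γ.m - 1) * (2 * Γ.w + Γ.w)) fun v' =>
      Frame [rI] [7] v v' ∧ ∀ i, 0 < i → i < Γ.m → v' 7 (1 + i) = if v 1 i ≠ 0 then 1 else 0 := by
  refine HT.of_wf fun hn7 hm7 _ => ?_
  have hm := Γ.hm
  have hmn := Nat.le_mul_of_pos_left Γ.m hn
  refine (DT.forProg (by decide) (by decide) (by decide) (Γ.m - 1) (by omega)
    (fun i v' => Frame [rI] [7] v v' ∧ v' 7 1 = Γ.m ∧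
      ∀ j, 0 < j → j < i + 1 → v' 7 (1 + j) = if v 1 j ≠ 0 then 1 else 0) ?_ ?_ ?_ ?_).mono
    le_rfl fun v' h => ⟨h.1, fun i h0 hi => h.2.2 i h0 (by omega)⟩
  · rintro i v' x ⟨h1, h2, h3⟩
    exact ⟨h1.setReg (by simp) x, by simpa [Segs.set] using h2,
      fun j h0 hj => by simpa [Segs.set] using h3 j h0 hj⟩
  · rintro i v' ⟨-, h2, -⟩
    simp [SExpr.eval, BinOp.eval, h2]
  · exact ⟨Frame.refl, hm7, fun j h0 hj => absurd hj (by omega)⟩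
  · rintro i hi v' ⟨h1, h2, h3⟩ hI
    have e1 : v' 1 = v 1 := h1.2 1 (by decide) (by decide)
    have e2 : (SExpr.op .add (reg rI) (.k 2)).eval v' = i + 2 := by
      simp [reg, SExpr.eval, BinOp.eval, hI]
    have e3 : (SExpr.op .lt (.k 0) (.ld 1 (.op .add (reg rI) (.k 1)))).eval v' =
        if v 1 (i + 1) ≠ 0 then 1 else 0 := by
      simp [reg, SExpr.eval, BinOp.eval, hI, e1, Nat.pos_iff_ne_zero]
    refine DT.write (by decide) (by decide) (by decide) (by decide) (by rw [e2]; omega)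
      (by rw [e2, Layout.R]; omega) ?_ ?_
    · rw [e3]
      have := Nat.one_lt_two_pow (n := Γ.b) (by omega)
      split_ifs <;> omega
    · rw [e2, e3]
      refine ⟨by simpa [Segs.set] using hI, h1.setSeg (by simp) (by simp) _ _,
        by simpa [Segs.set] using h2, fun j h0 hj => ?_⟩
      by_cases hji : j = i + 1
      · subst hji
        simp [Segs.set, show 1 + (i + 1) = i + 2 by omega]
      · have : 1 + j ≠ i + 2 := by omega
        simpa [Segs.set, this] using h3 j h0 (by omega)

end

/-! ## Preparation -/

section

variable {Γ : Layout} {v : Segs} {P : Prog} {t G r c tP : ℕ} {e η : ℝ≥0∞}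

/-- Write the number `t` into register `rChunks`. -/
def chunksProg (TE : Expr) : ℕ → Prog
  | 0 => setReg TE rChunks (.k 0)
  | t + 1 => .seq (chunksProg TE t) (setReg TE rChunks (.op .add (reg rChunks) (.k 1)))

/-- `t` grows with the required precision, whereas the time unit covers only expressions of bounded
weight. Hence `t` is produced by increments and not as one constant. -/
lemma chunksProg_spec (ht : t < Γ.b) : DT Γ (chunksProg Γ.TE t) v ((t + 1) * Γ.w)
    fun v' => Frame [rChunks] [] v v' ∧ v' 0 rChunks = t := by
  induction t with
  | zero =>
    rw [zero_add, one_mul]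
    exact DT.setReg (by decide) (by decide) (by decide) (by simp [SExpr.eval])
      ⟨Frame.refl.setReg (by simp) _, by simp [Segs.set, SExpr.eval]⟩
  | succ t ih =>
    refine (DT.seq (ih (by omega)) ?_ (t₂ := Γ.w)).mono (le_of_eq (by ring)) fun _ h => h
    rintro v' ⟨h1, h2⟩
    refine DT.setReg (by decide) (by decide) (by decide) ?_
      ⟨h1.setReg (by simp) _, by simp [Segs.set, SExpr.eval, BinOp.eval, reg, h2]⟩
    simp only [reg, SExpr.eval, BinOp.eval, h2]
    exact Layout.lt_pow_of_le ht.le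

/-- Compute the number of guesses. -/
def guessesProg (TE : Expr) : Prog :=
  .seq (setReg TE rGuesses (.k 1)) (forProg TE rJ (.op .add (reg rChunks) (reg rChunks))
    (setReg TE rGuesses (.op .mul (reg rGuesses) (.op .add .m (.k 1)))))

lemma guessesProg_spec (ht : v 0 rChunks = t) (hb : t + t ≤ Γ.b)
    (hG : (Γ.m + 1) ^ (t + t) < 2 ^ Γ.b) :
    DT Γ (guessesProg Γ.TE) v (Γ.w + (2 * Γ.w + (t + t) * (2 * Γ.w + Γ.w)))
    fun v' => Frame [rGuesses, rJ] [] v v' ∧ v' 0 rGuesses = (Γ.m + 1) ^ (t + t) := by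
  have hle : ∀ i ≤ t + t, (Γ.m + 1) ^ i < 2 ^ Γ.b := fun i hi =>
    (Nat.pow_le_pow_right (by omega) hi).trans_lt hG
  refine HT.setReg_seq (by simpa [SExpr.eval] using hle 0 (Nat.zero_le _)) ?_
  refine DT.forProg (by decide) (by decide) (by decide) (t + t) (Layout.lt_pow_of_le hb)
    (fun i v' => Frame [rGuesses, rJ] [] v v' ∧ v' 0 rGuesses = (Γ.m + 1) ^ i) ?_ ?_ ?_ ?_
  · rintro i v' x ⟨h1, h2⟩
    exact ⟨h1.setReg (by simp) x, by simpa [Segs.set] using h2⟩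
  · rintro i v' ⟨h1, -⟩
    simp only [reg, SExpr.eval, BinOp.eval]
    rw [h1.1 _ (by decide), ht]
  · exact ⟨Frame.refl.setReg (by simp) _, by simp [Segs.set, SExpr.eval]⟩
  · rintro i hi v' ⟨h1, h2⟩ hJ
    refine HT.of_wf fun _ hm _ => ?_
    have e1 : (SExpr.op .mul (reg rGuesses) (.op .add .m (.k 1))).eval v' =
        (Γ.m + 1) ^ (i + 1) := by
      simp only [reg, SExpr.eval, BinOp.eval, h2, hm, pow_succ]
    refine DT.setReg (by decide) (by decide) (by decide) ?_ ?_
    · rw [e1]; exact hle _ hi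
    · rw [e1]
      exact ⟨by simpa [Segs.set] using hJ, h1.setReg (by simp) _, by simp [Segs.set]⟩

/-- Compute the constants. -/
def constProg (t : ℕ) (TE : Expr) : Prog :=
  .seq (chunksProg TE t) (.seq (setReg TE rWidth (.op .add .n (reg rChunks)))
    (.seq (setReg TE rBound (.op .add (.op .div .n (reg rChunks)) (.k 1)))
      (.seq (guessesProg TE)
        (.seq (setReg TE rReps (.op .mul (.k 48) (.op .mul (reg rGuesses) (.op .add .m (.k 1)))))
          (setReg TE rCall (.k 8))))))

/-- The time for the computation of the constants. -/
def constTime (w t : ℕ) : ℕ :=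
  (t + 1) * w + (w + (w + ((w + (2 * w + (t + t) * (2 * w + w))) + (w + w))))

lemma constProg_spec (hA : Ample Γ t G r) (hG : G = (Γ.m + 1) ^ (t + t))
    (hr : r = 48 * (G * (Γ.m + 1))) :
    DT Γ (constProg t Γ.TE) v (constTime Γ.w t) fun v' =>
      Frame [rChunks, rWidth, rBound, rGuesses, rReps, rCall, rJ] [] v v' ∧
      v' 0 rChunks = t ∧ v' 0 rWidth = Γ.n + t ∧ v' 0 rBound = Γ.n / t + 1 ∧
      v' 0 rGuesses = G ∧ v' 0 rReps = r ∧ v' 0 rCall = 8 := by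
  refine HT.of_wf fun hn hm _ => ?_
  have hTT := Γ.hT
  have hw := hA.width
  refine HT.seq_right (chunksProg_spec (by omega)) ?_
  rintro v1 ⟨f1, h1⟩
  have n1 : v1 7 0 = Γ.n := by rw [f1.2 7 (by decide) (by simp), hn]
  have e1 : (SExpr.op .add .n (reg rChunks)).eval v1 = Γ.n + t := by
    simp only [reg, SExpr.eval, BinOp.eval, h1, n1]
  refine HT.setReg_seq (by rw [e1]; exact Layout.lt_pow_of_le hw.le) ?_
  rw [e1]
  set v2 := v1.set 0 rWidth (Γ.n + t) with hv2
  have f2 : Frame [rWidth] [] v1 v2 := Frame.refl.setReg (by simp) _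
  have w2 : v2 0 rWidth = Γ.n + t := by simp [hv2, Segs.set]
  have c2 : v2 0 rChunks = t := (f2.1 _ (by decide)).trans h1
  have n2 : v2 7 0 = Γ.n := by rw [f2.2 7 (by decide) (by simp), n1]
  have e2 : (SExpr.op .add (.op .div .n (reg rChunks)) (.k 1)).eval v2 = Γ.n / t + 1 := by
    simp only [reg, SExpr.eval, BinOp.eval, c2, n2]
  have hb := Nat.div_le_self Γ.n t
  have hpos := hA.pos
  refine HT.setReg_seq (by rw [e2]; exact Layout.lt_pow_of_le (by omega)) ?_
  rw [e2]
  set v3 := v2.set 0 rBound (Γ.n / t + 1) with hv3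
  have f3 : Frame [rBound] [] v2 v3 := Frame.refl.setReg (by simp) _
  have b3 : v3 0 rBound = Γ.n / t + 1 := by simp [hv3, Segs.set]
  have c3 : v3 0 rChunks = t := (f3.1 _ (by decide)).trans c2
  refine HT.seq_right (guessesProg_spec c3 hA.digits (hG ▸ hA.guesses)) ?_
  rintro v4 ⟨f4, h4⟩
  rw [← hG] at h4
  have F4 : Frame [rChunks, rWidth, rBound, rGuesses, rReps, rCall, rJ] [] v v4 :=
    (((f1.mono (by simp) (by simp)).trans (f2.mono (by simp) (by simp))).trans
      (f3.mono (by simp) (by simp))).trans (f4.mono (by simp) (by simp))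
  have m4 : v4 7 1 = Γ.m := by rw [F4.2 7 (by decide) (by simp), hm]
  have e5 : (SExpr.op .mul (.k 48) (.op .mul (reg rGuesses) (.op .add .m (.k 1)))).eval v4 = r := by
    simp only [reg, SExpr.eval, BinOp.eval, h4, m4, hr]
  have hrb := hA.reps
  refine HT.setReg_seq (by rw [e5]; omega) ?_
  rw [e5]
  set v5 := v4.set 0 rReps r with hv5
  have f5 : Frame [rReps] [] v4 v5 := Frame.refl.setReg (by simp) _
  have hseg := hA.segments
  refine DT.setReg (by decide) (by decide) (by decide) ?_ ?_
  · simp only [SExpr.eval]; omega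
  · have f6 : Frame [rCall] [] v5 (v5.set 0 rCall ((SExpr.k 8).eval v5)) :=
      Frame.refl.setReg (by simp) _
    refine ⟨(F4.trans (f5.mono (by simp) (by simp))).trans (f6.mono (by simp) (by simp)),
      ?_, ?_, ?_, ?_, ?_, ?_⟩
    · rw [f6.1 _ (by decide), f5.1 _ (by decide), f4.1 _ (by decide), c3]
    · rw [f6.1 _ (by decide), f5.1 _ (by decide), f4.1 _ (by decide), f3.1 _ (by decide), w2]
    · rw [f6.1 _ (by decide), f5.1 _ (by decide), f4.1 _ (by decide), b3]
    · rw [f6.1 _ (by decide), f5.1 _ (by decide), h4]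
    · rw [f6.1 _ (by decide)]; simp [hv5, Segs.set]
    · simp [Segs.set, SExpr.eval]

/-- Compute the constants and tables. -/
def prepProg (t : ℕ) (TE : Expr) : Prog :=
  .seq (constProg t TE) (.seq (powProg TE) (.seq (maskProg TE) (listProg TE)))

/-- The time for the computation of the constants and tables. -/
def prepTime (w n m t len : ℕ) : ℕ :=
  constTime w t + ((w + (2 * w + (n + t) * (2 * w + w))) +
    ((2 * w + m * (2 * w + (2 * w + n * (2 * w + (w + w))))) +
      (w + (w + (w + (2 * w + n * (2 * w + (w +
      (2 * w + len * (2 * w + (w + (w + (w + w)))))))))))))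

lemma length_smallSubsets_mono (h : ℕ) {j n : ℕ} (hj : j ≤ n) :
    (smallSubsets h j).length ≤ (smallSubsets h n).length := by
  induction n, hj using Nat.le_induction with
  | base => exact le_rfl
  | succ n _ ih => exact ih.trans (by rw [smallSubsets, List.length_append]; omega)

lemma prepProg_spec {f : ℕ → ℕ → ℕ} (hA : Ample Γ t G r) (hG : G = (Γ.m + 1) ^ (t + t))
    (hr : r = 48 * (G * (Γ.m + 1))) (hf : ∀ i j, f i j ≤ 1)
    (hin : ∀ i < Γ.m, ∀ j < Γ.n, v 7 (2 + (i * Γ.n + j)) = f i j)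
    (h0 : ∀ σ, σ ≠ 7 → ∀ a, v σ a = 0) :
    DT Γ (prepProg t Γ.TE) v
      (prepTime Γ.w Γ.n Γ.m t (smallList (Γ.n / t + 1) Γ.n).length) fun v' =>
      Ready Γ t G r 8 v' ∧ ∀ i, v' 1 i = if i < Γ.m then ofDigits (f i) Γ.n else 0 := by
  have hTT := Γ.hT
  refine HT.of_wf fun hn hm _ => ?_
  have hw := hA.width
  refine HT.seq_right (constProg_spec hA hG hr) ?_
  rintro v1 ⟨f1, hch, hwd, hbd, hgs, hrp, hcl⟩
  refine HT.seq_right (powProg_spec hwd hw) ?_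
  rintro v2 ⟨f2, h2⟩
  refine HT.seq_right (maskProg_spec f hf ?_ ?_ (fun j hj => h2 j (by omega)) (by omega) ?_ ?_) ?_
  · intro i hi j hj
    rw [f2.2 7 (by decide) (by simp), f1.2 7 (by decide) (by simp), hin i hi j hj]
  · intro i
    rw [f2.2 1 (by decide) (by simp), f1.2 1 (by decide) (by simp), h0 1 (by decide)]
  · rw [f2.2 7 (by decide) (by simp), f1.2 7 (by decide) (by simp), hn]
  · rw [f2.2 7 (by decide) (by simp), f1.2 7 (by decide) (by simp), hm]
  rintro v3 ⟨f3, h3⟩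
  have hpos := hA.pos
  have hb := Nat.div_le_self Γ.n t
  have e5 : v3 5 = v2 5 := f3.2 5 (by decide) (by simp)
  refine (listProg_spec (h := Γ.n / t + 1) (N := (smallSubsets (Γ.n / t + 1) Γ.n).length)
    ?_ (by omega) (by omega) ?_ ?_ fun j hj => length_smallSubsets_mono _ hj).mono ?_ ?_
  · rw [f3.1 _ (by decide), f2.1 _ (by decide), hbd]
  · intro j hj
    rw [e5]
    exact h2 j (by omega)
  · rw [f3.2 7 (by decide) (by simp), f2.2 7 (by decide) (by simp), f1.2 7 (by decide) (by simp), hn]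
  · rw [smallList, List.length_map]
  · rintro v4 ⟨f4, hst⟩
    have F : Frame [rI, rJ, rLen, rOld, rPos, rTmp] [1, 2, 3, 5] v1 v4 :=
      ((f2.mono (by simp) (by simp)).trans (f3.mono (by simp) (by simp))).trans
        (f4.mono (by simp) (by simp))
    refine ⟨⟨⟨?_, ?_, ?_, ?_, ?_, fun i X hX => ?_, fun j hj => ?_⟩, ?_, le_rfl, fun σ hσ a => ?_⟩,
      fun i => ?_⟩
    · rw [F.1 _ (by decide), hch]
    · rw [F.1 _ (by decide), hwd]
    · rw [F.1 _ (by decide), hgs]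
    · rw [F.1 _ (by decide), hrp]
    · rw [hst.1, smallList, List.length_map]
    · rw [smallList, List.getElem?_map, Option.map_eq_some_iff] at hX
      obtain ⟨q, hq, rfl⟩ := hX
      exact (hst.2 i q hq).1
    · rw [f4.2 5 (by decide) (by simp), e5, h2 j hj]
    · rw [F.1 _ (by decide), hcl]
    · rw [F.2 σ (by omega) (by simp; omega), f1.2 σ (by omega) (by simp), h0 σ (by omega)]
    · rw [f4.2 1 (by decide) (by simp), h3]

/-! ## Solving Set Cover -/

/-- The main part of the program for Set Cover. -/
def bodyProg (P : Prog) (t : ℕ) (TE : Expr) : Prog :=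
  .seq (prepProg t TE) (.seq (.seq (optProg P TE) (setReg TE rOpt (reg rBest)))
    (.seq (deleteProg P TE) (outputProg TE)))

/-- The time of the main part. -/
def bodyTime (w n m t len opt : ℕ) : ℕ :=
  prepTime w n m t len + ((opt + w) + (deleteTime w m opt + (2 * w + (m - 1) * (2 * w + w))))

lemma bodyProg_spec {f : ℕ → ℕ → ℕ} (hA : Ample Γ t G r) (hG : G = (Γ.m + 1) ^ (t + t))
    (hr : r = 48 * (G * (Γ.m + 1))) (hf : ∀ i j, f i j ≤ 1)
    (hP : Decides P (Γ.n + t) ((smallList (Γ.n / t + 1) Γ.n).length * t) tP e)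
    (hamp : Amplifies e η r) (hT : 8 + (Γ.m + 1) * (G * r) ≤ Γ.T) (hn : 0 < Γ.n)
    (hin : ∀ i < Γ.m, ∀ j < Γ.n, v 7 (2 + (i * Γ.n + j)) = f i j)
    (h0 : ∀ σ, σ ≠ 7 → ∀ a, v σ a = 0) {S : ℕ → ℕ}
    (hS : ∀ i, S i = if i < Γ.m then ofDigits (f i) Γ.n else 0) :
    HT Γ (bodyProg P t Γ.TE) v
      (bodyTime Γ.w Γ.n Γ.m t (smallList (Γ.n / t + 1) Γ.n).length (optTime Γ.w G
        (guessTime Γ.w (smallList (Γ.n / t + 1) Γ.n).length t Γ.m r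
        (callTime Γ.w (smallList (Γ.n / t + 1) Γ.n).length t (Γ.n + t) P.nodes tP))))
      (fun v' => (∀ j, v' 1 j = 0 ∨ v' 1 j = S j) ∧
        ∀ i, 0 < i → i < Γ.m → v' 7 (1 + i) = if v' 1 i ≠ 0 then 1 else 0)
      (fun v' => ind (¬ GoodDeletion S Γ.m Γ.n (v' 0 rOpt) (v' 1) Γ.m))
      ((Γ.m + 1) * (G * η)) := by
  have hTT := Γ.hT
  have hw := hA.width
  refine HT.seq_right (prepProg_spec hA hG hr hf hin h0) ?_
  rintro v1 ⟨r1, h1⟩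
  have h1S : v1 1 = S := funext fun i => (h1 i).trans (hS i).symm
  have hT' : 8 + G * r + Γ.m * (G * r) ≤ Γ.T := by rw [Nat.add_mul] at hT; omega
  have hM : v1 1 Γ.m = 0 := by rw [h1, if_neg (lt_irrefl _)]
  have h2 := (optProg_spec hA hG hP hamp r1 (by omega) hM).add_const (Γ.m * (G * η))
  rw [h1S] at h2
  have h3 : HT Γ (.seq (optProg P Γ.TE) (setReg Γ.TE rOpt (reg rBest))) v1
      ((optTime Γ.w G (guessTime Γ.w (smallList (Γ.n / t + 1) Γ.n).length t Γ.m r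
        (callTime Γ.w (smallList (Γ.n / t + 1) Γ.n).length t (Γ.n + t) P.nodes tP))) + Γ.w)
      (fun v' => v' 1 = S ∧ Ready Γ t G r (8 + G * r) v')
      (fun v' => ind (¬ IsOpt S Γ.m Γ.n (v' 0 rOpt)) + Γ.m * (G * η))
      (G * η + Γ.m * (G * η)) := by
    refine HT.seq_left h2 ?_
    rintro v2 ⟨f2, r2, h4⟩
    have f3 : Frame [rOpt] [] v2 (v2.set 0 rOpt ((reg rBest).eval v2)) :=
      Frame.refl.setReg (by simp) _
    have hset := hA.sets
    refine DT.setReg (by decide) (by decide) (by decide) ?_ ⟨⟨?_, ?_⟩, ?_⟩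
    · simp only [reg, SExpr.eval]
      exact Layout.lt_pow_of_le (h4.trans hset)
    · rw [f3.2 1 (by decide) (by simp), f2.2 1 (by decide) (by simp [Layout.mem_boxes]), h1S]
    · exact r2.of_frame f3 (by simp) (by simp) (by simp) (by simp)
    · simp [Segs.set, reg, SExpr.eval]
  have hsum : G * η + Γ.m * (G * η) = (Γ.m + 1) * (G * η) := by ring
  rw [hsum] at h3
  refine HT.seq h3 ?_
  rintro v3 ⟨h4, r3⟩
  have h5 := deleteProg_spec hA hG hP hamp r3 hT' (by rw [h4, ← h1S]; exact hM)
  rw [h4] at h5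
  refine HT.seq_left h5 ?_
  rintro v4 ⟨f4, h6⟩
  refine DT.mono (outputProg_spec hn (by omega)) le_rfl ?_
  rintro v5 ⟨f5, h7⟩
  have e1 : v5 1 = v4 1 := f5.2 1 (by decide) (by simp)
  have e2 : v5 0 rOpt = v3 0 rOpt := by rw [f5.1 _ (by decide), f4.1 _ (by decide)]
  rw [e1, e2]
  exact ⟨⟨h6, h7⟩, le_rfl⟩

end

/-! ## The program for Set Cover -/

/-- Write the answer into the cells `0` and `1`. -/
def finishProg (TE : Expr) : Prog :=
  .cond ((SExpr.op .lt (reg rOpt) (.op .add .m (.k 1))).comp TE)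
    (.seq (.store (.const 1) ((SExpr.op .lt (.k 0) (.ld 1 (.k 0))).comp TE))
      (.store (.const 0) (.const 1))) (.store (.const 0) (.const 0))

/-- Here `n` and `m` are overwritten, so the segments become unreadable. Everything that depends on
them is evaluated before or during the first store; what remains uses constants only. -/
lemma finish_exec {Γ : Layout} {s : Mem} (hs : Γ.WF s) :
    ∃ s' k, Exec (finishProg Γ.TE) s (PMF.pure (s', k)) ∧ k ≤ 20 * Γ.w ∧
      (∀ a, 2 ≤ a → s' a = s a) ∧
      (Γ.segs s 0 rOpt ≤ Γ.m → s' 0 = 1 ∧ s' 1 = if Γ.segs s 1 0 ≠ 0 then 1 else 0) ∧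
      (¬ Γ.segs s 0 rOpt ≤ Γ.m → s' 0 = 0) := by
  have hm : Γ.segs s 7 1 = Γ.m := by rw [Γ.segs_input_one]; exact hs.2.1
  have h1 := (SExpr.comp_spec hs (.op .lt (reg rOpt) (.op .add .m (.k 1))) rfl).1
  have h2 := Layout.cost_le hs (.op .lt (reg rOpt) (.op .add .m (.k 1))) rfl (by decide)
  have h3 := (SExpr.comp_spec hs (.op .lt (.k 0) (.ld 1 (.k 0))) rfl).1
  have h4 := Layout.cost_le hs (.op .lt (.k 0) (.ld 1 (.k 0))) rfl (by decide)
  have h5 : Nat.size 1 = 1 := Nat.size_one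
  by_cases h : Γ.segs s 0 rOpt ≤ Γ.m
  · have h6 : ((SExpr.op .lt (reg rOpt) (.op .add .m (.k 1))).comp Γ.TE).eval s ≠ 0 := by
      rw [h1]
      simp [reg, SExpr.eval, BinOp.eval, hm]
      omega
    have h7 := Exec.cond_true _ _ (.store (.const 0) (.const 0)) s _ h6
      (Exec.seq _ _ s _ (fun s' => PMF.pure (Function.update s' 0 1, 4))
        (Exec.store (.const 1) ((SExpr.op .lt (.k 0) (.ld 1 (.k 0))).comp Γ.TE) s)
        fun p _ => by
          have := Exec.store (.const 0) (.const 1) p.1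
          simpa [Expr.eval, Expr.cost, h5] using this)
    simp only [PMF.pure_bind, PMF.pure_map] at h7
    refine ⟨_, _, h7, ?_, fun a ha => ?_, fun _ => ⟨?_, ?_⟩, fun h' => absurd h h'⟩
    · simp only [Expr.cost, h5]; omega
    · rw [Function.update_of_ne (by omega), Function.update_of_ne (by simp only [Expr.eval]; omega)]
    · simp
    · simp only [Expr.eval, h3]
      simp [SExpr.eval, BinOp.eval, Nat.pos_iff_ne_zero]
  · have h6 : ((SExpr.op .lt (reg rOpt) (.op .add .m (.k 1))).comp Γ.TE).eval s = 0 := by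
      rw [h1]
      simp [reg, SExpr.eval, BinOp.eval, hm]
      omega
    have h7 := Exec.cond_false _ (.seq (.store (.const 1)
      ((SExpr.op .lt (.k 0) (.ld 1 (.k 0))).comp Γ.TE)) (.store (.const 0) (.const 1))) _ s _ h6
      (Exec.store (.const 0) (.const 0) s)
    simp only [PMF.pure_map] at h7
    refine ⟨_, _, h7, ?_, fun a ha => ?_, fun h' => absurd h' h, fun _ => ?_⟩
    · simp only [Expr.cost, Nat.size_zero]; omega
    · rw [Function.update_of_ne (by simp only [Expr.eval]; omega)]
    · simp [Expr.eval]

/-- The program for Set Cover, with the program `P` for Exact Cover as a subroutine. -/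
def setCoverProg (P : Prog) (t : ℕ) (TE : Expr) : Prog :=
  .cond (.load (.const 0)) (.seq (bodyProg P t TE) (finishProg TE))
    (.seq (.store (.const 1) (.const 0)) (.store (.const 0) (.const 1)))

lemma SetSystem.input_add_two (I : SetSystem) (i : Fin I.m) (j : Fin I.n) :
    I.input (2 + (i * I.n + j)) = if j ∈ I.S i then 1 else 0 := by
  have : 2 + ((i : ℕ) * I.n + j) = (i * I.n + j) + 2 := by omega
  rw [this, SetSystem.input]
  congr 1
  rw [eq_iff_iff]
  constructor
  · rintro ⟨i', j', h1, h2⟩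
    have hn : 0 < I.n := j.pos
    have e1 : ∀ (i : Fin I.m) (j : Fin I.n), (i * I.n + j : ℕ) / I.n = i := fun i j => by
      rw [mul_comm, Nat.mul_add_div hn, Nat.div_eq_of_lt j.2, add_zero]
    have e2 : ∀ (i : Fin I.m) (j : Fin I.n), (i * I.n + j : ℕ) % I.n = j := fun i j => by
      rw [mul_comm, Nat.mul_add_mod, Nat.mod_eq_of_lt j.2]
    have hi : i = i' := Fin.ext (by rw [← e1 i j, h1, e1])
    have hj : j = j' := Fin.ext (by rw [← e2 i j, h1, e2])
    rwa [hi, hj]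
  · exact fun h => ⟨i, j, rfl, h⟩

lemma SetSystem.input_le_one (I : SetSystem) (a : ℕ) : I.input (2 + a) ≤ 1 := by
  rw [add_comm, SetSystem.input]
  split_ifs <;> omega

lemma SetSystem.input_eq_zero (I : SetSystem) {a : ℕ} (ha : 2 + I.n * I.m ≤ a) :
    I.input a = 0 := by
  obtain ⟨a, rfl⟩ : ∃ x, a = x + 2 := ⟨a - 2, by omega⟩
  rw [SetSystem.input, if_neg]
  rintro ⟨i, j, h1, -⟩
  have h2 := Nat.mul_le_mul_right I.n (show (i : ℕ) + 1 ≤ I.m from i.2)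
  rw [Nat.add_mul, mul_comm I.m] at h2
  have := j.2
  omega

lemma SetSystem.segs_input {I : SetSystem} {Γ : Layout} (hn : Γ.n = I.n) (hm : Γ.m = I.m) :
    ∀ σ, σ ≠ 7 → ∀ a, Γ.segs I.input σ a = 0 := by
  intro σ hσ a
  simp only [Layout.segs, hσ, if_false]
  split_ifs
  · refine I.input_eq_zero ?_
    have := Γ.R_le_addr σ a
    rwa [Layout.R, hn, hm] at this
  · rfl

lemma SetSystem.wf_input {I : SetSystem} {Γ : Layout} (hn : Γ.n = I.n) (hm : Γ.m = I.m)
    (hb : 0 < Γ.b) : Γ.WF I.input := by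
  refine ⟨hn.symm, hm.symm, fun σ hσ a => ?_⟩
  by_cases h7 : σ = 7
  · subst h7
    simp only [Layout.segs, if_true]
    split_ifs
    · match a with
      | 0 => have h1 := Γ.hn; rw [hn] at h1; exact h1
      | 1 => have h1 := Γ.hm; rw [hm] at h1; exact h1
      | a + 2 =>
        have h1 := I.input_le_one a
        have h2 := Nat.one_lt_two_pow (n := Γ.b) (by omega)
        rw [add_comm]
        omega
    · positivity
  · rw [SetSystem.segs_input hn hm σ h7]
    positivity

/-- The program for Set Cover is correct. -/
theorem setCoverProg_spec {I : SetSystem} {Γ : Layout} (hn : Γ.n = I.n) (hm : Γ.m = I.m)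
    {P : Prog} {t G r tP : ℕ} {e η : ℝ≥0∞}
    (hA : Ample Γ t G r) (hG : G = (Γ.m + 1) ^ (t + t)) (hr : r = 48 * (G * (Γ.m + 1)))
    (hP : Decides P (Γ.n + t) ((smallList (Γ.n / t + 1) Γ.n).length * t) tP e)
    (hamp : Amplifies e η r) (hT : 8 + (Γ.m + 1) * (G * r) ≤ Γ.T) :
    ∃ μ, Exec (setCoverProg P t Γ.TE) I.input μ ∧
      (∀ p ∈ μ.support, p.2 ≤ bodyTime Γ.w Γ.n Γ.m t (smallList (Γ.n / t + 1) Γ.n).length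
        (optTime Γ.w G (guessTime Γ.w (smallList (Γ.n / t + 1) Γ.n).length t Γ.m r
        (callTime Γ.w (smallList (Γ.n / t + 1) Γ.n).length t (Γ.n + t) P.nodes tP))) +
          40 * Γ.w) ∧
      ev μ (fun p => ind (¬ SetCover I p.1)) ≤ (Γ.m + 1) * (G * η) := by
  have hww : 10 * Γ.b + 10 ≤ Γ.w := by
    refine le_trans ?_ Γ.hw
    have h1 : 100 ^ 2 ≤ (100 * (Γ.TE.wt + 20)) ^ 2 := Nat.pow_le_pow_left (by omega) 2
    have h2 : 10 * (Γ.b + 1) ≤ 2 * (100 * (Γ.TE.wt + 20)) ^ 2 * (Γ.b + 1) :=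
      Nat.mul_le_mul_right _ (by omega)
    omega
  have hs1 : Nat.size 1 = 1 := Nat.size_one
  have hsz : Nat.size I.n ≤ Γ.b := hn ▸ size_le_of_le_pow Γ.hn
  rcases Nat.eq_zero_or_pos I.n with h0 | h0
  -- For `n = 0` the empty subfamily is optimal, and the input region would be too short for the
  -- output. Cell `1` is cleared because it holds `m`; the other output cells are blank already.
  · have h1 := Exec.cond_false (.load (.const 0)) (.seq (bodyProg P t Γ.TE) (finishProg Γ.TE)) _
      I.input _ (by simpa [Expr.eval, SetSystem.input] using h0)
      (Exec.seq (.store (.const 1) (.const 0)) _ I.input _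
        (fun s => PMF.pure (Function.update s 0 1, 4)) (Exec.store _ _ _)
        fun p _ => by
          have := Exec.store (.const 0) (.const 1) p.1
          simpa [Expr.eval, Expr.cost, hs1] using this)
    simp only [PMF.pure_bind, PMF.pure_map, Expr.eval, Expr.cost, hs1, Nat.size_zero] at h1
    refine ⟨_, h1, fun p hp => ?_, ?_⟩
    · rw [PMF.mem_support_pure_iff] at hp
      subst hp
      have : Nat.size (I.input 0) ≤ Γ.b := hsz
      simp only
      omega
    · rw [ev_pure, ind_false]
      · exact zero_le
      · rw [not_not]
        have hempty : I.IsSubCover ∅ := by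
          rw [SetSystem.IsSubCover]
          ext v
          exact absurd v.2 (by omega)
        refine ⟨fun _ => ⟨by simp, ∅, ⟨hempty, fun B _ => by simp⟩, fun i => ?_⟩,
          fun h => absurd ⟨_, hempty⟩ h⟩
        simp only [Finset.notMem_empty, if_false]
        rcases Nat.eq_zero_or_pos i with hi | hi
        · rw [hi]; simp
        · rw [Function.update_of_ne (by omega), Function.update_of_ne (by omega)]
          exact I.input_eq_zero (by rw [h0]; omega)
  · have hwf := SetSystem.wf_input hn hm (by have := hA.width; omega)
    set f : ℕ → ℕ → ℕ := fun i j => I.input (2 + (i * Γ.n + j)) with hf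
    set S : ℕ → ℕ := fun i => if i < Γ.m then ofDigits (f i) Γ.n else 0 with hS
    have hf1 : ∀ i j, f i j ≤ 1 := fun i j => I.input_le_one _
    have hSI : ∀ (i : Fin I.m) (v : Fin I.n), (S i).testBit v = true ↔ v ∈ I.S i := by
      intro i v
      have h1 := I.input_add_two i v
      have h2 := testBit_ofDigits (hf1 i) Γ.n v
      simp only [hS, hm, i.2, if_true]
      rw [h2]
      simp only [hf, hn, v.2, true_and, h1]
      simp
    obtain ⟨μ, h1, h2, h3⟩ := bodyProg_spec (v := Γ.segs I.input) (S := S) hA hG hr hf1 hP hamp hT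
      (by omega) (fun i hi j hj => by
        have h1 := Nat.mul_le_mul_right Γ.n (show i + 1 ≤ Γ.m from hi)
        rw [Nat.add_mul, mul_comm Γ.m] at h1
        simp only [Layout.segs, if_true]
        rw [if_pos (by rw [Layout.R]; omega)]) (SetSystem.segs_input hn hm) (fun i => rfl)
      I.input hwf rfl
    have key : ∀ s : Mem, ∃ s' k, Γ.WF s → Exec (finishProg Γ.TE) s (PMF.pure (s', k)) ∧
        k ≤ 20 * Γ.w ∧ (∀ a, 2 ≤ a → s' a = s a) ∧
        (Γ.segs s 0 rOpt ≤ Γ.m → s' 0 = 1 ∧ s' 1 = if Γ.segs s 1 0 ≠ 0 then 1 else 0) ∧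
        (¬ Γ.segs s 0 rOpt ≤ Γ.m → s' 0 = 0) := by
      intro s
      by_cases h : Γ.WF s
      · obtain ⟨s', k, h4⟩ := finish_exec h
        exact ⟨s', k, fun _ => h4⟩
      · exact ⟨s, 0, fun h' => absurd h' h⟩
    choose s' k hk using key
    have h4 := Exec.cond_true (.load (.const 0)) _
      (.seq (.store (.const 1) (.const 0)) (.store (.const 0) (.const 1))) I.input _
      (by simpa [Expr.eval, SetSystem.input] using h0.ne')
      (Exec.seq _ _ I.input μ (fun s => PMF.pure (s' s, k s)) h1
        fun p hp => (hk p.1 (h2 p hp).2.1).1)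
    refine ⟨_, h4, ?_, ?_⟩
    · intro q hq
      rw [PMF.mem_support_map_iff] at hq
      obtain ⟨q', hq', rfl⟩ := hq
      rw [PMF.mem_support_bind_iff] at hq'
      obtain ⟨p, hp, hq'⟩ := hq'
      rw [PMF.pure_map, PMF.mem_support_pure_iff] at hq'
      subst hq'
      have h5 := (h2 p hp).1
      have h6 := (hk p.1 (h2 p hp).2.1).2.1
      have : Nat.size (I.input 0) ≤ Γ.b := hsz
      simp only [Expr.cost, Expr.eval, Nat.size_zero]
      omega
    · rw [ev_map, ev_bind]
      simp only [PMF.pure_map, ev_pure]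
      refine le_trans (ev_mono fun p hp => ?_) h3
      obtain ⟨-, g2, g3, g4⟩ := h2 p hp
      obtain ⟨-, -, k1, k2, k3⟩ := hk p.1 g2
      by_cases hgood : GoodDeletion S Γ.m Γ.n (Γ.segs p.1 0 rOpt) (Γ.segs p.1 1) Γ.m
      · rw [ind_false]
        · exact zero_le
        · rw [not_not]
          obtain ⟨q1, q2⟩ := hgood
          rw [hm, hn] at q1 q2
          rw [hm] at k2 k3
          have q3 := SetSystem.exists_isSubCover_iff hSI q1
          refine ⟨fun h => ?_, fun h => k3 fun h' => h (q3.2 h')⟩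
          have hle := q3.1 h
          obtain ⟨q4, q5⟩ := q2 hle
          refine ⟨(k2 hle).1, _, SetSystem.isMinSubCover_of_needed hSI hle q1 q4 g3 q5, fun i => ?_⟩
          simp only [Finset.mem_filter, Finset.mem_univ, true_and]
          rcases Nat.eq_zero_or_pos i with hi | hi
          · rw [hi]; exact (k2 hle).2
          · rw [k1 _ (by omega), ← g4 i hi (by rw [hm]; exact i.2)]
            have h1 := Nat.le_mul_of_pos_left I.m h0
            have h2 := i.2
            simp only [Layout.segs, if_true]
            rw [if_pos (by rw [Layout.R, hn, hm]; omega)]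
      · exact (ind_le_one _).trans (ind_true hgood).ge

/-! ## The layout -/

/-- The powers of the number of sets plus one. -/
def powExpr : ℕ → Expr
  | 0 => .const 1
  | k + 1 => .op .mul (powExpr k) (.op .add (.load (.const 1)) (.const 1))

lemma powExpr_eval (k : ℕ) (s : Mem) : (powExpr k).eval s = (s 1 + 1) ^ k := by
  induction k with
  | zero => rfl
  | succ k ih => simp [powExpr, Expr.eval, BinOp.eval, ih, pow_succ]

lemma powExpr_loadsLe (k : ℕ) {s : Mem} {b : ℕ} (h : Nat.size (s 1) ≤ b) :
    (powExpr k).LoadsLe s b := by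
  induction k with
  | zero => trivial
  | succ k ih => exact ⟨ih, ⟨trivial, h⟩, trivial⟩

/-- The number of segments, as an expression. -/
def segmentsExpr (t : ℕ) : Expr :=
  .op .add (.const 9) (.op .mul (.const 48) (powExpr (4 * t + 2)))

/-- The number of segments. -/
def segments (t m : ℕ) : ℕ := 9 + 48 * (m + 1) ^ (4 * t + 2)

/-- A bound on the lengths of numbers. -/
def bits (t n m : ℕ) : ℕ := 2 * n + 2 * t + t * (m + 1) + segments t m + 4

/-- The time unit. -/
def unitTime (t n m : ℕ) : ℕ := 2 * (100 * ((segmentsExpr t).wt + 20)) ^ 2 * (bits t n m + 1) + 1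

lemma lt_segments (t m : ℕ) : m < segments t m := by
  have : (m + 1) ^ 1 ≤ (m + 1) ^ (4 * t + 2) := Nat.pow_le_pow_right (by omega) (by omega)
  rw [pow_one] at this
  unfold segments
  omega

/-- The layout for the instances with `n` elements and `m` sets. -/
def coverLayout (t n m : ℕ) : Layout where
  n := n
  m := m
  T := segments t m
  b := bits t n m
  w := unitTime t n m
  TE := segmentsExpr t
  hT := by unfold segments; have : 0 < (m + 1) ^ (4 * t + 2) := by positivity
           omega
  hn := lt_of_le_of_lt (by unfold bits; omega) Nat.lt_two_pow_self
  hm := lt_of_le_of_lt (by have := lt_segments t m; unfold bits; omega) Nat.lt_two_pow_self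
  eval_TE s _ h := by
    simp [segmentsExpr, Expr.eval, BinOp.eval, powExpr_eval, h, segments]
  loads_TE s _ h := ⟨trivial, trivial, powExpr_loadsLe _ (by
    rw [h]
    have := lt_segments t m
    exact (size_le_self m).trans (by unfold bits; omega))⟩
  hw := le_rfl

/-- The number of guesses. -/
def guesses (t m : ℕ) : ℕ := (m + 1) ^ (t + t)

/-- The number of repetitions. -/
def repetitions (t m : ℕ) : ℕ := 48 * (guesses t m * (m + 1))

/-- There are `m + 1` computations of an optimum, each with all guesses, each with all repetitions;
every single run needs its own segment. -/
lemma calls_le_segments (t m : ℕ) :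
    8 + (m + 1) * (guesses t m * repetitions t m) ≤ segments t m := by
  have : (m + 1) * (guesses t m * repetitions t m) = 48 * (m + 1) ^ (4 * t + 2) := by
    unfold repetitions guesses
    ring
  rw [this]
  unfold segments
  omega

lemma ample_coverLayout {t : ℕ} (ht : 0 < t) (n m : ℕ) :
    Ample (coverLayout t n m) t (guesses t m) (repetitions t m) := by
  have hseg := lt_segments t m
  have hcalls := calls_le_segments t m
  have hg : 1 ≤ guesses t m := Nat.pos_of_ne_zero (by unfold guesses; positivity)
  have hb : bits t n m = 2 * n + 2 * t + t * (m + 1) + segments t m + 4 := rfl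
  have hlt : ∀ x ≤ bits t n m, x < 2 ^ (coverLayout t n m).b := fun x hx =>
    Layout.lt_pow_of_le (Γ := coverLayout t n m) hx
  have hr1 : repetitions t m ≤ guesses t m * repetitions t m := Nat.le_mul_of_pos_left _ hg
  have hr2 : guesses t m * repetitions t m ≤ (m + 1) * (guesses t m * repetitions t m) :=
    Nat.le_mul_of_pos_left _ (by omega)
  have hr3 : guesses t m ≤ repetitions t m := by
    have := Nat.le_mul_of_pos_right (guesses t m) (show 0 < m + 1 by omega)
    unfold repetitions
    omega
  refine ⟨ht, ?_, ?_, hlt _ (by show segments t m ≤ _; omega), hlt _ (by omega), hlt _ (by omega),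
    ?_, ?_, ?_⟩
  · show 2 + 2 ^ n * t * (n + t) < 2 ^ bits t n m
    -- A crude bound suffices: the number of bits has to be polynomial, not tight.
    have h1 : 2 ^ n * t * (n + t) ≤ 2 ^ n * 2 ^ t * 2 ^ (n + t) :=
      Nat.mul_le_mul (Nat.mul_le_mul_left _ Nat.lt_two_pow_self.le) Nat.lt_two_pow_self.le
    have h2 : 2 ^ n * 2 ^ t * 2 ^ (n + t) = 2 ^ (2 * n + 2 * t) := by
      rw [← pow_add, ← pow_add]; congr 1; ring
    have h3 : 2 ^ (2 * n + 2 * t + 2) ≤ 2 ^ bits t n m :=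
      Nat.pow_le_pow_right (by norm_num) (by omega)
    have h4 : 1 ≤ 2 ^ (2 * n + 2 * t) := Nat.one_le_two_pow
    rw [pow_add] at h3
    omega
  · show n + t < bits t n m
    omega
  · show t + t ≤ bits t n m
    omega
  · show t * (m + 1) ≤ bits t n m
    omega
  · show m + 1 ≤ bits t n m
    omega

/-! ## Error probabilities -/

/-- The potential is `0` as long as no error has occurred, which is always the case, and `1`
afterwards. -/
lemma amplifies_zero {r : ℕ} (hr : 0 < r) : Amplifies 0 0 r := by
  refine ⟨fun w => if w = 0 then 0 else 1, fun _ => 1, 1, fun w => ?_, fun w => ?_, fun w hw => ?_,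
    ?_⟩
  · simp
  · simp
  · have : w ≠ 0 := by omega
    simp [this]
  · simp

/-- The exponential moment method: each error doubles the potential, so a trial multiplies its
expectation by at most `1 + 1 / 3`. It is normalized to be `1` at `24 * K` errors, half of the
trials. -/
lemma amplifies_third {K : ℕ} (hK : 0 < K) :
    Amplifies (ENNReal.ofReal (1 / 3)) (ENNReal.ofReal (1 / (3 * K))) (48 * K) := by
  have hK' : (0 : ℝ) < K := by exact_mod_cast hK
  have hφ : ∀ w : ℕ, (0 : ℝ) ≤ 2 ^ w / 2 ^ (24 * K) := fun w => by positivity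
  refine ⟨fun w => ENNReal.ofReal (2 ^ w / 2 ^ (24 * K)),
    fun w => ENNReal.ofReal (2 ^ w / 2 ^ (24 * K)), ENNReal.ofReal (4 / 3), fun w => ?_, fun w => ?_,
    fun w hw => ?_, ?_⟩
  · rw [← ENNReal.ofReal_add (hφ w) (hφ w)]
    exact ENNReal.ofReal_le_ofReal (by rw [pow_succ]; exact le_of_eq (by ring))
  · rw [← ENNReal.ofReal_mul (hφ w), ← ENNReal.ofReal_add (by positivity) (hφ w),
      ← ENNReal.ofReal_mul (by norm_num)]
    exact ENNReal.ofReal_le_ofReal (le_of_eq (by ring))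
  · rw [← ENNReal.ofReal_one]
    refine ENNReal.ofReal_le_ofReal ?_
    rw [le_div_iff₀ (by positivity), one_mul]
    exact pow_le_pow_right₀ (by norm_num) (by omega)
  · rw [← ENNReal.ofReal_pow (by norm_num), ← ENNReal.ofReal_mul (by positivity)]
    refine ENNReal.ofReal_le_ofReal ?_
    -- Since `(4 / 3) ^ 2 / 2 = 8 / 9`, the bound decays like `(8 / 9) ^ (24 * K)`; Bernoulli's
    -- inequality turns this into `1 / (3 * K)`, which explains the number `48`.
    have h1 : 1 + ((24 * K : ℕ) : ℝ) * (1 / 8) ≤ (1 + 1 / 8) ^ (24 * K) :=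
      one_add_mul_le_pow (by norm_num) _
    have h2 : 3 * (K : ℝ) ≤ (9 / 8 : ℝ) ^ (24 * K) := by
      have : (1 + 1 / 8 : ℝ) = 9 / 8 := by norm_num
      rw [this] at h1
      push_cast at h1
      linarith
    have h3 : (4 / 3 : ℝ) ^ (48 * K) * (2 ^ 0 / 2 ^ (24 * K)) = 1 / (9 / 8) ^ (24 * K) := by
      have e : 48 * K = 2 * (24 * K) := by ring
      rw [e, pow_mul, pow_zero, div_eq_mul_inv 1 ((2 : ℝ) ^ _), one_mul, one_div, ← inv_pow,
        ← inv_pow, ← mul_pow]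
      norm_num
    rw [h3]
    exact one_div_le_one_div_of_le (by positivity) h2

lemma ev_ind_not {α : Type*} (μ : PMF α) (p : α → Prop) :
    ev μ (fun a => ind (p a)) + ev μ (fun a => ind (¬ p a)) = 1 := by
  rw [← ev_add, ← ev_const μ 1]
  congr 1
  funext a
  by_cases h : p a
  · rw [ind_true h, ind_false (not_not.2 h), add_zero]
  · rw [ind_false h, ind_true h, zero_add]

lemma two_thirds_add : (2 / 3 : ℝ≥0∞) + ENNReal.ofReal (1 / 3) = 1 := by
  have : (2 / 3 : ℝ≥0∞) = ENNReal.ofReal (2 / 3) := by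
    rw [ENNReal.ofReal_div_of_pos (by norm_num)]
    norm_num
  rw [this, ← ENNReal.ofReal_add (by norm_num) (by norm_num)]
  norm_num

lemma two_thirds_le_iff {α : Type*} (μ : PMF α) (p : α → Prop) :
    2 / 3 ≤ μ.toOuterMeasure {a | p a} ↔
      ev μ (fun a => ind (¬ p a)) ≤ ENNReal.ofReal (1 / 3) := by
  rw [← ev_ind]
  have h1 := ev_ind_not μ p
  have h2 := two_thirds_add
  have hf : ∀ {x y : ℝ≥0∞}, x + y = 1 → x ≠ ∞ ∧ y ≠ ∞ := fun h =>
    ENNReal.add_ne_top.1 (h ▸ ENNReal.one_ne_top)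
  constructor
  · intro h
    by_contra! hlt
    have := ENNReal.add_lt_add_of_le_of_lt (hf h2).1 h hlt
    rw [h1, h2] at this
    exact lt_irrefl _ this
  · intro h
    by_contra! hlt
    have := ENNReal.add_lt_add_of_lt_of_le (hf h1).2 hlt h
    rw [h1, h2] at this
    exact lt_irrefl _ this

lemma ev_ind_not_eq_zero_iff {α : Type*} (μ : PMF α) (p : α → Prop) :
    ev μ (fun a => ind (¬ p a)) = 0 ↔ ∀ a ∈ μ.support, p a := by
  unfold ev
  rw [ENNReal.tsum_eq_zero]
  refine forall_congr' fun a => ?_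
  rw [PMF.mem_support_iff]
  by_cases h : p a
  · simp only [ind_false (not_not.2 h)]
    simp [h]
  · simp only [ind_true h]
    simp [h]

/-! ## Determinism -/

lemma chunksProg_deterministic (TE : Expr) (t : ℕ) : (chunksProg TE t).Deterministic := by
  induction t with
  | zero => trivial
  | succ t ih => exact ⟨ih, trivial⟩

lemma setCoverProg_deterministic {P : Prog} (h : P.Deterministic) (t : ℕ) (TE : Expr) :
    (setCoverProg P t TE).Deterministic := by
  have hP := h.reloc TE ((reg 7).comp TE)
  simp only [setCoverProg, bodyProg, prepProg, constProg, guessesProg, powProg, maskProg, listProg,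
    optProg, guessProg, digitProg, unionProg, tableProg, repProg, callProg, buildProg, emitProg,
    tallyProg, decideProg, deleteProg, outputProg, finishProg, forProg, setReg, setProg, readProg,
    writeProg, Prog.Deterministic, chunksProg_deterministic, hP, and_self]

/-! ## Time bounds -/

section

variable {ι : Type*} {Y Z f g : ι → ℕ}

/-- The function `f` is at most a polynomial in `Y`, times `Z`. -/
def PolyLe (Y Z f : ι → ℕ) : Prop := ∃ c k, ∀ i, f i ≤ c * Y i ^ k * Z i

lemma PolyLe.mono (hf : PolyLe Y Z f) (h : ∀ i, g i ≤ f i) : PolyLe Y Z g := by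
  obtain ⟨c, k, hc⟩ := hf
  exact ⟨c, k, fun i => (h i).trans (hc i)⟩

lemma PolyLe.const (hZ : ∀ i, 0 < Z i) (a : ℕ) : PolyLe Y Z fun _ => a :=
  ⟨a, 0, fun i => by simpa using Nat.le_mul_of_pos_right a (hZ i)⟩

lemma PolyLe.add (hY : ∀ i, 0 < Y i) (hf : PolyLe Y Z f) (hg : PolyLe Y Z g) :
    PolyLe Y Z fun i => f i + g i := by
  obtain ⟨c, k, hc⟩ := hf
  obtain ⟨d, l, hd⟩ := hg
  refine ⟨c + d, k + l, fun i => ?_⟩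
  have h1 : Y i ^ k ≤ Y i ^ (k + l) := Nat.pow_le_pow_right (hY i) (by omega)
  have h2 : Y i ^ l ≤ Y i ^ (k + l) := Nat.pow_le_pow_right (hY i) (by omega)
  calc f i + g i ≤ c * Y i ^ k * Z i + d * Y i ^ l * Z i := add_le_add (hc i) (hd i)
    _ ≤ c * Y i ^ (k + l) * Z i + d * Y i ^ (k + l) * Z i := by gcongr
    _ = (c + d) * Y i ^ (k + l) * Z i := by ring

/-- Only one factor may carry `Z`: the exponential quantity enters all running times linearly. -/
lemma PolyLe.mul (hf : PolyLe Y (fun _ => 1) f) (hg : PolyLe Y Z g) :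
    PolyLe Y Z fun i => f i * g i := by
  obtain ⟨c, k, hc⟩ := hf
  obtain ⟨d, l, hd⟩ := hg
  refine ⟨c * d, k + l, fun i => ?_⟩
  calc f i * g i ≤ c * Y i ^ k * 1 * (d * Y i ^ l * Z i) := Nat.mul_le_mul (hc i) (hd i)
    _ = c * d * Y i ^ (k + l) * Z i := by ring

lemma PolyLe.mul' (hf : PolyLe Y Z f) (hg : PolyLe Y (fun _ => 1) g) :
    PolyLe Y Z fun i => f i * g i :=
  (hg.mul hf).mono fun _ => (mul_comm _ _).le

lemma PolyLe.pow (hf : PolyLe Y (fun _ => 1) f) (a : ℕ) :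
    PolyLe Y (fun _ => 1) fun i => f i ^ a := by
  obtain ⟨c, k, hc⟩ := hf
  refine ⟨c ^ a, k * a, fun i => ?_⟩
  calc f i ^ a ≤ (c * Y i ^ k * 1) ^ a := Nat.pow_le_pow_left (hc i) a
    _ = c ^ a * Y i ^ (k * a) * 1 := by ring

lemma PolyLe.weaken (hZ : ∀ i, 0 < Z i) (hf : PolyLe Y (fun _ => 1) f) : PolyLe Y Z f := by
  obtain ⟨c, k, hc⟩ := hf
  exact ⟨c, k, fun i => (hc i).trans (Nat.mul_le_mul_left _ (hZ i))⟩

variable {w n m t len N r call guess opt G tP : ι → ℕ} (hY : ∀ i, 0 < Y i) (hZ : ∀ i, 0 < Z i)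
  (hw : PolyLe Y (fun _ => 1) w)

include hY hZ hw

lemma PolyLe.buildTime (hlen : PolyLe Y Z len) (ht : PolyLe Y (fun _ => 1) t)
    (hN : PolyLe Y (fun _ => 1) N) :
    PolyLe Y Z fun i => buildTime (w i) (len i) (t i) (N i) := by
  have hw' := hw.weaken hZ
  have h1 : PolyLe Y (fun _ => 1) fun i => 2 * w i :=
    .mul (.const (fun _ => one_pos) 2) hw
  have h2 : PolyLe Y (fun _ => 1) fun i => 2 * w i + N i * (2 * w i + (w i + w i)) :=
    .add hY h1 (.mul hN (.add hY h1 (.add hY hw hw)))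
  exact .add hY hw' (.add hY hw' (.add hY (.add hY (h1.weaken hZ) (.mul' hlen (.add hY h1
    (.add hY hw (.add hY h1 (.mul ht (.add hY h1 (.add hY hw (.add hY hw (.add hY h2 hw))))))))))
    (.add hY hw' hw')))

lemma PolyLe.callTime {D : ι → ℕ} (hlen : PolyLe Y Z len) (ht : PolyLe Y (fun _ => 1) t)
    (hN : PolyLe Y (fun _ => 1) N) (hD : PolyLe Y (fun _ => 1) D) (htP : PolyLe Y Z tP) :
    PolyLe Y Z fun i => callTime (w i) (len i) (t i) (N i) (D i) (tP i) := by
  have hc := fun a => PolyLe.const (Y := Y) (Z := fun _ => 1) (fun _ => one_pos) a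
  have hw' := hw.weaken hZ
  exact .add hY (.buildTime hY hZ hw hlen ht hN) (.add hY (.add hY
    (.mul (.mul (.mul (hc 20) hw) hD) htP)
    (.add hY (.mul (hc 6) hw') (.add hY (hN.weaken hZ) htP))) hw')

lemma PolyLe.guessTime (hlen : PolyLe Y Z len) (ht : PolyLe Y (fun _ => 1) t)
    (hm : PolyLe Y (fun _ => 1) m) (hr : PolyLe Y (fun _ => 1) r) (hcall : PolyLe Y Z call) :
    PolyLe Y Z fun i => guessTime (w i) (len i) (t i) (m i) (r i) (call i) := by
  have hw' := hw.weaken hZ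
  have h1 : PolyLe Y (fun _ => 1) fun i => 2 * w i :=
    .mul (.const (fun _ => one_pos) 2) hw
  have h2 : PolyLe Y (fun _ => 1) fun i => 2 * w i + (w i + w i) := .add hY h1 (.add hY hw hw)
  exact .add hY (PolyLe.weaken hZ (.add hY hw (.add hY h1 (.mul (.add hY ht ht) h2))))
    (.add hY (PolyLe.weaken hZ (.add hY hw (.add hY hw (.add hY h1 (.mul ht h2)))))
    (.add hY (.add hY (h1.weaken hZ) (.mul' hlen (.add hY h1 (.add hY hw (.add hY hw
      (.add hY (.add hY h1 (.mul hm h2)) hw))))))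
    (.add hY (.add hY hw' (.add hY (h1.weaken hZ) (.mul hr (.add hY (h1.weaken hZ) hcall))))
      (.add hY hw' hw'))))

lemma PolyLe.optTime (hG : PolyLe Y (fun _ => 1) G) (hguess : PolyLe Y Z guess) :
    PolyLe Y Z fun i => optTime (w i) (G i) (guess i) := by
  have hw' := hw.weaken hZ
  have h1 : PolyLe Y Z fun i => 2 * w i :=
    .mul (.const (fun _ => one_pos) 2) hw'
  exact .add hY hw' (.add hY h1 (.mul hG (.add hY h1 hguess)))

lemma PolyLe.prepTime (hn : PolyLe Y (fun _ => 1) n) (hm : PolyLe Y (fun _ => 1) m)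
    (ht : PolyLe Y (fun _ => 1) t) (hlen : PolyLe Y Z len) :
    PolyLe Y Z fun i => prepTime (w i) (n i) (m i) (t i) (len i) := by
  have hc := fun a => PolyLe.const (Y := Y) (Z := fun _ => 1) (fun _ => one_pos) a
  have hw' := hw.weaken hZ
  have h1 : PolyLe Y (fun _ => 1) fun i => 2 * w i := .mul (hc 2) hw
  have h1' := h1.weaken hZ
  have h2 : PolyLe Y (fun _ => 1) fun i => 2 * w i + w i := .add hY h1 hw
  exact .add hY (PolyLe.weaken hZ (.add hY (.mul (.add hY ht (hc 1)) hw) (.add hY hw (.add hY hw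
      (.add hY (.add hY hw (.add hY h1 (.mul (.add hY ht ht) h2))) (.add hY hw hw))))))
    (.add hY (PolyLe.weaken hZ (.add hY hw (.add hY h1 (.mul (.add hY hn ht) h2))))
    (.add hY (PolyLe.weaken hZ (.add hY h1 (.mul hm (.add hY h1 (.add hY h1
      (.mul hn (.add hY h1 (.add hY hw hw))))))))
    (.add hY hw' (.add hY hw' (.add hY hw' (.add hY h1' (.mul hn (.add hY h1' (.add hY hw'
      (.add hY h1' (.mul' hlen (.add hY h1 (.add hY hw (.add hY hw (.add hY hw hw)))))))))))))))

lemma PolyLe.bodyTime (hn : PolyLe Y (fun _ => 1) n) (hm : PolyLe Y (fun _ => 1) m)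
    (ht : PolyLe Y (fun _ => 1) t) (hlen : PolyLe Y Z len) (hopt : PolyLe Y Z opt) :
    PolyLe Y Z fun i => bodyTime (w i) (n i) (m i) (t i) (len i) (opt i) := by
  have hw' := hw.weaken hZ
  have h1 : PolyLe Y Z fun i => 2 * w i := .mul (.const (fun _ => one_pos) 2) hw'
  have hm1 : PolyLe Y (fun _ => 1) fun i => m i - 1 := hm.mono fun i => Nat.sub_le _ _
  exact .add hY (.prepTime hY hZ hw hn hm ht hlen) (.add hY (.add hY hopt hw')
    (.add hY (.add hY h1 (.mul hm (.add hY h1 (.add hY hw' (.add hY hw' (.add hY hopt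
      (.add hY hw' hw')))))))
    (.add hY h1 (.mul hm1 (.add hY h1 hw')))))

end

/-- The time of the program for Set Cover. -/
def coverTime (t D n m len tP : ℕ) : ℕ :=
  bodyTime (unitTime t n m) n m t len (optTime (unitTime t n m) (guesses t m)
    (guessTime (unitTime t n m) len t m (repetitions t m)
      (callTime (unitTime t n m) len t (n + t) D tP))) + 40 * unitTime t n m

/-- For fixed `t` everything is polynomial in `n + m + 1`, except for the number of small subsets
and the time of the solver, and these are never multiplied with each other. -/
lemma exists_coverTime_le (t D : ℕ) : ∃ c k, ∀ n m len tP : ℕ,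
    coverTime t D n m len tP ≤ c * (n + m + 1) ^ k * (len + tP + 1) := by
  let ι := ℕ × ℕ × ℕ × ℕ
  let Y : ι → ℕ := fun i => i.1 + i.2.1 + 1
  let Z : ι → ℕ := fun i => i.2.2.1 + i.2.2.2 + 1
  have hY : ∀ i, 0 < Y i := fun i => Nat.succ_pos _
  have hZ : ∀ i, 0 < Z i := fun i => Nat.succ_pos _
  have hc := fun a => PolyLe.const (Y := Y) (Z := fun _ => 1) (fun _ => one_pos) a
  have hn : PolyLe Y (fun _ => 1) fun i => i.1 := ⟨1, 1, fun i => by simp [Y]; omega⟩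
  have hm : PolyLe Y (fun _ => 1) fun i => i.2.1 := ⟨1, 1, fun i => by simp [Y]; omega⟩
  have hlen : PolyLe Y Z fun i => i.2.2.1 := ⟨1, 0, fun i => by simp [Z]; omega⟩
  have htP : PolyLe Y Z fun i => i.2.2.2 := ⟨1, 0, fun i => by simp [Z]; omega⟩
  have hm1 : PolyLe Y (fun _ => 1) fun i => i.2.1 + 1 := .add hY hm (hc 1)
  have hseg : PolyLe Y (fun _ => 1) fun i => segments t i.2.1 :=
    .add hY (hc 9) (.mul (hc 48) (hm1.pow _))
  have hbits : PolyLe Y (fun _ => 1) fun i => bits t i.1 i.2.1 :=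
    .add hY (.add hY (.add hY (.add hY (.mul (hc 2) hn) (hc (2 * t))) (.mul (hc t) hm1)) hseg) (hc 4)
  have hw : PolyLe Y (fun _ => 1) fun i => unitTime t i.1 i.2.1 :=
    .add hY (.mul (hc _) (.add hY hbits (hc 1))) (hc 1)
  have hG : PolyLe Y (fun _ => 1) fun i => guesses t i.2.1 := hm1.pow _
  have hr : PolyLe Y (fun _ => 1) fun i => repetitions t i.2.1 :=
    .mul (hc 48) (.mul hG hm1)
  obtain ⟨c, k, h⟩ : PolyLe Y Z fun i => coverTime t D i.1 i.2.1 i.2.2.1 i.2.2.2 :=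
    .add hY (.bodyTime hY hZ hw hn hm (hc t) hlen (.optTime hY hZ hw hG
      (.guessTime hY hZ hw hlen (hc t) hm hr (.callTime hY hZ hw hlen (hc t)
        (.add hY hn (hc t)) (hc D) htP)))) (PolyLe.weaken hZ (.mul (hc 40) hw))
  exact ⟨c, k, fun n m len tP => h (n, m, len, tP)⟩

/-! ## The reduction -/

lemma one_le_length_smallList (h n : ℕ) : 1 ≤ (smallList h n).length := by
  rw [smallList, List.length_map]
  exact length_smallSubsets_mono h (Nat.zero_le n)

/-- For a suitable number of chunks, there are few small subsets. -/
lemma exists_length_smallList_le (c : ℕ) {B : ℝ} (hB : 1 < B) :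
    ∃ t > 0, ∃ D > 0, ∀ n, ((smallList (n / t + 1) n).length : ℝ) ^ (c + 1) ≤ D * B ^ (2 * n) := by
  set q : ℝ := B ^ ((c + 1 : ℕ) : ℝ)⁻¹ with hq
  have hq1 : 1 < q := Real.one_lt_rpow hB (by positivity)
  have hqB : q ^ (c + 1) = B := Real.rpow_inv_natCast_pow (by linarith) (by omega)
  -- Chosen such that `(1 + x) ^ (c + 1) ≤ B` and such that the generating function bound, which
  -- needs `x ≤ 1`, applies.
  set x : ℝ := min 1 (q - 1) with hx
  have hx0 : 0 < x := lt_min one_pos (by linarith)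
  have hx1 : x ≤ 1 := min_le_left _ _
  have hxB : (1 + x) ^ (c + 1) ≤ B := by
    rw [← hqB]
    have : x ≤ q - 1 := min_le_right _ _
    exact pow_le_pow_left₀ (by linarith) (by linarith) _
  set D : ℝ := (1 / x) ^ (c + 1) with hD
  have hD0 : 0 < D := by positivity
  -- The other factor of the bound is `D` to the power of the chunk length; with enough chunks it is
  -- at most a constant times `B ^ n`.
  obtain ⟨t, ht⟩ := pow_unbounded_of_one_lt D hB
  have ht' : D ≤ B ^ (t + 1) := ht.le.trans (pow_le_pow_right₀ hB.le (by omega))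
  refine ⟨t + 1, by omega, D, hD0, fun n => ?_⟩
  have h1 := length_smallSubsets_le_real (n / (t + 1) + 1) n hx0 hx1
  set len : ℝ := ((smallList (n / (t + 1) + 1) n).length : ℝ) with hlen
  have hlen' : len = ((smallSubsets (n / (t + 1) + 1) n).length : ℝ) := by
    rw [hlen, smallList, List.length_map]
  have hle : len ≤ (1 / x) ^ (n / (t + 1) + 1) * (1 + x) ^ n := by
    rw [hlen', one_div, inv_pow, inv_mul_eq_div, le_div_iff₀ (by positivity)]
    exact h1
  calc len ^ (c + 1) ≤ ((1 / x) ^ (n / (t + 1) + 1) * (1 + x) ^ n) ^ (c + 1) :=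
        pow_le_pow_left₀ (Nat.cast_nonneg _) hle _
    _ = D * D ^ (n / (t + 1)) * ((1 + x) ^ (c + 1)) ^ n := by
        rw [hD, mul_pow, ← pow_mul, ← pow_mul, ← pow_mul, ← pow_mul, ← pow_add]
        congr 2 <;> ring
    _ ≤ D * (B ^ (t + 1)) ^ (n / (t + 1)) * B ^ n := by gcongr
    _ = D * (B ^ ((t + 1) * (n / (t + 1))) * B ^ n) := by rw [← pow_mul]; ring
    _ ≤ D * (B ^ n * B ^ n) := by
        gcongr
        · exact hB.le
        · exact Nat.mul_div_le n (t + 1)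
    _ = D * B ^ (2 * n) := by rw [← pow_add]; congr 2; ring

/-- The time for an instance with `N` elements and `M` sets, as a natural number. -/
noncomputable def solverTime (C c : ℕ) (γ : ℝ) (N M : ℕ) : ℕ :=
  ⌊(C : ℝ) * ((N : ℝ) + M + 1) ^ c * (2 : ℝ) ^ ((1 - γ) * (N : ℝ))⌋₊

/-- The solver's time is polynomial of degree `c` in the size of the instance, which is essentially
the number of small subsets. Keeping the power `c + 1` of this number below a constant times `2 ^ (γ
n / 2)`, for `γ ≤ 1`, spends half of the gain; the exponent `c + 1` instead of `c` also covers the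
time for writing the list when `c = 0`. -/
lemma exists_sum_le {γ : ℝ} (hγ : 0 < γ) (C c : ℕ) : ∃ t > 0, ∃ K : ℝ, 0 < K ∧ ∀ n : ℕ,
    (((smallList (n / t + 1) n).length + solverTime C c γ (n + t)
      ((smallList (n / t + 1) n).length * t) + 1 : ℕ) : ℝ) ≤
      K * ((n : ℝ) + 1) ^ c * (2 : ℝ) ^ ((1 - min γ 1 / 2) * (n : ℝ)) := by
  -- Replacing `γ` by at most `1` makes `2 ^ ((1 - γ') n)` at least `1`, so that the lower order
  -- terms can be absorbed.
  set γ' := min γ 1 with hγ'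
  have h0 : 0 < γ' := lt_min hγ one_pos
  have h1 : γ' ≤ 1 := min_le_right _ _
  have hle : γ' ≤ γ := min_le_left _ _
  set B : ℝ := (2 : ℝ) ^ (γ' / 4) with hB
  have hB1 : 1 < B := Real.one_lt_rpow (by norm_num) (by positivity)
  obtain ⟨t, ht, D, hD, hlen⟩ := exists_length_smallList_le c hB1
  -- `2 * D` pays for the summands `len` and `1`. The factor `2 ^ t` is the price of the `t`
  -- additional elements in the exponent, and `(2 * t + 1) ^ c` is their price in the polynomial
  -- factor.
  refine ⟨t, ht, 2 * D + C * (2 * t + 1) ^ c * 2 ^ t * D, by positivity, fun n => ?_⟩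
  set len := (smallList (n / t + 1) n).length with hlen_def
  have hl1 : (1 : ℝ) ≤ len := by exact_mod_cast one_le_length_smallList _ _
  set E : ℝ := (2 : ℝ) ^ ((1 - γ' / 2) * (n : ℝ)) with hE
  set E₁ : ℝ := (2 : ℝ) ^ ((1 - γ') * (n : ℝ)) with hE₁
  have hE₁1 : 1 ≤ E₁ := Real.one_le_rpow (by norm_num) (mul_nonneg (by linarith) (Nat.cast_nonneg n))
  have hBE : E₁ * B ^ (2 * n) = E := by
    rw [hB, ← Real.rpow_natCast, ← Real.rpow_mul (by norm_num), hE₁, ← Real.rpow_add (by norm_num)]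
    congr 1
    push_cast
    ring
  have hlenc : (len : ℝ) ^ (c + 1) ≤ D * B ^ (2 * n) := hlen n
  have hBE' : D * B ^ (2 * n) ≤ D * E := by
    rw [← hBE]
    gcongr
    exact le_mul_of_one_le_left (by positivity) hE₁1
  have hA : (len : ℝ) ≤ D * E := (le_self_pow₀ hl1 (by omega)).trans (hlenc.trans hBE')
  have hn1 : (1 : ℝ) ≤ ((n : ℝ) + 1) ^ c := one_le_pow₀ (by linarith [Nat.cast_nonneg (α := ℝ) n])
  have hpow : (2 : ℝ) ^ ((1 - γ) * ((n + t : ℕ) : ℝ)) ≤ 2 ^ t * E₁ := by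
    rw [← Real.rpow_natCast 2 t, hE₁, ← Real.rpow_add (by norm_num)]
    refine Real.rpow_le_rpow_of_exponent_le (by norm_num) ?_
    push_cast
    nlinarith [Nat.cast_nonneg (α := ℝ) n, Nat.cast_nonneg (α := ℝ) t]
  have hbase : ((n + t : ℕ) : ℝ) + ((len * t : ℕ) : ℝ) + 1 ≤ ((n : ℝ) + 1) * (2 * t + 1) * len := by
    push_cast
    nlinarith [Nat.cast_nonneg (α := ℝ) n, Nat.cast_nonneg (α := ℝ) t,
      mul_nonneg (Nat.cast_nonneg (α := ℝ) n) (Nat.cast_nonneg (α := ℝ) t),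
      mul_nonneg (Nat.cast_nonneg (α := ℝ) n) (sub_nonneg.2 hl1),
      mul_nonneg (Nat.cast_nonneg (α := ℝ) t) (sub_nonneg.2 hl1),
      mul_nonneg (mul_nonneg (Nat.cast_nonneg (α := ℝ) n) (Nat.cast_nonneg (α := ℝ) t))
        (sub_nonneg.2 hl1)]
  have hT : (solverTime C c γ (n + t) (len * t) : ℝ) ≤
      C * (2 * t + 1) ^ c * 2 ^ t * D * ((n : ℝ) + 1) ^ c * E := by
    calc (solverTime C c γ (n + t) (len * t) : ℝ)
        ≤ C * (((n + t : ℕ) : ℝ) + ((len * t : ℕ) : ℝ) + 1) ^ c *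
          (2 : ℝ) ^ ((1 - γ) * ((n + t : ℕ) : ℝ)) := Nat.floor_le (by positivity)
      _ ≤ C * (((n : ℝ) + 1) * (2 * t + 1) * len) ^ c * (2 ^ t * E₁) := by gcongr
      _ = C * (2 * t + 1) ^ c * 2 ^ t * ((n : ℝ) + 1) ^ c * E₁ * (len : ℝ) ^ c := by
        rw [mul_pow, mul_pow]; ring
      _ ≤ C * (2 * t + 1) ^ c * 2 ^ t * ((n : ℝ) + 1) ^ c * E₁ * (D * B ^ (2 * n)) := by
        gcongr
        exact (pow_le_pow_right₀ hl1 (by omega)).trans hlenc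
      _ = C * (2 * t + 1) ^ c * 2 ^ t * D * ((n : ℝ) + 1) ^ c * E := by rw [← hBE]; ring
  have hDE : D * E ≤ D * E * ((n : ℝ) + 1) ^ c := le_mul_of_one_le_right (by positivity) hn1
  push_cast
  calc (len : ℝ) + solverTime C c γ (n + t) (len * t) + 1
      ≤ D * E * ((n : ℝ) + 1) ^ c + C * (2 * t + 1) ^ c * 2 ^ t * D * ((n : ℝ) + 1) ^ c * E +
        D * E * ((n : ℝ) + 1) ^ c := by linarith
    _ = _ := by ring

/-- If Exact Cover can be solved in time `O*(2^((1 - γ) n))` with error probability `e`, where `e`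
can be amplified, then Set Cover can be solved in time `O*(2^((1 - δ) n))` with error probability
`e` for some `δ > 0`. -/
theorem exists_setCoverProg {γ : ℝ} (hγ : 0 < γ) {P : Prog} {C c : ℕ} {e : ℝ≥0∞}
    (hP : ∀ I : SetSystem, ∃ μ, Exec P I.input μ ∧ (∀ p ∈ μ.support,
      (p.2 : ℝ) ≤ C * ((I.n : ℝ) + I.m + 1) ^ c * (2 : ℝ) ^ ((1 - γ) * (I.n : ℝ))) ∧
      ev μ (fun p => ind (¬ ExactCover I p.1)) ≤ e)
    (hamp : ∀ K : ℕ, 0 < K → ∃ η, Amplifies e η (48 * K) ∧ K * η ≤ e) :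
    ∃ δ : ℝ, 0 < δ ∧ ∃ (Q : Prog) (C' c' : ℕ), (P.Deterministic → Q.Deterministic) ∧
      ∀ I : SetSystem, ∃ μ, Exec Q I.input μ ∧ (∀ p ∈ μ.support,
        (p.2 : ℝ) ≤ C' * ((I.n : ℝ) + I.m + 1) ^ c' * (2 : ℝ) ^ ((1 - δ) * (I.n : ℝ))) ∧
        ev μ (fun p => ind (¬ SetCover I p.1)) ≤ e := by
  obtain ⟨t, ht, K, hK, hsum⟩ := exists_sum_le hγ C c
  obtain ⟨C₁, k₁, htime⟩ := exists_coverTime_le t P.nodes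
  refine ⟨min γ 1 / 2, by have : 0 < min γ 1 := lt_min hγ one_pos
                          positivity, setCoverProg P t (segmentsExpr t), ⌈C₁ * K⌉₊, k₁ + c,
    fun h => setCoverProg_deterministic h t _, fun I => ?_⟩
  have hg : 0 < guesses t I.m := by unfold guesses; positivity
  -- The number of majority votes over the whole computation, for the union bound.
  obtain ⟨η, hη, hηe⟩ := hamp (guesses t I.m * (I.m + 1)) (by positivity)
  set len := (smallList (I.n / t + 1) I.n).length with hlen
  have hdec : Decides P (I.n + t) (len * t) (solverTime C c γ (I.n + t) (len * t)) e := by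
    intro I' hn' hm'
    obtain ⟨μ, h1, h2, h3⟩ := hP I'
    -- Running times are natural numbers, so rounding the bound down loses nothing; the bound is
    -- monotone in the number of sets.
    refine ⟨μ, h1, fun p hp => Nat.le_floor ((h2 p hp).trans ?_), h3⟩
    rw [hn']
    gcongr
  obtain ⟨μ, h1, h2, h3⟩ := setCoverProg_spec (I := I) (Γ := coverLayout t I.n I.m) rfl rfl
    (ample_coverLayout ht I.n I.m) rfl rfl hdec hη (calls_le_segments t I.m)
  refine ⟨μ, h1, fun p hp => ?_, h3.trans ?_⟩
  · have h4 : p.2 ≤ coverTime t P.nodes I.n I.m len (solverTime C c γ (I.n + t) (len * t)) :=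
      h2 p hp
    have h5 := h4.trans (htime _ _ _ _)
    have h6 : (p.2 : ℝ) ≤ C₁ * ((I.n : ℝ) + I.m + 1) ^ k₁ *
        ((len + solverTime C c γ (I.n + t) (len * t) + 1 : ℕ) : ℝ) := by exact_mod_cast h5
    refine h6.trans ?_
    have h7 : ((I.n : ℝ) + 1) ^ c ≤ ((I.n : ℝ) + I.m + 1) ^ c :=
      pow_le_pow_left₀ (by positivity) (by linarith [Nat.cast_nonneg (α := ℝ) I.m]) _
    calc (C₁ : ℝ) * ((I.n : ℝ) + I.m + 1) ^ k₁ *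
          ((len + solverTime C c γ (I.n + t) (len * t) + 1 : ℕ) : ℝ)
        ≤ C₁ * ((I.n : ℝ) + I.m + 1) ^ k₁ * (K * ((I.n : ℝ) + 1) ^ c *
          (2 : ℝ) ^ ((1 - min γ 1 / 2) * (I.n : ℝ))) := by
          gcongr
          exact hsum I.n
      _ ≤ C₁ * ((I.n : ℝ) + I.m + 1) ^ k₁ * (K * ((I.n : ℝ) + I.m + 1) ^ c *
          (2 : ℝ) ^ ((1 - min γ 1 / 2) * (I.n : ℝ))) := by gcongr
      _ = C₁ * K * ((I.n : ℝ) + I.m + 1) ^ (k₁ + c) *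
          (2 : ℝ) ^ ((1 - min γ 1 / 2) * (I.n : ℝ)) := by rw [pow_add]; ring
      _ ≤ _ := by
          gcongr
          exact Nat.le_ceil _
  · refine le_trans (le_of_eq ?_) hηe
    show ((I.m : ℝ≥0∞) + 1) * (guesses t I.m * η) = _
    push_cast
    ring

end RAM

theorem lemma2 (γ : ℝ) (hγ : 0 < γ) :
    (RAM.MonteCarloSolvable RAM.ExactCover (fun n => (2 : ℝ) ^ ((1 - γ) * (n : ℝ))) →
      ∃ δ : ℝ, 0 < δ ∧
        RAM.MonteCarloSolvable RAM.SetCover (fun n => (2 : ℝ) ^ ((1 - δ) * (n : ℝ)))) ∧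
    (RAM.DetSolvable RAM.ExactCover (fun n => (2 : ℝ) ^ ((1 - γ) * (n : ℝ))) →
      ∃ δ : ℝ, 0 < δ ∧
        RAM.DetSolvable RAM.SetCover (fun n => (2 : ℝ) ^ ((1 - δ) * (n : ℝ)))) := by
  constructor
  · rintro ⟨P, C, c, hP⟩
    obtain ⟨δ, hδ, Q, C', c', -, hQ⟩ := RAM.exists_setCoverProg hγ (P := P) (C := C) (c := c)
      (e := ENNReal.ofReal (1 / 3))
      (fun I => by
        obtain ⟨μ, h1, h2, h3⟩ := hP I
        exact ⟨μ, h1, h2, (RAM.two_thirds_le_iff μ fun p => RAM.ExactCover I p.1).1 h3⟩)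
      -- `K` votes with error `1 / (3 * K)` each add up to exactly the permitted `1 / 3`.
      fun K hK => ⟨_, RAM.amplifies_third hK, by
        have hK' : (0 : ℝ) < K := by exact_mod_cast hK
        rw [← ENNReal.ofReal_natCast K, ← ENNReal.ofReal_mul hK'.le]
        refine ENNReal.ofReal_le_ofReal (le_of_eq ?_)
        field_simp⟩
    refine ⟨δ, hδ, Q, C', c', fun I => ?_⟩
    obtain ⟨μ, h1, h2, h3⟩ := hQ I
    exact ⟨μ, h1, h2, (RAM.two_thirds_le_iff μ fun p => RAM.SetCover I p.1).2 h3⟩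
  -- For a deterministic program, being correct on the whole support is the same as error `0`, which
  -- no number of votes increases.
  · rintro ⟨P, C, c, hdet, hP⟩
    obtain ⟨δ, hδ, Q, C', c', hQd, hQ⟩ := RAM.exists_setCoverProg hγ (P := P) (C := C) (c := c)
      (e := 0)
      (fun I => by
        obtain ⟨μ, h1, h2⟩ := hP I
        exact ⟨μ, h1, fun p hp => (h2 p hp).1,
          ((RAM.ev_ind_not_eq_zero_iff μ fun p => RAM.ExactCover I p.1).2
            fun p hp => (h2 p hp).2).le⟩)
      fun K hK => ⟨0, RAM.amplifies_zero (by omega), by simp⟩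
    refine ⟨δ, hδ, Q, C', c', hQd hdet, fun I => ?_⟩
    obtain ⟨μ, h1, h2, h3⟩ := hQ I
    have h4 := (RAM.ev_ind_not_eq_zero_iff μ fun p => RAM.SetCover I p.1).1 (by simpa using h3)
    exact ⟨μ, h1, fun p hp => ⟨h2 p hp, h4 p hp⟩⟩
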